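/- **Setting.** Let $\hat\Omega\subset\mathbb R^2$ be a bounded domain with boundary $\Gamma_f=\partial\hat\Omega$, let $\mathcal T$ be a finite conforming triangulation of $\overline{\hat\Omega}$ with mesh size $h=\max_K \operatorname{diam}K$, and let $\Omega\subset\hat\Omega$ be a subdomain with Lipschitz boundary $\partial\Omega=\Gamma_f\cup\Gamma_\Omega$, where $\Gamma_\Omega$ is closed and disjoint from $\Gamma_f$. Let $n$ be the unit outer normal, $D_nv=\nabla v\cdot n$ (traces on $\partial\Omega$ are taken from inside $\Omega$), and let $$V_h(\Omega)=\{v\in H^1(\Omega): v|_K\in P_1(K)\ \text{for all } K\in\mathcal T \text{ meeting } \Omega\},$$ where $v$ is identified on each triangle $K$ meeting $\Omega$ with its affine extension to all of $K$. Let $\mathcal E_I$ be the set of interior edges of $\mathcal T$ whose two neighbouring triangles both meet $\Omega$, and let $[\![\cdot]\!]$ denote the jump over an edge. For real parameters $\beta,\gamma$ put $$a_h(w,v)=(\nabla w,\nabla v)_\Omega-\langle D_nw,v\rangle_{\Gamma_\Omega}-\langle D_nv,w\rangle_{\Gamma_\Omega}+\beta h^{-1}\langle w,v\rangle_{\Gamma_\Omega}+j(w,v),\qquad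 j(w,v)=\sum_{F\in\mathcal E_I}\gamma h\int_F[\![D_nw]\!][\![D_nv]\!]\,ds,$$ and, for $f$ continuously differentiable in a neighbourhood of $\overline\Omega$, $g_D\in L^2(\Gamma_f)$ and $g_N\in H^{-1/2}(\Gamma_f)$, $$l_h(v)=(f,v)_\Omega+\langle g_N,v\rangle_{\Gamma_f},\qquad \mathcal L_h(\Omega,w,v)=\tfrac12h^{-1}\|g_D-w\|^2_{\Gamma_f}-a_h(w,v)+l_h(v).$$ Assume that $a_h$ is nondegenerate on $V_h(\Omega)$: if $w\in V_h(\Omega)$ and $a_h(w,v)=0$ for all $v\in V_h(\Omega)$, then $w=0$ on $\Omega$. Let $\theta:\mathbb R^2\to\mathbb R^2$ be a $C^1$ vector field with $\theta=0$ on $\Gamma_f$, $T_t(x)=x+t\theta(x)$ and $\Omega_t=T_t(\Omega)$. On $\Omega_t$ use the mapped mesh $\{T_t(K)\}$, the mapped edges $T_t(F)$, $F\in\mathcal E_I$, the mapped space $V_h^t(\Omega_t)=\{v: v\circ T_t\in V_h(\Omega)\}$, the free boundary $\Gamma_{\Omega_t}=\partial\Omega_t\setminus\Gamma_f$, and the same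 $h,\beta,\gamma,f,g_D,g_N$; this defines $a_h$, $l_h$ and $\mathcal L_h(\Omega_t,\cdot,\cdot)$. Let $u_h(t),p_h(t)\in V_h^t(\Omega_t)$ be the solutions of $$a_h(u_h(t),v)=l_h(v),\qquad a_h(p_h(t),v)=h^{-1}\langle u_h(t)-g_D,v\rangle_{\Gamma_f}\qquad\text{for all } v\in V_h^t(\Omega_t),$$ and write $u_h=u_h(0)$, $p_h=p_h(0)$. **Claim.** For all sufficiently small $|t|$ the solutions $u_h(t),p_h(t)$ exist and are unique (as functions on $\Omega_t$, up to null sets), the shape derivative $$D_{\Omega,\theta}\mathcal L_h(\Omega,u_h(\Omega),p_h(\Omega))=\lim_{t\to0}\tfrac1t\bigl(\mathcal L_h(\Omega_t,u_h(t),p_h(t))-\mathcal L_h(\Omega,u_h,p_h)\bigr)$$ exists, and, with $S(\theta)=D\theta+(D\theta)^t$ and $\nabla_\Gamma\cdot\theta=\nabla\cdot\theta-n\cdot D\theta\,n$, $$\begin{aligned} D_{\Omega,\theta}\mathcal L_h={}&\int_\Omega(\nabla\cdot\theta)\,(f p_h-\nabla u_h\cdot\nabla p_h)\,dx+\int_\Omega\nabla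 u_h\cdot S(\theta)\nabla p_h\,dx+\int_\Omega(\nabla f\cdot\theta)\,p_h\,dx\\ &+\int_{\Gamma_\Omega}(\nabla\cdot\theta)(D_nu_h)\,p_h-(S(\theta)\nabla u_h)\cdot n\,p_h\,ds\\ &+\int_{\Gamma_\Omega}(\nabla\cdot\theta)(D_np_h)\,u_h-(S(\theta)\nabla p_h)\cdot n\,u_h\,ds\\ &-\int_{\Gamma_\Omega}\beta h^{-1}(\nabla_\Gamma\cdot\theta)\,u_hp_h\,ds-\sum_{F\in\mathcal E_I}\gamma h\,\epsilon_F(u_h,p_h), \end{aligned}$$ where $$\begin{aligned} \epsilon_F(w,v)={}&\int_F[\![(\nabla\cdot\theta)\nabla w\cdot n-\nabla w\cdot S(\theta)n]\!]\,[\![\nabla v\cdot n]\!]\,ds+\int_F[\![(\nabla\cdot\theta)\nabla v\cdot n-\nabla v\cdot S(\theta)n]\!]\,[\![\nabla w\cdot n]\!]\,ds\\ &-\int_F[\![\nabla w\cdot n]\!]\,[\![\nabla v\cdot n]\!]\,\bigl(\nabla\cdot\theta-(D\theta\,n)\cdot n\bigr)\,ds. \end{aligned}$$ -/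

import Mathlib

open MeasureTheory Set Filter Topology
open scoped Gradient RealInnerProductSpace ENNReal NNReal ContDiff

noncomputable section

namespace CutFEM

/-- The Euclidean plane. -/
abbrev Plane : Type := EuclideanSpace ℝ (Fin 2)

/-! ### Boundaries, normals and traces -/

/-- `D` has a Lipschitz boundary: near every boundary point, in suitable Cartesian coordinates,
`D` is the strict subgraph of a Lipschitz function. -/
def HasLipschitzBoundary (D : Set Plane) : Prop :=
  ∀ x ∈ frontier D, ∃ (e : Plane ≃ₗᵢ[ℝ] Plane) (r : ℝ) (L : ℝ≥0) (φ : ℝ → ℝ),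
    0 < r ∧ LipschitzWith L φ ∧ ∀ y ∈ Metric.ball x r, (y ∈ D ↔ e y 1 < φ (e y 0))

/-- `n` is the unit outer normal to `D` at `x`: to first order at `x`, the set `D` is the half plane
`{y | ⟪y - x, n⟫ < 0}`. There is at most one such `n`. -/
def IsOuterNormal (D : Set Plane) (x n : Plane) : Prop :=
  ‖n‖ = 1 ∧ ∀ ε : ℝ, 0 < ε → ∀ᶠ y in 𝓝 x,
    (y ∈ D → ⟪y - x, n⟫ ≤ ε * ‖y - x‖) ∧ (y ∉ D → -(ε * ‖y - x‖) ≤ ⟪y - x, n⟫)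

open Classical in
/-- The unit outer normal to `D` at `x`, and `0` at the points where there is none. -/
def outerNormal (D : Set Plane) (x : Plane) : Plane :=
  if h : ∃ n, IsOuterNormal D x n then h.choose else 0

/-- Nontangential approach to the boundary point `x` from inside `D`: convergence to `x` within
every cone `{y | c ‖y - x‖ < ⟪x - y, n⟫}`, `c > 0`, about the inner normal direction. -/
def approach (D : Set Plane) (x : Plane) : Filter Plane :=
  ⨆ c : {c : ℝ // 0 < c},
    𝓝[{y : Plane | (c : ℝ) * ‖y - x‖ < ⟪x - y, outerNormal D x⟫}] x

/-- The trace at the boundary point `x` of a function `g` given in `D`: its nontangential limit. -/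
def trace {X : Type*} [TopologicalSpace X] [Nonempty X] (D : Set Plane) (g : Plane → X)
    (x : Plane) : X :=
  limUnder (approach D x) g

/-- The normal derivative `D_n v = ∇v · n` of `v` on the boundary of `D`, taken from inside `D`. -/
def normalDeriv (D : Set Plane) (v : Plane → ℝ) (x : Plane) : ℝ :=
  ⟪trace D (∇ v) x, outerNormal D x⟫

/-! ### Function spaces -/

/-- `v ∈ H¹(D)`: `v` and a weak gradient `g` of `v` are square integrable on `D`. -/
def MemH1 (D : Set Plane) (v : Plane → ℝ) : Prop :=
  MemLp v 2 (volume.restrict D) ∧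
  ∃ g : Plane → Plane, MemLp g 2 (volume.restrict D) ∧
    ∀ φ : Plane → ℝ, ContDiff ℝ ∞ φ → HasCompactSupport φ → tsupport φ ⊆ D →
      ∫ x in D, v x • ∇ φ x = -∫ x in D, φ x • g x

/-- The square of the `H^{1/2}(Γ)` norm (Sobolev-Slobodeckij) on a curve `Γ`. -/
def hHalfNormSq (Γ : Set Plane) (v : Plane → ℝ) : ℝ≥0∞ :=
  (∫⁻ x in Γ, ‖v x‖ₑ ^ 2 ∂μH[1]) +
    ∫⁻ x in Γ, ∫⁻ y in Γ, ‖v x - v y‖ₑ ^ 2 / ‖x - y‖ₑ ^ 2 ∂μH[1] ∂μH[1]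

/-- `ℓ ∈ H^{-1/2}(Γ)`: the linear functional `ℓ` is bounded on `H^{1/2}(Γ)`. (Linear functionals on
`H^{1/2}(Γ)` are written as linear functionals on all functions; the values on functions
outside `H^{1/2}(Γ)` are irrelevant.) -/
def MemHNegHalf (Γ : Set Plane) (ℓ : (Plane → ℝ) →ₗ[ℝ] ℝ) : Prop :=
  ∃ C : ℝ≥0, ∀ v : Plane → ℝ, AEStronglyMeasurable v (μH[1].restrict Γ) →
    ENNReal.ofReal (ℓ v ^ 2) ≤ C * hHalfNormSq Γ v

/-! ### The discretization -/

/-- A fixed background domain `Ωhat`, the physical domain `Ω`, a background mesh (given as a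
geometric simplicial complex), and the Nitsche and ghost penalty parameters. -/
structure Discretization where
  Ωhat : Set Plane
  Ω : Set Plane
  mesh : Geometry.SimplicialComplex ℝ Plane
  β : ℝ
  γ : ℝ

/-- The data of the problem: the source `f`, the Dirichlet datum `g_D` and the Neumann datum `g_N`
(a functional: `gN v` is the pairing `⟨g_N, v⟩` over the fixed boundary). -/
structure Data where
  f : Plane → ℝ
  gD : Plane → ℝ
  gN : (Plane → ℝ) →ₗ[ℝ] ℝ

/-- The open triangle with vertex set `K` (the interior of the convex hull of `K`). -/
def cell (K : Finset Plane) : Set Plane := interior (convexHull ℝ (K : Set Plane))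

/-- A unit normal to the segment with vertex set `F` (either of the two). -/
def faceNormal (F : Finset Plane) : Plane :=
  Classical.epsilon fun n => ‖n‖ = 1 ∧ ∀ a ∈ F, ∀ b ∈ F, ⟪b - a, n⟫ = 0

namespace Discretization

variable (d : Discretization)

/-- The fixed boundary `Γ_f`. -/
def Γf : Set Plane := frontier d.Ωhat

/-- The triangles of the mesh. -/
def triangles : Set (Finset Plane) := {K | K ∈ d.mesh.faces ∧ K.card = 3}

/-- The mesh size `h`, the largest diameter of a triangle. -/
def h : ℝ := sSup ((fun K : Finset Plane => Metric.diam (convexHull ℝ (K : Set Plane))) ''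
  d.triangles)

/-- The triangles that meet the physical domain. -/
def active : Set (Finset Plane) := {K | K ∈ d.triangles ∧ (cell K ∩ d.Ω).Nonempty}

/-- The triangles that have the edge `F`. -/
def adjacent (F : Finset Plane) : Set (Finset Plane) := {K | K ∈ d.triangles ∧ F ⊆ K}

/-- The interior edges of the mesh on which jumps of discrete functions on `Ω` make sense, that is,
those whose neighbouring triangles all meet `Ω`. -/
def interiorFaces : Set (Finset Plane) :=
  {F | F ∈ d.mesh.faces ∧ F.card = 2 ∧ ¬ convexHull ℝ (F : Set Plane) ⊆ frontier d.Ωhat ∧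
    d.adjacent F ⊆ d.active}

/-- The standing assumptions: `Ωhat` is a bounded domain, triangulated by the finite mesh, and `Ω`
is a subdomain with Lipschitz boundary that consists of `Γ_f` and a closed set disjoint from it. -/
structure IsAdmissible : Prop where
  isOpen_hat : IsOpen d.Ωhat
  isConnected_hat : IsConnected d.Ωhat
  isBounded_hat : Bornology.IsBounded d.Ωhat
  finite_mesh : d.mesh.faces.Finite
  space_mesh : d.mesh.space = closure d.Ωhat
  subset_hat : d.Ω ⊆ d.Ωhat
  isOpen : IsOpen d.Ω
  isConnected : IsConnected d.Ω
  lipschitz : HasLipschitzBoundary d.Ω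
  fixed_subset : d.Γf ⊆ frontier d.Ω
  isClosed_free : IsClosed (frontier d.Ω \ d.Γf)

/-- The discrete space `V_h(Ω)`: functions in `H¹(Ω)` that are affine on every (whole) triangle
meeting `Ω`. A function is used only on `Ω` and on the triangles meeting `Ω`. -/
def MemVh (v : Plane → ℝ) : Prop :=
  MemH1 d.Ω v ∧ ∀ K ∈ d.active, ∃ a : Plane →ᵃ[ℝ] ℝ, EqOn v a (cell K)

/-! In what follows `T` is a deformation of the plane, under which the physical domain and the mesh
are moved to `T '' Ω` and to the curved triangles `T '' K`; `T = id` is the undeformed case. The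
background domain, `Γ_f` and the number `h` are not changed. -/

/-- The discrete space on the deformed domain: `v ∘ T ∈ V_h(Ω)`. -/
def MemVhMapped (T : Plane → Plane) (v : Plane → ℝ) : Prop := d.MemVh (v ∘ T)

/-- The free boundary of the deformed domain. -/
def Γfree (T : Plane → Plane) : Set Plane := frontier (T '' d.Ω) \ d.Γf

/-- The jump over the deformed edge `T '' F` of the normal component of a broken vector field `G`:
the sum over the neighbouring triangles of the trace of `G` times the outer normal. -/
def normalJump (T : Plane → Plane) (F : Finset Plane) (G : Plane → Plane) (x : Plane) : ℝ :=
  ∑ᶠ K ∈ d.adjacent F, ⟪trace (T '' cell K) G x, outerNormal (T '' cell K) x⟫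

/-- The ghost penalty form `j`. -/
def ghost (T : Plane → Plane) (w v : Plane → ℝ) : ℝ :=
  ∑ᶠ F ∈ d.interiorFaces, d.γ * d.h *
    ∫ x in T '' convexHull ℝ (F : Set Plane),
      d.normalJump T F (∇ w) x * d.normalJump T F (∇ v) x ∂μH[1]

/-- The bilinear form `a_h` (Nitsche's method with ghost penalty). -/
def a (T : Plane → Plane) (w v : Plane → ℝ) : ℝ :=
  (∫ x in T '' d.Ω, ⟪∇ w x, ∇ v x⟫)
    - (∫ x in d.Γfree T, normalDeriv (T '' d.Ω) w x * trace (T '' d.Ω) v x ∂μH[1])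
    - (∫ x in d.Γfree T, normalDeriv (T '' d.Ω) v x * trace (T '' d.Ω) w x ∂μH[1])
    + d.β * d.h⁻¹ *
      (∫ x in d.Γfree T, trace (T '' d.Ω) w x * trace (T '' d.Ω) v x ∂μH[1])
    + d.ghost T w v

/-- The linear form `l_h(v) = (f, v) + ⟨g_N, v⟩`. -/
def l (g : Data) (T : Plane → Plane) (v : Plane → ℝ) : ℝ :=
  (∫ x in T '' d.Ω, g.f x * v x) + g.gN (trace (T '' d.Ω) v)

/-- The discrete Lagrangian `L_h`. -/
def lagrangian (g : Data) (T : Plane → Plane) (w v : Plane → ℝ) : ℝ :=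
  1 / 2 * d.h⁻¹ * (∫ x in d.Γf, (g.gD x - trace (T '' d.Ω) w x) ^ 2 ∂μH[1])
    - d.a T w v + d.l g T v

/-- `u` solves the discrete primal problem. -/
def IsPrimal (g : Data) (T : Plane → Plane) (u : Plane → ℝ) : Prop :=
  d.MemVhMapped T u ∧ ∀ v, d.MemVhMapped T v → d.a T u v = d.l g T v

/-- `p` solves the discrete dual problem for the primal function `u`. -/
def IsDual (g : Data) (T : Plane → Plane) (u p : Plane → ℝ) : Prop :=
  d.MemVhMapped T p ∧ ∀ v, d.MemVhMapped T v →
    d.a T p v = d.h⁻¹ *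
      ∫ x in d.Γf, (trace (T '' d.Ω) u x - g.gD x) * trace (T '' d.Ω) v x ∂μH[1]

/-- `a_h` is nondegenerate on `V_h(Ω)`, i.e. the discrete problem on `Ω` is well posed. -/
def IsWellPosed : Prop :=
  ∀ w, d.MemVh w → (∀ v, d.MemVh v → d.a id w v = 0) → w =ᵐ[volume.restrict d.Ω] 0

end Discretization

/-! ### Shape derivative -/

/-- The perturbation `T_{t,θ} = id + t θ` of the identity. -/
def perturb (θ : Plane → Plane) (t : ℝ) (x : Plane) : Plane := x + t • θ x

/-- The divergence `∇ · θ`. -/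
def div (θ : Plane → Plane) (x : Plane) : ℝ :=
  ∑ i, fderiv ℝ θ x (EuclideanSpace.single i 1) i

/-- The symmetric gradient `S(θ) = Dθ + (Dθ)ᵗ`. -/
def S (θ : Plane → Plane) (x : Plane) : Plane →L[ℝ] Plane :=
  fderiv ℝ θ x + ContinuousLinearMap.adjoint (fderiv ℝ θ x)

/-- The tangential divergence `∇_Γ · θ = ∇ · θ - n · Dθ n` at `x` for the unit normal `n`. -/
def tangentialDiv (θ : Plane → Plane) (n x : Plane) : ℝ :=
  div θ x - ⟪fderiv ℝ θ x n, n⟫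

namespace Discretization

variable (d : Discretization)

/-- The face term `ε_F(w, v)`. -/
def faceTerm (θ : Plane → Plane) (F : Finset Plane) (w v : Plane → ℝ) : ℝ :=
  (∫ x in convexHull ℝ (F : Set Plane),
      d.normalJump id F (fun y => div θ y • ∇ w y - S θ y (∇ w y)) x *
        d.normalJump id F (∇ v) x ∂μH[1])
    + (∫ x in convexHull ℝ (F : Set Plane),
      d.normalJump id F (fun y => div θ y • ∇ v y - S θ y (∇ v y)) x *
        d.normalJump id F (∇ w) x ∂μH[1])
    - ∫ x in convexHull ℝ (F : Set Plane),
      d.normalJump id F (∇ w) x * d.normalJump id F (∇ v) x *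
        tangentialDiv θ (faceNormal F) x ∂μH[1]

/-- The boundary term
`∫_Γ (∇·θ) (D_n w) v - (S(θ) ∇w)·n v ds` over the free boundary of `Ω`. -/
def nitscheTerm (θ : Plane → Plane) (w v : Plane → ℝ) : ℝ :=
  ∫ x in d.Γfree id, (div θ x * normalDeriv d.Ω w x * trace d.Ω v x
    - ⟪S θ x (trace d.Ω (∇ w) x), outerNormal d.Ω x⟫ * trace d.Ω v x) ∂μH[1]

end Discretization

end CutFEM

end

open CutFEM

/-! Everything is pulled back to the fixed domain `Ω`. There the discrete problem is a finite linear
system `A(t) U(t) = L(t)` with coefficients differentiable at `t = 0`, and the shape derivative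
follows by the adjoint method.

A discrete function on `T_t(Ω)`, composed with `T_t`, is affine on each active triangle, so it is
given by one pair (gradient, constant) per triangle (`Coeff`). The condition `v ∘ T_t ∈ H¹(Ω)` cuts
out a subspace `coeffSpace` that does not depend on `t`. With `N = DT_t = 1 + t Dθ`, gradients
transform by `(det N)⁻¹ cof N`, normals by `cof N n / ‖cof N n‖`, and arc length by the factor `‖cof
N n‖`. Hence every term of `a_h` becomes an integral over a fixed set of an explicit function of
`N`, the normal, and the gradients and values of the two functions (`a_eq_formA`). In the plane `cof
M = tr M - Mᵀ`, so differentiating at `t = 0` produces exactly `div θ`, `S(θ)` and the tangential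
divergence (`hasDerivAt_formA`). In `l_h` only the volume integral moves, because `g_N` acts on
`Γ_f`, which `T_t` fixes (`l_eq_formL`, `hasDerivAt_formL`).

Since `p_h(t)` is an admissible test function, `a_h(u_h, p_h) = l_h(p_h)`, and the Lagrangian
collapses to the misfit, a fixed quadratic function of `U(t)` (`lagrangian_eq`). Its gradient at
`U(0)` is `A(0) P` by the dual equation, and `A(0)` is symmetric, so the derivative is `P · A(0) U'
= P · (L' - A' U(0))` (`hasDerivAt_quadratic_of_linear_system`). Nondegeneracy means `det A(0) ≠ 0`;
this gives unique solvability for small `t` and the differentiability of `U`. The dual solution is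
never differentiated.

The analytic work is in the traces, which are nontangential limits at a merely Lipschitz boundary
that cuts the mesh arbitrarily. At almost every boundary point there is a normal, and every cone
about the inner normal lies near the point in a single triangle (`ae_approach_le_cell`): mesh edges
transversal to the boundary meet it in a null set, and tangential ones miss the cone. Thus traces
are values of affine functions. The arc length formula (`setIntegral_image_boundary`) is obtained
for Hausdorff measure by cutting the curve into pieces on which `T` is almost a similarity.

Finally, `θ` need not be bounded or Lipschitz, so it is first replaced by a compactly supported
field that agrees with it near the closure of `Ωhat`; then `T_t` is a diffeomorphism of the whole
plane for small `t`. -/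

noncomputable section

namespace CutFEM

/-! ### Linear algebra in the plane -/

/-- The rotation of the plane by a right angle. -/
def rot : Plane →L[ℝ] Plane :=
  LinearMap.toContinuousLinearMap
    { toFun := fun v => !₂[-v 1, v 0]
      map_add' := fun u v => by ext i; fin_cases i <;> simp; ring
      map_smul' := fun c v => by ext i; fin_cases i <;> simp }

@[simp] lemma rot_zero_coord (v : Plane) : rot v 0 = -v 1 := rfl

@[simp] lemma rot_one_coord (v : Plane) : rot v 1 = v 0 := rfl

lemma inner_plane (u v : Plane) : ⟪u, v⟫ = u 0 * v 0 + u 1 * v 1 := by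
  simp [PiLp.inner_apply, Fin.sum_univ_two, mul_comm]

lemma norm_sq_plane (u : Plane) : ‖u‖ ^ 2 = u 0 ^ 2 + u 1 ^ 2 := by
  rw [← real_inner_self_eq_norm_sq, inner_plane]; ring

lemma plane_ext {u v : Plane} (h0 : u 0 = v 0) (h1 : u 1 = v 1) : u = v := by
  ext i; fin_cases i
  · exact h0
  · exact h1

@[simp] lemma rot_rot (v : Plane) : rot (rot v) = -v := by
  apply plane_ext <;> simp

@[simp] lemma norm_rot (v : Plane) : ‖rot v‖ = ‖v‖ := by
  rw [← sq_eq_sq₀ (norm_nonneg _) (norm_nonneg _), norm_sq_plane, norm_sq_plane]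
  simp; ring

/-- The cofactor matrix (the transpose of the adjugate) of a linear endomorphism of the plane. -/
def cof (N : Plane →L[ℝ] Plane) : Plane →L[ℝ] Plane := rot ∘L N ∘L (-rot)

lemma cof_apply (N : Plane →L[ℝ] Plane) (v : Plane) : cof N v = rot (N (-rot v)) := rfl

lemma norm_cof_apply (N : Plane →L[ℝ] Plane) (v : Plane) : ‖cof N v‖ = ‖N (rot v)‖ := by
  rw [cof_apply, norm_rot, map_neg, norm_neg]

lemma cof_add (M N : Plane →L[ℝ] Plane) : cof (M + N) = cof M + cof N := by
  ext v; simp [cof]; ring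

lemma cof_smul (c : ℝ) (N : Plane →L[ℝ] Plane) : cof (c • N) = c • cof N := by
  ext v; simp [cof]

lemma cof_one : cof 1 = 1 := by
  ext v; simp [cof]

/-- The standard basis vectors. -/
abbrev e₀ : Plane := EuclideanSpace.single 0 1

/-- The standard basis vectors. -/
abbrev e₁ : Plane := EuclideanSpace.single 1 1

lemma plane_decomp (v : Plane) : v = v 0 • e₀ + v 1 • e₁ := by
  apply plane_ext <;> simp

lemma map_plane_apply (N : Plane →L[ℝ] Plane) (v : Plane) (i : Fin 2) :
    N v i = v 0 * N e₀ i + v 1 * N e₁ i := by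
  conv_lhs => rw [plane_decomp v]
  simp

/-- The determinant of a linear endomorphism of the plane in coordinates. -/
def det₂ (N : Plane →L[ℝ] Plane) : ℝ := N e₀ 0 * N e₁ 1 - N e₁ 0 * N e₀ 1

lemma det_eq_det₂ (N : Plane →L[ℝ] Plane) : N.det = det₂ N := by
  rw [ContinuousLinearMap.det,
    ← LinearMap.det_toMatrix (EuclideanSpace.basisFun (Fin 2) ℝ).toBasis, Matrix.det_fin_two]
  simp [LinearMap.toMatrix_apply, det₂]

/-- This is `Nᵀ cof N = det N`, the identity behind the transformation of gradients and of normals.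
-/
lemma inner_map_cof (N : Plane →L[ℝ] Plane) (u v : Plane) :
    ⟪N u, cof N v⟫ = det₂ N * ⟪u, v⟫ := by
  simp only [inner_plane, cof_apply, rot_zero_coord, rot_one_coord]
  rw [map_plane_apply N u 0, map_plane_apply N u 1, map_plane_apply N (-rot v) 0,
    map_plane_apply N (-rot v) 1]
  simp [det₂]; ring

/-- The trace of a linear endomorphism of the plane in coordinates. -/
def tr₂ (N : Plane →L[ℝ] Plane) : ℝ := N e₀ 0 + N e₁ 1

/-- In dimension two `cof N = tr N - Nᵀ`. At `N = Dθ` this is the source of the combination of `div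
θ` and `Dθ` in all the derivatives below. -/
lemma cof_eq (N : Plane →L[ℝ] Plane) (u v : Plane) :
    ⟪cof N u, v⟫ = tr₂ N * ⟪u, v⟫ - ⟪u, N v⟫ := by
  simp only [inner_plane, cof_apply, rot_zero_coord, rot_one_coord]
  rw [map_plane_apply N v 0, map_plane_apply N v 1, map_plane_apply N (-rot u) 0,
    map_plane_apply N (-rot u) 1]
  simp [tr₂]; ring

lemma det₂_one_add_smul (M : Plane →L[ℝ] Plane) (t : ℝ) :
    det₂ (1 + t • M) = 1 + t * tr₂ M + t ^ 2 * det₂ M := by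
  simp [det₂, tr₂]; ring

lemma cof_ne_zero {N : Plane →L[ℝ] Plane} (hN : det₂ N ≠ 0) {v : Plane} (hv : v ≠ 0) :
    cof N v ≠ 0 := by
  intro h
  have := inner_map_cof N v v
  rw [h, inner_zero_right] at this
  have hvv : ⟪v, v⟫ ≠ 0 := inner_self_ne_zero.2 hv
  exact (mul_ne_zero hN hvv) this.symm

lemma div_eq_tr₂ (θ : Plane → Plane) (x : Plane) : div θ x = tr₂ (fderiv ℝ θ x) := by
  simp [div, tr₂, Fin.sum_univ_two]

lemma inner_S (θ : Plane → Plane) (x u v : Plane) :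
    ⟪S θ x u, v⟫ = ⟪fderiv ℝ θ x u, v⟫ + ⟪u, fderiv ℝ θ x v⟫ := by
  simp [S, inner_add_left, ContinuousLinearMap.adjoint_inner_left]

lemma continuous_det₂ : Continuous det₂ := by
  unfold det₂; fun_prop

lemma isUnit_of_det₂ {N : Plane →L[ℝ] Plane} (hN : det₂ N ≠ 0) :
    ∃ e : Plane ≃L[ℝ] Plane, (e : Plane →L[ℝ] Plane) = N := by
  have : N.det ≠ 0 := by rwa [det_eq_det₂]
  exact ⟨N.toContinuousLinearEquivOfDetNeZero this, by ext; simp⟩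

/-- The chain rule for gradients under a change of variables. -/
lemma hasGradientAt_of_comp {T : Plane ≃ₜ Plane} {x g : Plane} {N : Plane →L[ℝ] Plane}
    (hT : HasFDerivAt T N x) (hN : det₂ N ≠ 0) {w : Plane → ℝ}
    (hw : HasGradientAt (w ∘ T) g x) :
    HasGradientAt w ((det₂ N)⁻¹ • cof N g) (T x) := by
  obtain ⟨e, rfl⟩ := isUnit_of_det₂ hN
  have hs : HasFDerivAt T.symm (e.symm : Plane →L[ℝ] Plane) (T x) := by
    apply HasFDerivAt.of_local_left_inverse (f := T)
    · exact T.symm.continuous.continuousAt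
    · simpa using hT
    · exact Eventually.of_forall T.apply_symm_apply
  have hw' : HasFDerivAt (w ∘ T) (InnerProductSpace.toDual ℝ Plane g) (T.symm (T x)) := by
    simpa using hw.hasFDerivAt
  have := hw'.comp (T x) hs
  have h2 : (w ∘ T) ∘ T.symm = w := by ext; simp
  rw [h2] at this
  rw [hasGradientAt_iff_hasFDerivAt]
  refine this.congr_fderiv (ContinuousLinearMap.ext fun z => ?_)
  obtain ⟨u, rfl⟩ := e.surjective z
  have h4 : ⟪cof (e : Plane →L[ℝ] Plane) g, e u⟫ = det₂ (e : Plane →L[ℝ] Plane) * ⟪g, u⟫ := by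
    rw [real_inner_comm, real_inner_comm u g]; exact inner_map_cof (e : Plane →L[ℝ] Plane) u g
  simp [h4, hN]

/-! ### Outer normals and nontangential approach -/

lemma IsOuterNormal.ne_zero {D : Set Plane} {x n : Plane} (h : IsOuterNormal D x n) : n ≠ 0 := by
  rintro rfl
  simpa using h.1

lemma tendsto_ray (x v : Plane) : Tendsto (fun s : ℝ => x + s • v) (𝓝[>] 0) (𝓝 x) := by
  have : Tendsto (fun s : ℝ => x + s • v) (𝓝 0) (𝓝 (x + (0 : ℝ) • v)) :=
    (Continuous.tendsto (by fun_prop) 0)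
  simpa using this.mono_left nhdsWithin_le_nhds

/-- The ray from `x` in the direction `n - m` points strictly outwards according to `n` and strictly
inwards according to `m`. The tolerance `δ` is half of the gap `1 - ⟪m, n⟫`, relative to the length
of `n - m`, so neither condition can absorb the contradiction. -/
lemma IsOuterNormal.unique {D : Set Plane} {x m n : Plane} (hm : IsOuterNormal D x m)
    (hn : IsOuterNormal D x n) : m = n := by
  by_contra hne
  have hlt : ⟪m, n⟫ < 1 := (inner_lt_one_iff_real_of_norm_eq_one hm.1 hn.1).2 hne
  have hv : 0 < ‖n - m‖ := norm_pos_iff.2 (sub_ne_zero.2 (Ne.symm hne))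
  set δ : ℝ := (1 - ⟪m, n⟫) / (2 * ‖n - m‖)
  have hδ : 0 < δ := div_pos (by linarith) (by linarith)
  have hδv : δ * ‖n - m‖ = (1 - ⟪m, n⟫) / 2 := by simp only [δ]; field_simp
  have e1 := (tendsto_ray x (n - m)).eventually (hm.2 δ hδ)
  have e2 := (tendsto_ray x (n - m)).eventually (hn.2 δ hδ)
  obtain ⟨s, ⟨⟨h1, h2⟩, hs⟩⟩ := ((e1.and e2).and self_mem_nhdsWithin).exists
  have hs : 0 < s := hs
  have hmm : ⟪m, m⟫ = 1 := by rw [real_inner_self_eq_norm_sq, hm.1]; norm_num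
  have hnn : ⟪n, n⟫ = 1 := by rw [real_inner_self_eq_norm_sq, hn.1]; norm_num
  have hnm : ⟪n, m⟫ = ⟪m, n⟫ := real_inner_comm _ _
  simp only [add_sub_cancel_left, inner_smul_left, inner_sub_left, norm_smul, Real.norm_eq_abs,
    abs_of_pos hs, hmm, hnn, hnm, conj_trivial] at h1 h2
  have h3 : δ * (s * ‖n - m‖) = s * ((1 - ⟪m, n⟫) / 2) := by rw [← hδv]; ring
  rw [h3] at h1 h2
  have h4 : 0 < s * (1 - ⟪m, n⟫) := mul_pos hs (by linarith)
  by_cases hD : x + s • (n - m) ∈ D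
  · have := h2.1 hD
    nlinarith
  · have := h1.2 hD
    nlinarith

lemma IsOuterNormal.outerNormal_eq {D : Set Plane} {x n : Plane} (h : IsOuterNormal D x n) :
    outerNormal D x = n := by
  have hex : ∃ n, IsOuterNormal D x n := ⟨n, h⟩
  rw [outerNormal, dif_pos hex]
  exact hex.choose_spec.unique h

lemma isOuterNormal_outerNormal {D : Set Plane} {x : Plane} (h : ∃ n, IsOuterNormal D x n) :
    IsOuterNormal D x (outerNormal D x) := by
  obtain ⟨n, hn⟩ := h
  rwa [hn.outerNormal_eq]

/-- Tolerance and radius may be restricted to the values `1/(k+1)` and `1/(m+1)`. For fixed values,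
with the strict bound on `‖y - x‖`, the condition is closed in `(x, n)`: a point `y` within the
radius of a limit is within the radius of nearby pairs. -/
lemma measurableSet_isOuterNormal (D : Set Plane) :
    MeasurableSet {p : Plane × Plane | IsOuterNormal D p.1 p.2} := by
  have key : {p : Plane × Plane | IsOuterNormal D p.1 p.2} =
      {p | ‖p.2‖ = 1} ∩ ⋂ k : ℕ, ⋃ m : ℕ, {p | ∀ y, ‖y - p.1‖ < 1 / ((m : ℝ) + 1) →
        (y ∈ D → ⟪y - p.1, p.2⟫ ≤ 1 / ((k : ℝ) + 1) * ‖y - p.1‖) ∧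
        (y ∉ D → -(1 / ((k : ℝ) + 1) * ‖y - p.1‖) ≤ ⟪y - p.1, p.2⟫)} := by
    ext ⟨x, n⟩
    simp only [IsOuterNormal, mem_ofPred_eq, mem_inter_iff, mem_iInter, mem_iUnion]
    refine and_congr_right fun _ => ⟨fun h k => ?_, fun h ε hε => ?_⟩
    · obtain ⟨r, hr, h'⟩ := Metric.eventually_nhds_iff.1 (h (1 / ((k : ℝ) + 1)) (by positivity))
      obtain ⟨m, hm⟩ := exists_nat_one_div_lt hr
      exact ⟨m, fun y hy => h' (by rw [dist_eq_norm]; exact hy.trans hm)⟩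
    · obtain ⟨k, hk⟩ := exists_nat_one_div_lt hε
      obtain ⟨m, hm⟩ := h k
      refine Metric.eventually_nhds_iff.2 ⟨1 / ((m : ℝ) + 1), by positivity, fun y hy => ?_⟩
      rw [dist_eq_norm] at hy
      have hle : 1 / ((k : ℝ) + 1) * ‖y - x‖ ≤ ε * ‖y - x‖ := by gcongr
      exact ⟨fun hD => ((hm y hy).1 hD).trans hle,
        fun hD => (neg_le_neg hle).trans ((hm y hy).2 hD)⟩
  rw [key]
  refine (measurableSet_eq_fun (by fun_prop) (by fun_prop)).inter
    (MeasurableSet.iInter fun k => MeasurableSet.iUnion fun m => IsClosed.measurableSet ?_)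
  refine isClosed_of_closure_subset fun p hp y hy => ?_
  have hy' : ∀ᶠ q : Plane × Plane in 𝓝 p, ‖y - q.1‖ < 1 / ((m : ℝ) + 1) :=
    (Continuous.tendsto (by fun_prop : Continuous fun q : Plane × Plane => ‖y - q.1‖) p).eventually
      (gt_mem_nhds hy)
  have hfr := (mem_closure_iff_frequently.1 hp).and_eventually hy'
  refine ⟨fun hD => ?_, fun hD => ?_⟩
  · have hc : IsClosed {q : Plane × Plane | ⟪y - q.1, q.2⟫ ≤ 1 / ((k : ℝ) + 1) * ‖y - q.1‖} :=
      isClosed_le (by fun_prop) (by fun_prop)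
    exact hc.closure_subset (mem_closure_iff_frequently.2 (hfr.mono fun q hq => (hq.1 y hq.2).1 hD))
  · have hc : IsClosed {q : Plane × Plane | -(1 / ((k : ℝ) + 1) * ‖y - q.1‖) ≤ ⟪y - q.1, q.2⟫} :=
      isClosed_le (by fun_prop) (by fun_prop)
    exact hc.closure_subset (mem_closure_iff_frequently.2 (hfr.mono fun q hq => (hq.1 y hq.2).2 hD))

/-- The relation "n is the normal at x" is Borel in the product, and by uniqueness it projects
injectively to `x`. By the Lusin–Souslin theorem injective measurable images of Borel sets are
Borel. -/
lemma measurable_outerNormal (D : Set Plane) : Measurable (outerNormal D) := by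
  have himg : ∀ B : Set Plane, MeasurableSet B →
      MeasurableSet {x | ∃ n ∈ B, IsOuterNormal D x n} := by
    intro B hB
    have hm : MeasurableSet ({p : Plane × Plane | IsOuterNormal D p.1 p.2} ∩ Prod.snd ⁻¹' B) :=
      (measurableSet_isOuterNormal D).inter (measurable_snd hB)
    have := hm.image_of_measurable_injOn measurable_fst (fun p hp q hq hpq => by
      refine Prod.ext hpq ?_
      have h1 : IsOuterNormal D p.1 p.2 := hp.1
      rw [hpq] at h1
      exact h1.unique hq.1)
    convert this using 1
    ext x
    constructor
    · rintro ⟨n, hn, h⟩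
      exact ⟨(x, n), ⟨h, hn⟩, rfl⟩
    · rintro ⟨⟨y, n⟩, ⟨h, hn⟩, rfl⟩
      exact ⟨n, hn, h⟩
  intro B hB
  have hN := himg univ MeasurableSet.univ
  have : outerNormal D ⁻¹' B = {x | ∃ n ∈ B, IsOuterNormal D x n} ∪
      ({x | ∃ n ∈ univ, IsOuterNormal D x n}ᶜ ∩ {_x | (0 : Plane) ∈ B}) := by
    ext x
    by_cases h : ∃ n, IsOuterNormal D x n
    · obtain ⟨n, hn⟩ := h
      constructor
      · intro hx
        rw [mem_preimage, hn.outerNormal_eq] at hx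
        exact Or.inl ⟨n, hx, hn⟩
      · rintro (⟨m, hm, h⟩ | ⟨h, _⟩)
        · rwa [mem_preimage, h.outerNormal_eq]
        · exact absurd ⟨n, mem_univ _, hn⟩ h
    · have h0 : outerNormal D x = 0 := by rw [outerNormal, dif_neg h]
      rw [mem_preimage, h0]
      constructor
      · exact fun hx => Or.inr ⟨by rintro ⟨n, _, hn⟩; exact h ⟨n, hn⟩, hx⟩
      · rintro (⟨m, _, hm⟩ | ⟨_, hx⟩)
        · exact absurd ⟨m, hm⟩ h
        · exact hx
  rw [this]
  exact (himg B hB).union (hN.compl.inter (MeasurableSet.const _))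

/-- Along the boundary, the tangent at a point with a normal is perpendicular to the normal. -/
lemma IsOuterNormal.abs_inner_le {D : Set Plane} {x n : Plane} (h : IsOuterNormal D x n) {ε : ℝ}
    (hε : 0 < ε) : ∀ᶠ y in 𝓝 x, y ∈ frontier D → |⟪y - x, n⟫| ≤ ε * ‖y - x‖ := by
  -- A frontier point is a limit of points of `D` and of points outside `D`; each kind passes one of
  -- the two closed inequalities on to it.
  filter_upwards [(h.2 ε hε).eventually_nhds] with y hy hyD
  have hcl : y ∈ closure D := frontier_subset_closure hyD
  have hcl' : y ∈ closure Dᶜ := by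
    rw [frontier_eq_closure_inter_closure] at hyD
    exact hyD.2
  refine abs_le.2 ⟨?_, ?_⟩
  · have hc : IsClosed {z : Plane | -(ε * ‖z - x‖) ≤ ⟪z - x, n⟫} :=
      isClosed_le (by fun_prop) (by fun_prop)
    exact hc.closure_subset (mem_closure_iff_frequently.2
      (((mem_closure_iff_frequently.1 hcl').and_eventually hy).mono fun z hz => hz.2.2 hz.1))
  · have hc : IsClosed {z : Plane | ⟪z - x, n⟫ ≤ ε * ‖z - x‖} :=
      isClosed_le (by fun_prop) (by fun_prop)
    exact hc.closure_subset (mem_closure_iff_frequently.2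
      (((mem_closure_iff_frequently.1 hcl).and_eventually hy).mono fun z hz => hz.2.1 hz.1))

lemma mem_approach {D : Set Plane} {x : Plane} {s : Set Plane} :
    s ∈ approach D x ↔ ∀ c : ℝ, 0 < c →
      ∀ᶠ y in 𝓝 x, c * ‖y - x‖ < ⟪x - y, outerNormal D x⟫ → y ∈ s := by
  simp only [approach, mem_iSup, Subtype.forall, mem_nhdsWithin_iff_eventually, mem_ofPred_eq]

lemma approach_le_nhds (D : Set Plane) (x : Plane) : approach D x ≤ 𝓝 x :=
  iSup_le fun _ => nhdsWithin_le_nhds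

lemma IsOuterNormal.approach_le {D : Set Plane} {x n : Plane} (h : IsOuterNormal D x n) :
    approach D x ≤ 𝓟 D := by
  rw [le_principal_iff, mem_approach]
  intro c hc
  rw [h.outerNormal_eq]
  filter_upwards [h.2 c hc] with y hy hlt
  by_contra hD
  have := hy.2 hD
  rw [← neg_sub x y, inner_neg_left, neg_sub] at this
  linarith

lemma tendsto_approach {D : Set Plane} {x n : Plane} (h : IsOuterNormal D x n) :
    Tendsto (fun s : ℝ => x + s • (-n)) (𝓝[>] 0) (approach D x) := by
  -- Any aperture constant below `1` would do: the cone then contains the inner normal ray.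
  have hle : 𝓝[{y : Plane | (1 / 2 : ℝ) * ‖y - x‖ < ⟪x - y, outerNormal D x⟫}] x ≤
      approach D x :=
    le_iSup (fun c : {c : ℝ // 0 < c} =>
      𝓝[{y : Plane | (c : ℝ) * ‖y - x‖ < ⟪x - y, outerNormal D x⟫}] x) ⟨1 / 2, by norm_num⟩
  refine Tendsto.mono_right ?_ hle
  refine tendsto_nhdsWithin_iff.2 ⟨tendsto_ray x (-n), ?_⟩
  filter_upwards [self_mem_nhdsWithin] with s (hs : 0 < s)
  simp [h.outerNormal_eq, norm_smul, h.1, abs_of_pos hs, inner_smul_left]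
  linarith

lemma approach_neBot {D : Set Plane} {x n : Plane} (h : IsOuterNormal D x n) :
    (approach D x).NeBot :=
  (tendsto_approach h).neBot

lemma trace_eq {X : Type*} [TopologicalSpace X] [T2Space X] [Nonempty X] {D : Set Plane}
    {x n : Plane} (h : IsOuterNormal D x n) {g : Plane → X} {L : X}
    (hg : Tendsto g (approach D x) (𝓝 L)) : trace D g x = L := by
  have := approach_neBot h
  exact hg.limUnder_eq

/-! ### Transformation under diffeomorphisms -/

lemma hasFDerivAt_symm {T : Plane ≃ₜ Plane} {x : Plane} {e : Plane ≃L[ℝ] Plane}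
    (hT : HasFDerivAt T (e : Plane →L[ℝ] Plane) x) :
    HasFDerivAt T.symm (e.symm : Plane →L[ℝ] Plane) (T x) := by
  apply HasFDerivAt.of_local_left_inverse (f := T)
  · exact T.symm.continuous.continuousAt
  · simpa using hT
  · exact Eventually.of_forall T.apply_symm_apply

section Transform

variable {T : Plane ≃ₜ Plane} {x : Plane} {N : Plane →L[ℝ] Plane}

lemma exists_norm_symm_sub_le (hT : HasFDerivAt T N x) (hN : 0 < det₂ N) :
    ∃ C : ℝ, 0 < C ∧ ∀ᶠ z in 𝓝 (T x), ‖T.symm z - x‖ ≤ C * ‖z - T x‖ := by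
  obtain ⟨e, rfl⟩ := isUnit_of_det₂ hN.ne'
  obtain ⟨C, hC, h⟩ := (hasFDerivAt_symm hT).isBigO_sub.exists_pos
  exact ⟨C, hC, by simpa using h.bound⟩

/-- To first order `z - T x = N (T⁻¹ z - x)`, and pairing with `cof N n` gives `det N ⟪T⁻¹ z - x,
n⟫`. So heights over the tangent line are multiplied by the positive factor `det N / ‖cof N n‖`. -/
lemma isLittleO_inner_normal (hT : HasFDerivAt T N x) (hN : 0 < det₂ N) (n : Plane) :
    (fun z => ⟪z - T x, ‖cof N n‖⁻¹ • cof N n⟫ - det₂ N / ‖cof N n‖ * ⟪T.symm z - x, n⟫)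
      =o[𝓝 (T x)] fun z => z - T x := by
  obtain ⟨e, rfl⟩ := isUnit_of_det₂ hN.ne'
  set N : Plane →L[ℝ] Plane := (e : Plane →L[ℝ] Plane)
  have h1 : (fun z => T.symm z - T.symm (T x)) =O[𝓝 (T x)] fun z => z - T x :=
    (hasFDerivAt_symm hT).isBigO_sub
  have hT' : HasFDerivAt T N (T.symm (T x)) := by simpa using hT
  have h2 : (fun z => T (T.symm z) - T (T.symm (T x)) - N (T.symm z - T.symm (T x)))
      =o[𝓝 (T x)] fun z => T.symm z - T.symm (T x) :=
    hT'.isLittleO.comp_tendsto T.symm.continuous.continuousAt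
  have h3 : (fun z => z - T x - N (T.symm z - x)) =o[𝓝 (T x)] fun z => z - T x := by
    simpa using h2.trans_isBigO h1
  have h4 : (fun z => ⟪z - T x - N (T.symm z - x), ‖cof N n‖⁻¹ • cof N n⟫)
      =O[𝓝 (T x)] fun z => z - T x - N (T.symm z - x) :=
    Asymptotics.IsBigO.of_bound ‖‖cof N n‖⁻¹ • cof N n‖ (Eventually.of_forall fun z => by
      rw [mul_comm]; exact norm_inner_le_norm _ _)
  refine (h4.trans_isLittleO h3).congr_left fun z => ?_
  rw [inner_sub_left, inner_smul_right _ (cof N n), inner_smul_right _ (cof N n),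
    inner_map_cof N (T.symm z - x) n]
  ring

lemma IsOuterNormal.image {D : Set Plane} {n : Plane} (h : IsOuterNormal D x n)
    (hT : HasFDerivAt T N x) (hN : 0 < det₂ N) :
    IsOuterNormal (T '' D) (T x) (‖cof N n‖⁻¹ • cof N n) := by
  have hc : 0 < ‖cof N n‖ := norm_pos_iff.2 (cof_ne_zero hN.ne' h.ne_zero)
  refine ⟨by rw [norm_smul, norm_inv, norm_norm, inv_mul_cancel₀ hc.ne'], fun ε hε => ?_⟩
  obtain ⟨C, hC, hb⟩ := exists_norm_symm_sub_le hT hN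
  set κ := det₂ N / ‖cof N n‖ with hκ_def
  have hκ : 0 < κ := div_pos hN hc
  have ho := (isLittleO_inner_normal hT hN n).bound (half_pos hε)
  -- After the scaling by `κ` and the bound `C` for the inverse map, this tolerance costs `ε / 2`;
  -- the other half pays for the linearization error.
  have hη : 0 < ε / (2 * κ * C) := by positivity
  have hs : Tendsto T.symm (𝓝 (T x)) (𝓝 x) := by
    simpa using T.symm.continuous.tendsto (T x)
  filter_upwards [hb, ho, hs.eventually (h.2 _ hη)] with z hz1 hz2 hz3
  rw [Real.norm_eq_abs, abs_le] at hz2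
  have hle : ε / (2 * κ * C) * ‖T.symm z - x‖ ≤ ε / (2 * κ) * ‖z - T x‖ := by
    calc _ ≤ ε / (2 * κ * C) * (C * ‖z - T x‖) := by gcongr
      _ = _ := by field_simp
  have hκe : κ * (ε / (2 * κ) * ‖z - T x‖) = ε / 2 * ‖z - T x‖ := by field_simp
  have hmem : z ∈ T '' D ↔ T.symm z ∈ D := by
    rw [T.image_eq_preimage_symm]; rfl
  rw [hmem]
  refine ⟨fun hD => ?_, fun hD => ?_⟩
  · have := mul_le_mul_of_nonneg_left ((hz3.1 hD).trans hle) hκ.le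
    linarith [hz2.2]
  · have := mul_le_mul_of_nonneg_left ((neg_le_neg hle).trans (hz3.2 hD)) hκ.le
    linarith [hz2.1]

/-- The preimage of a cone with constant `c` about the new normal lies, near `x`, in the cone with
constant `c / (2 κ C)` about the old one. Apertures change under `T`, which is harmless because
`approach` involves all of them. -/
lemma approach_image_le {D : Set Plane} {n : Plane} (h : IsOuterNormal D x n)
    (hT : HasFDerivAt T N x) (hN : 0 < det₂ N) :
    approach (T '' D) (T x) ≤ map T (approach D x) := by
  intro s hs
  rw [mem_map, mem_approach, h.outerNormal_eq] at hs
  rw [mem_approach, (h.image hT hN).outerNormal_eq]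
  intro c hcpos
  have hc : 0 < ‖cof N n‖ := norm_pos_iff.2 (cof_ne_zero hN.ne' h.ne_zero)
  obtain ⟨C, hC, hb⟩ := exists_norm_symm_sub_le hT hN
  set κ := det₂ N / ‖cof N n‖ with hκ_def
  have hκ : 0 < κ := div_pos hN hc
  have ho := (isLittleO_inner_normal hT hN n).bound (half_pos hcpos)
  have hst : Tendsto T.symm (𝓝 (T x)) (𝓝 x) := by
    simpa using T.symm.continuous.tendsto (T x)
  filter_upwards [hb, ho, hst.eventually (hs (c / (2 * κ * C)) (by positivity))]
    with z hz1 hz2 hz3 hlt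
  rw [Real.norm_eq_abs, abs_le] at hz2
  have hz : T (T.symm z) = z := T.apply_symm_apply z
  have : T.symm z ∈ T ⁻¹' s := by
    apply hz3
    have h1 : κ * ⟪x - T.symm z, n⟫ > c / 2 * ‖z - T x‖ := by
      rw [← neg_sub (T.symm z) x, inner_neg_left]
      rw [← neg_sub z (T x), inner_neg_left] at hlt
      linarith [hz2.2, hz2.1]
    have h2 : κ * (c / (2 * κ * C) * ‖T.symm z - x‖) ≤ c / 2 * ‖z - T x‖ := by
      calc _ ≤ κ * (c / (2 * κ * C) * (C * ‖z - T x‖)) := by gcongr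
        _ = _ := by field_simp
    exact lt_of_mul_lt_mul_left (h2.trans_lt h1) hκ.le
  rwa [mem_preimage, hz] at this

lemma trace_image_eq {X : Type*} [TopologicalSpace X] [T2Space X] [Nonempty X] {D : Set Plane}
    {n : Plane} (h : IsOuterNormal D x n) (hT : HasFDerivAt T N x) (hN : 0 < det₂ N)
    {g : Plane → X} {L : X} (hg : Tendsto (g ∘ T) (approach D x) (𝓝 L)) :
    trace (T '' D) g (T x) = L :=
  trace_eq (h.image hT hN) ((tendsto_map'_iff.2 hg).mono_left (approach_image_le h hT hN))

end Transform

/-! ### Change of variables on curves -/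

/-- An inequality between measures that holds locally on a countable cover holds globally. -/
lemma measure_le_of_countable_cover {X ι : Type*} [MeasurableSpace X] [Countable ι] [Nonempty ι]
    {μ ν : Measure X} {s : ι → Set X} (hs : ∀ i, MeasurableSet (s i))
    (h : ∀ i, ∀ B ⊆ s i, MeasurableSet B → ν B ≤ μ B) {A : Set X} (hA : MeasurableSet A)
    (hAs : A ⊆ ⋃ i, s i) : ν A ≤ μ A := by
  obtain ⟨f, hf⟩ := exists_surjective_nat ι
  have hcov : A = ⋃ k, A ∩ disjointed (s ∘ f) k := by
    rw [← inter_iUnion, iUnion_disjointed, eq_comm, inter_eq_left]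
    exact hAs.trans (by rw [← hf.iUnion_comp s]; rfl)
  have hm : ∀ k, MeasurableSet (A ∩ disjointed (s ∘ f) k) := fun k =>
    hA.inter (MeasurableSet.disjointed (fun i => hs (f i)) k)
  have hd : Pairwise (Function.onFun Disjoint fun k => A ∩ disjointed (s ∘ f) k) :=
    fun i j hij => (disjoint_disjointed (s ∘ f) hij).mono inter_subset_right inter_subset_right
  rw [hcov, measure_iUnion hd hm, measure_iUnion hd hm]
  exact ENNReal.tsum_le_tsum fun k =>
    h (f k) _ (inter_subset_right.trans (disjointed_subset _ _)) (hm k)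

lemma hausdorffMeasure_one_image_le {X Y : Type*} [EMetricSpace X] [MeasurableSpace X]
    [BorelSpace X] [EMetricSpace Y] [MeasurableSpace Y] [BorelSpace Y] {f : X → Y} {s : Set X}
    {K : ℝ≥0} (h : LipschitzOnWith K f s) : μH[1] (f '' s) ≤ K * μH[1] s := by
  simpa using h.hausdorffMeasure_image_le (d := 1) zero_le_one

section CurveMap

variable {Γ : Set Plane} {T : Plane ≃ₜ Plane} {J : Plane → ℝ}

/-- `J` is the metric derivative of `T` along `Γ` at `x`. -/
def IsMetricDeriv (Γ : Set Plane) (T : Plane → Plane) (x : Plane) (J : ℝ) : Prop :=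
  ∀ ε : ℝ, 0 < ε → ∀ᶠ y in 𝓝 x, y ∈ Γ → |‖T y - T x‖ - J * ‖y - x‖| ≤ ε * ‖y - x‖

lemma hausdorffMeasure_image_le_of_almost_isometry {B : Set Plane} {T : Plane → Plane} {q η : ℝ}
    (hq : 0 ≤ q) (hη : 0 ≤ η)
    (h : ∀ x ∈ B, ∀ y ∈ B, |‖T y - T x‖ - q * ‖y - x‖| ≤ η * ‖y - x‖) :
    μH[1] (T '' B) ≤ ENNReal.ofReal q * μH[1] B + ENNReal.ofReal η * μH[1] B := by
  have hl : LipschitzOnWith (Real.toNNReal (q + η)) T B := by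
    refine LipschitzOnWith.of_dist_le_mul fun x hx y hy => ?_
    rw [dist_eq_norm, dist_eq_norm, Real.coe_toNNReal _ (by positivity)]
    have := (abs_le.1 (h y hy x hx)).2
    linarith
  refine (hausdorffMeasure_one_image_le hl).trans ?_
  rw [← add_mul, ← ENNReal.ofReal_add hq hη]
  rfl

/-- If `q > η`, then `T` is injective on `B` with inverse of Lipschitz constant `1 / (q - η)`; if `q
≤ η`, the error term alone dominates. -/
lemma le_hausdorffMeasure_image_of_almost_isometry {B : Set Plane} {T : Plane → Plane} {q η : ℝ}
    (hη : 0 ≤ η)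
    (h : ∀ x ∈ B, ∀ y ∈ B, |‖T y - T x‖ - q * ‖y - x‖| ≤ η * ‖y - x‖) :
    ENNReal.ofReal q * μH[1] B ≤ μH[1] (T '' B) + ENNReal.ofReal η * μH[1] B := by
  by_cases hqη : q ≤ η
  · exact (mul_le_mul_left (ENNReal.ofReal_le_ofReal hqη) _).trans le_add_self
  push Not at hqη
  have hpos : 0 < q - η := sub_pos.2 hqη
  have hT : ∀ x ∈ B, ∀ y ∈ B, (q - η) * ‖x - y‖ ≤ ‖T x - T y‖ := fun x hx y hy => by
    have := (abs_le.1 (h y hy x hx)).1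
    linarith
  have hinj : InjOn T B := fun x hx y hy hxy => by
    have := hT x hx y hy
    rw [hxy, sub_self, norm_zero] at this
    have h0 : ‖x - y‖ ≤ 0 := by
      by_contra hlt
      push Not at hlt
      exact absurd (mul_pos hpos hlt) (not_lt.2 this)
    exact sub_eq_zero.1 (norm_le_zero_iff.1 h0)
  have hl : LipschitzOnWith (Real.toNNReal (q - η)⁻¹) (Function.invFunOn T B) (T '' B) := by
    refine LipschitzOnWith.of_dist_le_mul ?_
    rintro _ ⟨x, hx, rfl⟩ _ ⟨y, hy, rfl⟩
    rw [hinj.leftInvOn_invFunOn hx, hinj.leftInvOn_invFunOn hy, dist_eq_norm, dist_eq_norm,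
      Real.coe_toNNReal _ (by positivity), inv_mul_eq_div, le_div_iff₀ hpos, mul_comm]
    exact hT x hx y hy
  have h1 := hausdorffMeasure_one_image_le hl
  rw [hinj.leftInvOn_invFunOn.image_image] at h1
  have h2 : ENNReal.ofReal (q - η) * μH[1] B ≤ μH[1] (T '' B) := by
    calc _ ≤ ENNReal.ofReal (q - η) * (ENNReal.ofReal (q - η)⁻¹ * μH[1] (T '' B)) := by
          gcongr; exact h1
      _ = μH[1] (T '' B) := by
          rw [← mul_assoc, ← ENNReal.ofReal_mul hpos.le, mul_inv_cancel₀ hpos.ne',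
            ENNReal.ofReal_one, one_mul]
  calc ENNReal.ofReal q * μH[1] B = ENNReal.ofReal (q - η) * μH[1] B + ENNReal.ofReal η * μH[1] B := by
        rw [← add_mul, ← ENNReal.ofReal_add hpos.le hη, sub_add_cancel]
    _ ≤ _ := by gcongr

/-- The pieces on which `T` is almost a similarity of ratio `m * ε`. -/
def similarityPiece (Γ : Set Plane) (T : Plane → Plane) (J : Plane → ℝ) (ε : ℝ)
    (i : ℕ × ℕ × ℕ) : Set Plane :=
  -- The index has three parts: the scale at which the approximation holds, the level of `J` in
  -- steps of `ε`, and the centre of a ball. The ball has half of that scale as radius, so any two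
  -- points of a piece are comparable.
  {x | x ∈ Γ ∧ (∀ y ∈ Γ, ‖y - x‖ < 1 / ((i.1 : ℝ) + 1) →
    |‖T y - T x‖ - i.2.1 * ε * ‖y - x‖| ≤ 2 * ε * ‖y - x‖)} ∩
  J ⁻¹' Ico (i.2.1 * ε) ((i.2.1 + 1) * ε) ∩
  Metric.ball (TopologicalSpace.denseSeq Plane i.2.2) (1 / ((i.1 : ℝ) + 1) / 2)

lemma measurableSet_similarityPiece (hΓ : MeasurableSet Γ) (hJ : Measurable J) (ε : ℝ)
    (i : ℕ × ℕ × ℕ) : MeasurableSet (similarityPiece Γ T J ε i) := by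
  refine ((?_ : MeasurableSet _).inter (hJ measurableSet_Ico)).inter measurableSet_ball
  refine hΓ.inter (IsClosed.measurableSet ?_)
  refine isClosed_of_closure_subset fun p hp y hyΓ hy => ?_
  have hT := T.continuous
  have hy' : ∀ᶠ q : Plane in 𝓝 p, ‖y - q‖ < 1 / ((i.1 : ℝ) + 1) :=
    (Continuous.tendsto (by fun_prop : Continuous fun q : Plane => ‖y - q‖) p).eventually
      (gt_mem_nhds hy)
  have hfr := (mem_closure_iff_frequently.1 hp).and_eventually hy'
  have hc : IsClosed {q : Plane | |‖T y - T q‖ - i.2.1 * ε * ‖y - q‖| ≤ 2 * ε * ‖y - q‖} :=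
    isClosed_le (by fun_prop) (by fun_prop)
  exact hc.closure_subset (mem_closure_iff_frequently.2 (hfr.mono fun q hq => hq.1 y hyΓ hq.2))

lemma mem_similarityPiece {ε : ℝ} (hε : 0 < ε) {x : Plane} (hx : x ∈ Γ) (hJ : 0 ≤ J x)
    (h : IsMetricDeriv Γ T x (J x)) : ∃ i, x ∈ similarityPiece Γ T J ε i := by
  set m := ⌊J x / ε⌋₊
  have hm1 : m * ε ≤ J x := (le_div_iff₀ hε).1 (Nat.floor_le (by positivity))
  have hm2 : J x < (m + 1) * ε := (div_lt_iff₀ hε).1 (Nat.lt_floor_add_one _)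
  obtain ⟨r, hr, h'⟩ := Metric.eventually_nhds_iff.1 (h ε hε)
  obtain ⟨k, hk⟩ := exists_nat_one_div_lt hr
  have hk0 : 0 < 1 / ((k : ℝ) + 1) / 2 := by positivity
  obtain ⟨i, hi⟩ := (TopologicalSpace.denseRange_denseSeq Plane).exists_dist_lt x hk0
  refine ⟨(k, m, i), ⟨⟨⟨hx, fun y hy hyx => ?_⟩, hm1, hm2⟩, hi⟩⟩
  have h1 := h' (by rw [dist_eq_norm]; exact hyx.trans hk) hy
  have h0 := norm_nonneg (y - x)
  rw [abs_le] at h1 ⊢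
  -- One `ε` comes from the metric derivative, the other from rounding `J x` down to a multiple of
  -- `ε`.
  constructor <;> nlinarith

lemma similarityPiece_almost_isometry {ε : ℝ} {i : ℕ × ℕ × ℕ} :
    ∀ x ∈ similarityPiece Γ T J ε i, ∀ y ∈ similarityPiece Γ T J ε i,
      |‖T y - T x‖ - i.2.1 * ε * ‖y - x‖| ≤ 2 * ε * ‖y - x‖ := by
  intro x hx y hy
  refine hx.1.1.2 y hy.1.1.1 ?_
  rw [← dist_eq_norm]
  calc dist y x ≤ dist y _ + dist x _ := dist_triangle_right _ _ _
    _ < 1 / ((i.1 : ℝ) + 1) / 2 + 1 / ((i.1 : ℝ) + 1) / 2 := add_lt_add hy.2 hx.2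
    _ = _ := add_halves _

variable {C : ℝ≥0}

/-- On one piece `T` is a similarity up to `2 ε` and `J` exceeds its ratio by at most `ε`, hence the
errors `2 ε` and `3 ε`. The countably many pieces cover `A` up to a null set, and a Lipschitz map
sends null sets to null sets. -/
lemma measure_image_compare (hΓ : MeasurableSet Γ) (hT : LipschitzWith C T) (hJ : Measurable J)
    (hJ0 : ∀ x, 0 ≤ J x) (hd : ∀ᵐ x ∂μH[1].restrict Γ, IsMetricDeriv Γ T x (J x)) {ε : ℝ}
    (hε : 0 < ε) {A : Set Plane} (hA : MeasurableSet A) (hAΓ : A ⊆ Γ) :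
    μH[1] (T '' A) ≤ (∫⁻ x in A, ENNReal.ofReal (J x) ∂μH[1]) +
        ENNReal.ofReal (2 * ε) * μH[1] A ∧
    (∫⁻ x in A, ENNReal.ofReal (J x) ∂μH[1]) ≤ μH[1] (T '' A) +
        ENNReal.ofReal (3 * ε) * μH[1] A := by
  set P := similarityPiece Γ T J ε
  have hP : ∀ i, MeasurableSet (P i) := measurableSet_similarityPiece hΓ hJ ε
  have hU : MeasurableSet (⋃ i, P i) := MeasurableSet.iUnion hP
  have hnull : μH[1] (A \ ⋃ i, P i) = 0 := by
    rw [ae_restrict_iff' hΓ] at hd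
    refine measure_mono_null (fun x hx => ?_) (ae_iff.1 hd)
    intro hx'
    exact hx.2 (mem_iUnion.2 (mem_similarityPiece hε (hAΓ hx.1) (hJ0 x) (hx' (hAΓ hx.1))))
  have hnullT : μH[1] (T '' (A \ ⋃ i, P i)) = 0 := by
    have := hausdorffMeasure_one_image_le (hT.lipschitzOnWith (s := A \ ⋃ i, P i))
    rwa [hnull, mul_zero, nonpos_iff_eq_zero] at this
  set ν : Measure Plane := (μH[1] : Measure Plane).map T.symm
  have hν : ∀ B : Set Plane, ν B = μH[1] (T '' B) := fun B => by
    rw [show ν B = _ from T.symm.toMeasurableEquiv.map_apply B, T.image_eq_preimage_symm]; rfl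
  set lam : Measure Plane := (μH[1] : Measure Plane).withDensity fun x => ENNReal.ofReal (J x)
  have hlam : ∀ B : Set Plane, MeasurableSet B →
      lam B = ∫⁻ x in B, ENNReal.ofReal (J x) ∂μH[1] := fun B hB => withDensity_apply _ hB
  have hlamnull : lam (A \ ⋃ i, P i) = 0 := withDensity_absolutelyContinuous _ _ hnull
  have hnn : ∀ m : ℕ, 0 ≤ (m : ℝ) * ε := fun m => by positivity
  have upper : ∀ i, ∀ B ⊆ P i, MeasurableSet B →
      ν B ≤ (lam + ENNReal.ofReal (2 * ε) • (μH[1] : Measure Plane)) B := by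
    intro i B hB hBm
    have h1 := hausdorffMeasure_image_le_of_almost_isometry (hnn i.2.1) (by positivity)
      (fun x hx y hy => similarityPiece_almost_isometry x (hB hx) y (hB hy))
    rw [hν, Measure.add_apply, Measure.smul_apply, smul_eq_mul, hlam B hBm]
    refine h1.trans (add_le_add ?_ le_rfl)
    rw [← setLIntegral_const]
    exact setLIntegral_mono' hBm fun x hx => ENNReal.ofReal_le_ofReal (hB hx).1.2.1
  have lower : ∀ i, ∀ B ⊆ P i, MeasurableSet B →
      lam B ≤ (ν + ENNReal.ofReal (3 * ε) • (μH[1] : Measure Plane)) B := by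
    intro i B hB hBm
    have h1 := le_hausdorffMeasure_image_of_almost_isometry (by positivity)
      (fun x hx y hy => similarityPiece_almost_isometry x (hB hx) y (hB hy))
    rw [Measure.add_apply, Measure.smul_apply, smul_eq_mul, hlam B hBm, hν]
    have h2 : ∫⁻ x in B, ENNReal.ofReal (J x) ∂μH[1] ≤
        ENNReal.ofReal (i.2.1 * ε + ε) * μH[1] B := by
      rw [← setLIntegral_const]
      refine setLIntegral_mono' hBm fun x hx => ENNReal.ofReal_le_ofReal ?_
      have := (hB hx).1.2.2
      linarith
    refine h2.trans ?_
    rw [ENNReal.ofReal_add (hnn _) hε.le, add_mul]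
    calc _ ≤ μH[1] (T '' B) + ENNReal.ofReal (2 * ε) * μH[1] B + ENNReal.ofReal ε * μH[1] B := by
          gcongr
      _ = _ := by
          rw [add_assoc, ← add_mul, ← ENNReal.ofReal_add (by positivity) hε.le]
          congr 3; ring
  have hsplit : ∀ κ : Measure Plane, κ (A \ ⋃ i, P i) = 0 → κ A = κ (A ∩ ⋃ i, P i) := by
    intro κ hκ
    rw [← measure_inter_add_sdiff A hU, hκ, add_zero]
  have hAU := hA.inter hU
  constructor
  · rw [← hν, ← hlam A hA, hsplit ν (by rw [hν, hnullT])]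
    refine (measure_le_of_countable_cover hP upper hAU inter_subset_right).trans ?_
    exact measure_mono inter_subset_left
  · rw [← hν, ← hlam A hA, hsplit lam hlamnull]
    refine (measure_le_of_countable_cover hP lower hAU inter_subset_right).trans ?_
    exact measure_mono inter_subset_left

/-- Let `ε` tend to `0` in the comparison; the finite length makes the error terms vanish. -/
lemma measure_image_eq_lintegral (hΓ : MeasurableSet Γ) (hfin : μH[1] Γ ≠ ⊤)
    (hT : LipschitzWith C T) (hJ : Measurable J) (hJ0 : ∀ x, 0 ≤ J x)
    (hd : ∀ᵐ x ∂μH[1].restrict Γ, IsMetricDeriv Γ T x (J x)) {A : Set Plane}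
    (hA : MeasurableSet A) (hAΓ : A ⊆ Γ) :
    μH[1] (T '' A) = ∫⁻ x in A, ENNReal.ofReal (J x) ∂μH[1] := by
  have hAfin : μH[1] A ≠ ⊤ := ne_top_of_le_ne_top hfin (measure_mono hAΓ)
  have hcmp := fun (ε : ℝ) (hε : 0 < ε) =>
    measure_image_compare hΓ hT hJ hJ0 hd hε hA hAΓ
  have small : ∀ δ : ℝ≥0, 0 < δ → ∃ ε : ℝ, 0 < ε ∧
      ENNReal.ofReal (2 * ε) * μH[1] A ≤ δ ∧ ENNReal.ofReal (3 * ε) * μH[1] A ≤ δ := by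
    intro δ hδ
    have hm : (0 : ℝ) ≤ (μH[1] A).toReal := ENNReal.toReal_nonneg
    have key : ENNReal.ofReal (3 * (δ / (3 * ((μH[1] A).toReal + 1)))) * μH[1] A ≤ δ := by
      rw [← ENNReal.ofReal_toReal hAfin, ← ENNReal.ofReal_mul (by positivity),
        ENNReal.toReal_ofReal hm, ← ENNReal.ofReal_coe_nnreal]
      refine ENNReal.ofReal_le_ofReal ?_
      rw [show 3 * ((δ : ℝ) / (3 * ((μH[1] A).toReal + 1))) * (μH[1] A).toReal =
        δ * ((μH[1] A).toReal / ((μH[1] A).toReal + 1)) by field_simp]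
      refine mul_le_of_le_one_right δ.2 ((div_le_one (by positivity)).2 (by linarith))
    refine ⟨δ / (3 * ((μH[1] A).toReal + 1)), by positivity, le_trans ?_ key, key⟩
    gcongr
    norm_num
  refine le_antisymm (ENNReal.le_of_forall_pos_le_add fun δ hδ _ => ?_)
    (ENNReal.le_of_forall_pos_le_add fun δ hδ _ => ?_)
  · obtain ⟨ε, hε, h1, -⟩ := small δ hδ
    exact (hcmp ε hε).1.trans (add_le_add le_rfl h1)
  · obtain ⟨ε, hε, -, h2⟩ := small δ hδ
    exact (hcmp ε hε).2.trans (add_le_add le_rfl h2)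

/-- Change of variables in an integral over a curve. -/
lemma setIntegral_image_eq (hΓ : MeasurableSet Γ) (hfin : μH[1] Γ ≠ ⊤)
    (hT : LipschitzWith C T) (hJ : Measurable J) (hJ0 : ∀ x, 0 ≤ J x)
    (hd : ∀ᵐ x ∂μH[1].restrict Γ, IsMetricDeriv Γ T x (J x)) (g : Plane → ℝ) :
    ∫ x in T '' Γ, g x ∂μH[1] = ∫ x in Γ, J x * g (T x) ∂μH[1] := by
  -- Length on the image curve is the push-forward under `T` of length on `Γ` with density `J`.
  have hmeas : (μH[1] : Measure Plane).restrict (T '' Γ) =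
      (((μH[1] : Measure Plane).restrict Γ).withDensity
        fun x => ((J x).toNNReal : ℝ≥0∞)).map T := by
    ext B hB
    rw [Measure.restrict_apply hB, show Measure.map T _ B = _ from T.toMeasurableEquiv.map_apply B,
      withDensity_apply _ (T.toMeasurableEquiv.measurable hB), Measure.restrict_restrict
        (T.toMeasurableEquiv.measurable hB)]
    have himg : B ∩ T '' Γ = T '' (T ⁻¹' B ∩ Γ) := by
      rw [image_preimage_inter]
    rw [himg, measure_image_eq_lintegral hΓ hfin hT hJ hJ0 hd
      ((T.continuous.measurable hB).inter hΓ) inter_subset_right]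
    rfl
  rw [hmeas, T.measurableEmbedding.integral_map,
    integral_withDensity_eq_integral_smul hJ.real_toNNReal]
  refine integral_congr_ae (Eventually.of_forall fun x => ?_)
  simp [NNReal.smul_def, Real.coe_toNNReal _ (hJ0 x)]

end CurveMap

/-! ### Normal and tangential components; arc length along a boundary. -/

lemma norm_sq_eq_normal_tangential {n : Plane} (hn : ‖n‖ = 1) (u : Plane) :
    ‖u‖ ^ 2 = ⟪u, n⟫ ^ 2 + ⟪u, rot n⟫ ^ 2 := by
  have h1 : n 0 ^ 2 + n 1 ^ 2 = 1 := by rw [← norm_sq_plane, hn]; norm_num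
  rw [norm_sq_plane, inner_plane, inner_plane]
  simp only [rot_zero_coord, rot_one_coord]
  linear_combination (-(u 0 ^ 2 + u 1 ^ 2)) * h1

lemma eq_normal_add_tangential {n : Plane} (hn : ‖n‖ = 1) (u : Plane) :
    u = ⟪u, n⟫ • n + ⟪u, rot n⟫ • rot n := by
  have h1 : n 0 ^ 2 + n 1 ^ 2 = 1 := by rw [← norm_sq_plane, hn]; norm_num
  apply plane_ext <;> simp [inner_plane]
  · linear_combination (-(u 0)) * h1
  · linear_combination (-(u 1)) * h1

/-- The metric derivative along the boundary of a set at a point with a normal. -/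
lemma IsOuterNormal.isMetricDeriv {D : Set Plane} {x n : Plane} (h : IsOuterNormal D x n)
    {T : Plane → Plane} {N : Plane →L[ℝ] Plane} (hT : HasFDerivAt T N x) {Γ : Set Plane}
    (hΓ : Γ ⊆ frontier D) : IsMetricDeriv Γ T x ‖cof N n‖ := by
  intro ε hε
  -- The normal component of `u = y - x` enters twice, in replacing `N u` by its tangential part and
  -- in replacing `‖u‖` by its tangential part. Each costs at most `ε / 4`, and linearizing `T`
  -- costs `ε / 2`.
  have hη : 0 < ε / (4 * (‖N‖ + 1)) := by positivity
  filter_upwards [h.abs_inner_le hη, hT.isLittleO.bound (half_pos hε)] with y hy hy' hyΓ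
  have h1 := hy (hΓ hyΓ)
  set u := y - x
  rw [norm_cof_apply]
  have hJ : ‖N (rot n)‖ ≤ ‖N‖ := by
    have := N.le_opNorm (rot n)
    rwa [norm_rot, h.1, mul_one] at this
  have hNn : ‖N n‖ ≤ ‖N‖ := by
    have := N.le_opNorm n
    rwa [h.1, mul_one] at this
  have hsq := norm_sq_eq_normal_tangential h.1 u
  have hb1 : |⟪u, rot n⟫| ≤ ‖u‖ := by
    have := abs_real_inner_le_norm u (rot n)
    rwa [norm_rot, h.1, mul_one] at this
  have hb2 : ‖u‖ ≤ |⟪u, n⟫| + |⟪u, rot n⟫| := by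
    refine abs_le_of_sq_le_sq' ?_ (by positivity) |>.2
    rw [hsq, ← sq_abs ⟪u, n⟫, ← sq_abs ⟪u, rot n⟫]
    nlinarith [abs_nonneg ⟪u, n⟫, abs_nonneg ⟪u, rot n⟫]
  have hNu : N u = ⟪u, n⟫ • N n + ⟪u, rot n⟫ • N (rot n) := by
    conv_lhs => rw [eq_normal_add_tangential h.1 u]
    simp
  have h2 : |‖N u‖ - |⟪u, rot n⟫| * ‖N (rot n)‖| ≤ |⟪u, n⟫| * ‖N n‖ := by
    have := abs_norm_sub_norm_le (N u) (⟪u, rot n⟫ • N (rot n))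
    rw [hNu, add_sub_cancel_right, ← hNu, norm_smul, norm_smul] at this
    simpa using this
  have h3 : |‖T y - T x‖ - ‖N u‖| ≤ ε / 2 * ‖u‖ := (abs_norm_sub_norm_le _ _).trans hy'
  have h4 : |⟪u, n⟫| * (‖N‖ + 1) ≤ ε / 4 * ‖u‖ := by
    calc _ ≤ ε / (4 * (‖N‖ + 1)) * ‖u‖ * (‖N‖ + 1) := by gcongr
      _ = _ := by field_simp
  have h5 : |⟪u, n⟫| * ‖N n‖ ≤ |⟪u, n⟫| * (‖N‖ + 1) := by gcongr; linarith
  have h6 : (‖u‖ - |⟪u, rot n⟫|) * ‖N (rot n)‖ ≤ |⟪u, n⟫| * (‖N‖ + 1) := by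
    gcongr
    · linarith
    · linarith
  have h7 : 0 ≤ (‖u‖ - |⟪u, rot n⟫|) * ‖N (rot n)‖ := by
    apply mul_nonneg _ (norm_nonneg _); linarith
  rw [abs_le] at h2 h3 ⊢
  constructor <;> nlinarith

/-- Change of variables along the boundary of a set with normals almost everywhere. -/
lemma setIntegral_image_boundary {D Γ : Set Plane} (hΓD : Γ ⊆ frontier D) (hΓ : MeasurableSet Γ)
    (hfin : μH[1] Γ ≠ ⊤) (hn : ∀ᵐ x ∂μH[1].restrict Γ, ∃ n, IsOuterNormal D x n)
    {T : Plane ≃ₜ Plane} {C : ℝ≥0} (hTL : LipschitzWith C T) (hT : ContDiff ℝ 1 T)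
    (g : Plane → ℝ) :
    ∫ x in T '' Γ, g x ∂μH[1] =
      ∫ x in Γ, ‖cof (fderiv ℝ T x) (outerNormal D x)‖ * g (T x) ∂μH[1] := by
  refine setIntegral_image_eq hΓ hfin hTL ?_ (fun _ => norm_nonneg _) ?_ g
  · have hc : Continuous (fderiv ℝ T) := hT.continuous_fderiv (by norm_num)
    have h0 : Measurable fun x => fderiv ℝ T x e₀ := (hc.clm_apply continuous_const).measurable
    have h1 : Measurable fun x => fderiv ℝ T x e₁ := (hc.clm_apply continuous_const).measurable
    have hr : Measurable fun x => rot (outerNormal D x) :=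
      rot.continuous.measurable.comp (measurable_outerNormal D)
    have hi : ∀ i : Fin 2, Measurable fun x => rot (outerNormal D x) i := fun i =>
      (show Measurable fun v : Plane => v i from
        (by fun_prop : Continuous fun v : Plane => v i).measurable).comp hr
    simp only [norm_cof_apply]
    have : ∀ x, fderiv ℝ T x (rot (outerNormal D x)) =
        rot (outerNormal D x) 0 • fderiv ℝ T x e₀ +
          rot (outerNormal D x) 1 • fderiv ℝ T x e₁ := fun x => by
      conv_lhs => rw [plane_decomp (rot (outerNormal D x))]
      simp only [map_add, map_smul]
    simp only [this]
    exact (((hi 0).smul h0).add ((hi 1).smul h1)).norm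
  · filter_upwards [hn] with x hx
    exact (isOuterNormal_outerNormal hx).isMetricDeriv
      ((hT.differentiable (by norm_num)) x).hasFDerivAt hΓD

/-! ### Lipschitz boundaries -/

/-- The graph of `φ` in the coordinates given by `e`. -/
def graphCurve (e : Plane ≃ₗᵢ[ℝ] Plane) (φ : ℝ → ℝ) (s : ℝ) : Plane :=
  e.symm (s • e₀ + φ s • e₁)

lemma lipschitzWith_graphCurve (e : Plane ≃ₗᵢ[ℝ] Plane) {φ : ℝ → ℝ} {L : ℝ≥0}
    (hφ : LipschitzWith L φ) : LipschitzWith (1 + L) (graphCurve e φ) := by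
  refine LipschitzWith.of_dist_le_mul fun s t => ?_
  rw [graphCurve, graphCurve, e.symm.dist_map, dist_eq_norm]
  have h1 : s • e₀ + φ s • e₁ - (t • e₀ + φ t • e₁) = (s - t) • e₀ + (φ s - φ t) • e₁ := by
    module
  rw [h1]
  refine (norm_add_le _ _).trans ?_
  have h2 := hφ.dist_le_mul s t
  rw [Real.dist_eq] at h2 ⊢
  rw [Real.dist_eq] at h2
  simp only [norm_smul, PiLp.norm_single, Real.norm_eq_abs, norm_one, mul_one,
    NNReal.coe_add, NNReal.coe_one]
  linarith

/-- `D` is near `x`, in the coordinates `e` and within distance `r`, the strict subgraph of `φ`. -/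
def IsSubgraphNear (D : Set Plane) (x : Plane) (e : Plane ≃ₗᵢ[ℝ] Plane) (r : ℝ) (φ : ℝ → ℝ) :
    Prop :=
  ∀ y ∈ Metric.ball x r, (y ∈ D ↔ e y 1 < φ (e y 0))

variable {D : Set Plane} {x : Plane} {e : Plane ≃ₗᵢ[ℝ] Plane} {r : ℝ} {φ : ℝ → ℝ}

lemma IsSubgraphNear.eq_of_mem_frontier (h : IsSubgraphNear D x e r φ) (hφ : Continuous φ)
    {y : Plane} (hy : y ∈ Metric.ball x r) (hyD : y ∈ frontier D) : e y 1 = φ (e y 0) := by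
  have hb : Metric.ball x r ∈ 𝓝 y := Metric.isOpen_ball.mem_nhds hy
  have hc0 : Continuous fun z => φ (e z 0) := by fun_prop
  have hc1 : Continuous fun z => e z 1 := by fun_prop
  rcases lt_trichotomy (e y 1) (φ (e y 0)) with hlt | heq | hgt
  · refine absurd ?_ hyD.2
    rw [mem_interior_iff_mem_nhds]
    filter_upwards [hb, (isOpen_lt hc1 hc0).mem_nhds hlt] with z hz hz'
    exact (h z hz).2 hz'
  · exact heq
  · exfalso
    have : ∀ᶠ z in 𝓝 y, z ∉ D := by
      filter_upwards [hb, (isOpen_lt hc0 hc1).mem_nhds hgt] with z hz hz'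
      rw [h z hz]
      exact not_lt.2 (le_of_lt hz')
    obtain ⟨z, hz, hz'⟩ :=
      ((mem_closure_iff_frequently.1 (frontier_subset_closure hyD)).and_eventually this).exists
    exact hz' hz

lemma graphCurve_of_eq {y : Plane} (h : e y 1 = φ (e y 0)) : graphCurve e φ (e y 0) = y := by
  rw [graphCurve, ← h, ← plane_decomp, e.symm_apply_apply]

lemma abs_coord_le_norm (v : Plane) (i : Fin 2) : |v i| ≤ ‖v‖ := by
  refine abs_le_of_sq_le_sq' ?_ (norm_nonneg _) |> abs_le.2
  rw [norm_sq_plane]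
  fin_cases i
  · simpa using sq_nonneg (v 1)
  · simpa using sq_nonneg (v 0)

lemma IsSubgraphNear.measure_lt_top (h : IsSubgraphNear D x e r φ) {L : ℝ≥0}
    (hφ : LipschitzWith L φ) : μH[1] (frontier D ∩ Metric.ball x r) < ⊤ := by
  have hsub : frontier D ∩ Metric.ball x r ⊆
      graphCurve e φ '' Metric.closedBall (e x 0) r := by
    rintro y ⟨hyD, hy⟩
    refine ⟨e y 0, ?_, graphCurve_of_eq (h.eq_of_mem_frontier hφ.continuous hy hyD)⟩
    rw [Metric.mem_closedBall, Real.dist_eq]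
    have h1 := abs_coord_le_norm (e y - e x) 0
    rw [← map_sub, e.norm_map, ← dist_eq_norm] at h1
    have h2 : |e y 0 - e x 0| ≤ dist y x := by simpa using h1
    exact h2.trans (Metric.mem_ball.1 hy).le
  refine (measure_mono hsub).trans_lt ?_
  refine (hausdorffMeasure_one_image_le
    ((lipschitzWith_graphCurve e hφ).lipschitzOnWith)).trans_lt ?_
  rw [hausdorffMeasure_real]
  exact ENNReal.mul_lt_top ENNReal.coe_lt_top (isCompact_closedBall _ _).measure_lt_top

/-- The normal is `(-φ', 1)`, normalized: its pairing with `z - y` is the height of `z` over the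
tangent line, and the graph deviates from that line by a small multiple of `‖z - y‖`. -/
lemma IsSubgraphNear.exists_isOuterNormal (h : IsSubgraphNear D x e r φ) (hφ : Continuous φ)
    {y : Plane} (hy : y ∈ Metric.ball x r) (hyD : y ∈ frontier D)
    (hd : DifferentiableAt ℝ φ (e y 0)) : ∃ n, IsOuterNormal D y n := by
  have heq := h.eq_of_mem_frontier hφ hy hyD
  set m := deriv φ (e y 0)
  set v : Plane := (-m) • e₀ + (1 : ℝ) • e₁
  have hv0 : v 0 = -m := by simp [v]
  have hv1 : v 1 = 1 := by simp [v]
  have hv : v ≠ 0 := fun h0 => by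
    have : v 1 = 0 := by rw [h0]; rfl
    simp [v] at this
  have hvn : 0 < ‖v‖ := norm_pos_iff.2 hv
  have hinner : ∀ z, ⟪z - y, e.symm (‖v‖⁻¹ • v)⟫ =
      ‖v‖⁻¹ * ((e z 1 - e y 1) - m * (e z 0 - e y 0)) := fun z => by
    rw [← e.inner_map_map, e.apply_symm_apply, map_sub, inner_smul_right, inner_plane, hv0,
      hv1, PiLp.sub_apply, PiLp.sub_apply]
    ring
  refine ⟨e.symm (‖v‖⁻¹ • v), ?_, fun ε hε => ?_⟩
  · rw [e.symm.norm_map, norm_smul, norm_inv, norm_norm, inv_mul_cancel₀ hvn.ne']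
  have hcont : Tendsto (fun z => e z 0) (𝓝 y) (𝓝 (e y 0)) :=
    Continuous.tendsto (by fun_prop) y
  have ho := (hd.hasDerivAt.hasFDerivAt.isLittleO.comp_tendsto hcont).bound
    (mul_pos hε hvn)
  filter_upwards [ho, Metric.isOpen_ball.mem_nhds hy] with z hz hzb
  have hle : |e z 0 - e y 0| ≤ ‖z - y‖ := by
    have h1 := abs_coord_le_norm (e z - e y) 0
    rw [← map_sub, e.norm_map] at h1
    simpa using h1
  have hz' : |φ (e z 0) - φ (e y 0) - m * (e z 0 - e y 0)| ≤ ε * ‖v‖ * ‖z - y‖ := by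
    refine le_trans ?_ (mul_le_mul_of_nonneg_left hle (by positivity))
    simpa [mul_comm] using hz
  rw [abs_le] at hz'
  rw [h z hzb, hinner, inv_mul_le_iff₀ hvn, le_inv_mul_iff₀ hvn, heq]
  constructor
  · intro hlt
    linarith [hz'.2]
  · intro hge
    linarith [hz'.1]

/-- Rademacher's theorem on the line: the parameters where `φ` is not differentiable form a null
set, and the graph map is Lipschitz. -/
lemma IsSubgraphNear.measure_not_isOuterNormal (h : IsSubgraphNear D x e r φ) {L : ℝ≥0}
    (hφ : LipschitzWith L φ) :
    μH[1] ({y | y ∈ frontier D ∧ ¬ ∃ n, IsOuterNormal D y n} ∩ Metric.ball x r) = 0 := by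
  have hsub : {y | y ∈ frontier D ∧ ¬ ∃ n, IsOuterNormal D y n} ∩ Metric.ball x r ⊆
      graphCurve e φ '' {s | ¬ DifferentiableAt ℝ φ s} := by
    rintro y ⟨⟨hyD, hn⟩, hy⟩
    refine ⟨e y 0, fun hd => hn (h.exists_isOuterNormal hφ.continuous hy hyD hd),
      graphCurve_of_eq (h.eq_of_mem_frontier hφ.continuous hy hyD)⟩
  refine measure_mono_null hsub ?_
  have h1 := hausdorffMeasure_one_image_le
    ((lipschitzWith_graphCurve e hφ).lipschitzOnWith (s := {s | ¬ DifferentiableAt ℝ φ s}))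
  rw [hausdorffMeasure_real, ae_iff.1 hφ.ae_differentiableAt_real, mul_zero] at h1
  exact nonpos_iff_eq_zero.1 h1

lemma HasLipschitzBoundary.measure_frontier_lt_top (h : HasLipschitzBoundary D)
    (hD : Bornology.IsBounded D) : μH[1] (frontier D) < ⊤ := by
  have hc : IsCompact (frontier D) :=
    Metric.isCompact_of_isClosed_isBounded isClosed_frontier
      (hD.closure.subset frontier_subset_closure)
  refine hc.measure_lt_top_of_nhdsWithin fun x hx => ?_
  obtain ⟨e, r, L, φ, hr, hφ, h'⟩ := h x hx
  refine ⟨frontier D ∩ Metric.ball x r, ?_, IsSubgraphNear.measure_lt_top h' hφ⟩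
  exact inter_mem_nhdsWithin _ (Metric.ball_mem_nhds x hr)

lemma HasLipschitzBoundary.ae_exists_isOuterNormal (h : HasLipschitzBoundary D) :
    ∀ᵐ x ∂μH[1].restrict (frontier D), ∃ n, IsOuterNormal D x n := by
  rw [ae_restrict_iff' isClosed_frontier.measurableSet, ae_iff]
  simp only [Classical.not_imp]
  refine measure_null_of_locally_null _ fun x hx => ?_
  obtain ⟨e, r, L, φ, hr, hφ, h'⟩ := h x hx.1
  exact ⟨_, inter_mem_nhdsWithin _ (Metric.ball_mem_nhds x hr),
    IsSubgraphNear.measure_not_isOuterNormal h' hφ⟩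

/-! ### Triangles -/

/-- The vertex set `K` spans a nondegenerate triangle. -/
def IsTriangle (K : Finset Plane) : Prop :=
  AffineIndependent ℝ ((↑) : K → Plane) ∧ K.card = 3

lemma IsTriangle.exists_affineBasis {K : Finset Plane} (h : IsTriangle K) :
    ∃ b : AffineBasis K ℝ Plane, ∀ v : K, b v = v := by
  refine ⟨⟨((↑) : K → Plane), h.1, ?_⟩, fun v => rfl⟩
  rw [h.1.affineSpan_eq_top_iff_card_eq_finrank_add_one]
  simp [h.2]

section Basis

variable {K : Finset Plane} {b : AffineBasis K ℝ Plane}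

lemma range_affineBasis (hb : ∀ v : K, b v = v) : range b = (K : Set Plane) := by
  have : (b : K → Plane) = Subtype.val := funext hb
  rw [this]; simp

lemma mem_convexHull_iff_coord (hb : ∀ v : K, b v = v) {x : Plane} :
    x ∈ convexHull ℝ (K : Set Plane) ↔ ∀ v, 0 ≤ b.coord v x := by
  rw [← range_affineBasis hb, b.convexHull_eq_nonneg_coord]; rfl

lemma mem_cell_iff_coord (hb : ∀ v : K, b v = v) {x : Plane} :
    x ∈ cell K ↔ ∀ v, 0 < b.coord v x := by
  rw [cell, ← range_affineBasis hb, b.interior_convexHull]; rfl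

lemma mem_convexHull_erase (hb : ∀ v : K, b v = v) {x : Plane}
    (hx : x ∈ convexHull ℝ (K : Set Plane)) {v : K} (hv : b.coord v x = 0) :
    x ∈ convexHull ℝ ((K.erase v : Finset Plane) : Set Plane) := by
  classical
  have hx' := (mem_convexHull_iff_coord hb).1 hx
  have h1 : ∑ i, b.coord i x • (b i) = x := b.linear_combination_coord_eq_self x
  have h2 : ∑ i, b.coord i x = 1 := b.sum_coord_apply_eq_one x
  rw [← Finset.sum_erase Finset.univ (a := v) (by rw [hv, zero_smul])] at h1
  rw [← Finset.sum_erase Finset.univ (a := v) hv] at h2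
  rw [← h1]
  refine (convex_convexHull ℝ _).sum_mem (fun i _ => hx' i) h2 fun i hi => ?_
  apply subset_convexHull
  rw [hb]
  simp only [Finset.mem_erase, Finset.mem_univ, and_true] at hi
  simp [Subtype.coe_ne_coe.2 hi]

end Basis

lemma isOpen_cell (K : Finset Plane) : IsOpen (cell K) := isOpen_interior

lemma isClosed_convexHull_finset (F : Finset Plane) : IsClosed (convexHull ℝ (F : Set Plane)) :=
  (F.finite_toSet.isCompact_convexHull ℝ).isClosed

lemma volume_convexHull_eq_zero {F : Finset Plane} (hF : F.card ≤ 2) :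
    volume (convexHull ℝ (F : Set Plane)) = 0 := by
  refine measure_mono_null (convexHull_subset_affineSpan _) (Measure.addHaar_affineSubspace _ _ ?_)
  intro htop
  rcases F.eq_empty_or_nonempty with rfl | hne
  · rw [Finset.coe_empty, AffineSubspace.span_empty] at htop
    exact AffineSubspace.bot_ne_top ℝ Plane Plane htop
  · have h1 : Module.finrank ℝ (vectorSpan ℝ (F : Set Plane)) ≤ F.card - 1 := by
      have hc : Fintype.card F = (F.card - 1) + 1 := by
        have := hne.card_pos
        simp; omega
      have := finrank_vectorSpan_range_le ℝ ((↑) : F → Plane) hc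
      have hr : range ((↑) : F → Plane) = (F : Set Plane) := by simp
      rwa [hr] at this
    rw [← direction_affineSpan, htop, AffineSubspace.direction_top, finrank_top] at h1
    simp at h1
    omega

/-- The edges of a triangle have constant normals, which are the outer normals of the triangle. -/
lemma IsTriangle.exists_edge_normal {K F : Finset Plane} (hK : IsTriangle K) (hFK : F ⊆ K)
    (hF : F.card = 2) :
    convexHull ℝ (F : Set Plane) ⊆ frontier (cell K) ∧
    ∃ n : Plane, ‖n‖ = 1 ∧ (∀ a ∈ F, ∀ b ∈ F, ⟪b - a, n⟫ = 0) ∧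
      ∀ x ∈ convexHull ℝ (F : Set Plane), x ∉ F → IsOuterNormal (cell K) x n := by
  classical
  obtain ⟨b, hb⟩ := hK.exists_affineBasis
  obtain ⟨p, q, hpq, rfl⟩ := Finset.card_eq_two.1 hF
  have hpK : p ∈ K := hFK (by simp)
  have hqK : q ∈ K := hFK (by simp)
  obtain ⟨k, hk⟩ : ∃ k, K \ {p, q} = {k} := by
    rw [← Finset.card_eq_one, Finset.card_sdiff_of_subset hFK, hK.2, hF]
  have hkK : k ∈ K := (Finset.mem_sdiff.1 (hk ▸ Finset.mem_singleton_self k)).1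
  have hkpq : k ∉ ({p, q} : Finset Plane) :=
    (Finset.mem_sdiff.1 (hk ▸ Finset.mem_singleton_self k)).2
  have hall : ∀ v : K, v = ⟨p, hpK⟩ ∨ v = ⟨q, hqK⟩ ∨ v = ⟨k, hkK⟩ := by
    rintro ⟨v, hv⟩
    by_cases h : v ∈ ({p, q} : Finset Plane)
    · simp at h
      rcases h with rfl | rfl <;> simp
    · have : v ∈ K \ {p, q} := Finset.mem_sdiff.2 ⟨hv, h⟩
      rw [hk, Finset.mem_singleton] at this
      simp [this]
  set vp : K := ⟨p, hpK⟩
  set vq : K := ⟨q, hqK⟩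
  set vk : K := ⟨k, hkK⟩
  have hne : vp ≠ vq := fun h => hpq (congrArg Subtype.val h)
  have hkp : vk ≠ vp := fun h => hkpq (by simp [show k = p from congrArg Subtype.val h])
  have hkq : vk ≠ vq := fun h => hkpq (by simp [show k = q from congrArg Subtype.val h])
  have hbp : b vp = p := hb vp
  have hbq : b vq = q := hb vq
  have hkp0 : b.coord vk p = 0 := by rw [← hbp]; exact b.coord_apply_ne hkp
  have hkq0 : b.coord vk q = 0 := by rw [← hbq]; exact b.coord_apply_ne hkq
  have hcoe : ((({p, q} : Finset Plane)) : Set Plane) = {p, q} := by simp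
  rw [hcoe, convexHull_pair]
  have hseg : ∀ x ∈ segment ℝ p q, b.coord vk x = 0 := by
    intro x hx
    rw [segment_eq_image_lineMap] at hx
    obtain ⟨s, -, rfl⟩ := hx
    rw [AffineMap.apply_lineMap, hkp0, hkq0]
    simp
  set l : Plane →L[ℝ] ℝ := (b.coord vk).linear.toContinuousLinearMap
  have hl : ∀ x y, b.coord vk y = b.coord vk x + l (y - x) := fun x y => by
    have h : l (y - x) = b.coord vk y - b.coord vk x := (b.coord vk).linearMap_vsub y x
    rw [h]; ring
  -- `ν` is the gradient of the barycentric coordinate of the third vertex `k`. That coordinate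
  -- vanishes on the edge and is positive in the triangle, so `-ν / ‖ν‖` is the outer normal.
  set ν : Plane := (InnerProductSpace.toDual ℝ Plane).symm l
  have hν : ∀ z, ⟪ν, z⟫ = l z := fun z => InnerProductSpace.toDual_symm_apply
  have hν0 : ν ≠ 0 := by
    intro h0
    have h1 := hl p k
    rw [hkp0, ← hν, h0, inner_zero_left] at h1
    have h2 : b.coord vk (b vk) = 1 := b.coord_apply_eq vk
    rw [hb vk] at h2
    linarith [show b.coord vk k = 0 + 0 from h1, show b.coord vk k = 1 from h2]
  have hνn : 0 < ‖ν‖ := norm_pos_iff.2 hν0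
  have hin : ∀ x y, ⟪y - x, -(‖ν‖⁻¹ • ν)⟫ = -(‖ν‖⁻¹ * (b.coord vk y - b.coord vk x)) :=
    fun x y => by
      rw [inner_neg_right, inner_smul_right, real_inner_comm, hν, hl x y, add_sub_cancel_left]
  constructor
  · intro x hx
    have hcell : x ∉ cell K := fun h => by
      have := (mem_cell_iff_coord hb).1 h vk
      rw [hseg x hx] at this
      exact lt_irrefl _ this
    refine ⟨?_, by rwa [(isOpen_cell K).interior_eq]⟩
    have hne : (interior (convexHull ℝ (K : Set Plane))).Nonempty := by
      rw [interior_convexHull_nonempty_iff_affineSpan_eq_top, ← range_affineBasis hb]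
      exact b.tot
    rw [cell, (convex_convexHull ℝ _).closure_interior_eq_closure_of_nonempty_interior hne]
    refine subset_closure (convexHull_mono ?_ (by rwa [← convexHull_pair] at hx))
    rw [← hcoe]
    exact_mod_cast hFK
  · refine ⟨-(‖ν‖⁻¹ • ν), by rw [norm_neg, norm_smul, norm_inv, norm_norm,
      inv_mul_cancel₀ hνn.ne'], ?_, ?_⟩
    · intro x hx y hy
      have h0 : ∀ z ∈ ({p, q} : Finset Plane), b.coord vk z = 0 := by
        intro z hz
        simp at hz
        rcases hz with rfl | rfl
        · exact hkp0
        · exact hkq0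
      rw [hin, h0 x hx, h0 y hy]; simp
    · intro x hx hxF
      have hk0 := hseg x hx
      -- Away from the endpoints the other two coordinates stay positive nearby, so there the
      -- triangle coincides with the half plane where the coordinate of `k` is positive.
      have hpos : 0 < b.coord vp x ∧ 0 < b.coord vq x := by
        rw [← insert_endpoints_openSegment] at hx
        have hx' : x ∈ openSegment ℝ p q := by
          rcases hx with rfl | rfl | hx
          · simp at hxF
          · simp at hxF
          · exact hx
        rw [openSegment_eq_image_lineMap] at hx'
        obtain ⟨s, ⟨hs0, hs1⟩, rfl⟩ := hx'
        have e1 : b.coord vp p = 1 := by rw [← hbp]; exact b.coord_apply_eq vp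
        have e2 : b.coord vp q = 0 := by rw [← hbq]; exact b.coord_apply_ne hne
        have e3 : b.coord vq p = 0 := by rw [← hbp]; exact b.coord_apply_ne hne.symm
        have e4 : b.coord vq q = 1 := by rw [← hbq]; exact b.coord_apply_eq vq
        rw [AffineMap.apply_lineMap, AffineMap.apply_lineMap, e1, e2, e3, e4]
        simp [AffineMap.lineMap_apply]
        exact ⟨hs1, hs0⟩
      refine ⟨by rw [norm_neg, norm_smul, norm_inv, norm_norm, inv_mul_cancel₀ hνn.ne'],
        fun ε hε => ?_⟩
      have hcp : Continuous (b.coord vp) := (b.coord vp).continuous_of_finiteDimensional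
      have hcq : Continuous (b.coord vq) := (b.coord vq).continuous_of_finiteDimensional
      filter_upwards [(isOpen_lt continuous_const hcp).mem_nhds hpos.1,
        (isOpen_lt continuous_const hcq).mem_nhds hpos.2] with y hyp hyq
      have hcell : y ∈ cell K ↔ 0 < b.coord vk y := by
        rw [mem_cell_iff_coord hb]
        refine ⟨fun h => h vk, fun h v => ?_⟩
        rcases hall v with rfl | rfl | rfl
        · exact hyp
        · exact hyq
        · exact h
      have hεn : 0 ≤ ε * ‖y - x‖ := by positivity
      rw [hin, hk0, sub_zero, hcell]
      constructor
      · intro h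
        have : 0 < ‖ν‖⁻¹ * b.coord vk y := by positivity
        linarith
      · intro h
        have : ‖ν‖⁻¹ * b.coord vk y ≤ 0 :=
          mul_nonpos_of_nonneg_of_nonpos (by positivity) (not_lt.1 h)
        linarith

/-! ### The mesh -/

lemma convex_cone (x n : Plane) (c : ℝ) (hc : 0 ≤ c) :
    Convex ℝ {y : Plane | c * ‖y - x‖ < ⟪x - y, n⟫} := by
  intro y hy z hz a b ha hb hab
  simp only [mem_ofPred_eq] at hy hz ⊢
  have h1 : a • y + b • z - x = a • (y - x) + b • (z - x) := by
    obtain rfl : b = 1 - a := by linarith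
    module
  have h2 : x - (a • y + b • z) = a • (x - y) + b • (x - z) := by
    obtain rfl : b = 1 - a := by linarith
    module
  rw [h1, h2, inner_add_left, inner_smul_left, inner_smul_left]
  simp only [conj_trivial]
  have h3 : ‖a • (y - x) + b • (z - x)‖ ≤ a * ‖y - x‖ + b * ‖z - x‖ := by
    refine (norm_add_le _ _).trans (le_of_eq ?_)
    rw [norm_smul, norm_smul, Real.norm_of_nonneg ha, Real.norm_of_nonneg hb]
  have h4 : c * ‖a • (y - x) + b • (z - x)‖ ≤ a * (c * ‖y - x‖) + b * (c * ‖z - x‖) := by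
    calc _ ≤ c * (a * ‖y - x‖ + b * ‖z - x‖) := by gcongr
      _ = _ := by ring
  refine h4.trans_lt ?_
  rcases ha.eq_or_lt with rfl | ha'
  · have hb1 : b = 1 := by linarith
    subst hb1
    simpa using hz
  · have h5 := mul_lt_mul_of_pos_left hy ha'
    have h6 := mul_le_mul_of_nonneg_left hz.le hb
    linarith

namespace Discretization

variable {d : Discretization}

lemma isTriangle_of_mem {K : Finset Plane} (hK : K ∈ d.triangles) : IsTriangle K :=
  ⟨d.mesh.indep hK.1, hK.2⟩

/-- By conformity the two triangles meet in the hull of at most two common vertices. This is a null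
set, whereas the intersection of the cells is open. -/
lemma disjoint_cell {K K' : Finset Plane} (hK : K ∈ d.triangles) (hK' : K' ∈ d.triangles)
    (hne : K ≠ K') : Disjoint (cell K) (cell K') := by
  classical
  rw [Set.disjoint_iff_inter_eq_empty]
  by_contra hnon
  have hopen : IsOpen (cell K ∩ cell K') := (isOpen_cell K).inter (isOpen_cell K')
  have hpos := hopen.measure_pos volume (nonempty_iff_ne_empty.2 hnon)
  have hsub : cell K ∩ cell K' ⊆ convexHull ℝ ((K ∩ K' : Finset Plane) : Set Plane) := by
    refine (inter_subset_inter interior_subset interior_subset).trans ?_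
    rw [Finset.coe_inter]
    exact d.mesh.inter_subset_convexHull hK.1 hK'.1
  have hcard : (K ∩ K').card ≤ 2 := by
    by_contra hc
    push Not at hc
    have h1 : K ∩ K' = K := Finset.eq_of_subset_of_card_le Finset.inter_subset_left
      (by rw [hK.2]; omega)
    have h2 : K ∩ K' = K' := Finset.eq_of_subset_of_card_le Finset.inter_subset_right
      (by rw [hK'.2]; omega)
    exact hne (h1.symm.trans h2)
  have := measure_mono_null hsub (volume_convexHull_eq_zero hcard)
  exact hpos.ne' this

variable (d) in
/-- The union of the edges and vertices of the mesh. -/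
def skeleton : Set Plane :=
  ⋃ F ∈ {F | F ∈ d.mesh.faces ∧ F.card ≤ 2}, convexHull ℝ (F : Set Plane)

lemma IsAdmissible.finite_triangles (hd : d.IsAdmissible) : d.triangles.Finite :=
  hd.finite_mesh.subset fun _ h => h.1

lemma IsAdmissible.finite_active (hd : d.IsAdmissible) : d.active.Finite :=
  hd.finite_triangles.subset fun _ h => h.1

lemma IsAdmissible.finite_low_faces (hd : d.IsAdmissible) : {F | F ∈ d.mesh.faces ∧ F.card ≤ 2}.Finite :=
  hd.finite_mesh.subset fun _ h => h.1

lemma IsAdmissible.volume_skeleton (hd : d.IsAdmissible) : volume d.skeleton = 0 := by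
  rw [skeleton, measure_biUnion_null_iff hd.finite_low_faces.countable]
  exact fun F hF => volume_convexHull_eq_zero hF.2

/-- Affinely independent sets in the plane have at most three points. A point of a closed triangle
outside its interior has a vanishing barycentric coordinate and hence lies on the opposite edge. -/
lemma IsAdmissible.mem_cell_or_skeleton (hd : d.IsAdmissible) {x : Plane} (hx : x ∈ d.Ω) :
    (∃ K ∈ d.active, x ∈ cell K) ∨ x ∈ d.skeleton := by
  classical
  have hx' : x ∈ d.mesh.space := by
    rw [hd.space_mesh]; exact subset_closure (hd.subset_hat hx)
  obtain ⟨K, hK, hxK⟩ := Geometry.SimplicialComplex.mem_space_iff.1 hx'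
  by_cases hcard : K.card ≤ 2
  · exact Or.inr (mem_biUnion (show K ∈ {F | F ∈ d.mesh.faces ∧ F.card ≤ 2} from ⟨hK, hcard⟩) hxK)
  have hle : K.card ≤ 3 := by
    have := (d.mesh.indep hK).card_le_finrank_succ
    have h2 : Module.finrank ℝ (vectorSpan ℝ (range ((↑) : K → Plane))) ≤ 2 := by
      simpa using Submodule.finrank_le (vectorSpan ℝ (range ((↑) : K → Plane)))
    rw [Fintype.card_coe] at this
    omega
  have hT : K ∈ d.triangles := ⟨hK, by omega⟩
  obtain ⟨b, hb⟩ := (isTriangle_of_mem hT).exists_affineBasis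
  by_cases hcell : x ∈ cell K
  · exact Or.inl ⟨K, ⟨hT, x, hcell, hx⟩, hcell⟩
  · right
    rw [mem_cell_iff_coord hb] at hcell
    push Not at hcell
    obtain ⟨v, hv⟩ := hcell
    have hv0 : b.coord v x = 0 := le_antisymm hv ((mem_convexHull_iff_coord hb).1 hxK v)
    have hc : (K.erase (v : Plane)).card = 2 := by
      rw [Finset.card_erase_of_mem v.2, hT.2]
    refine mem_biUnion (x := K.erase (v : Plane)) ⟨?_, hc.le⟩ (mem_convexHull_erase hb hxK hv0)
    exact d.mesh.down_closed hK (Finset.erase_subset _ _) (Finset.card_pos.1 (by omega))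

/-- Almost every point of `Ω` lies in an active cell. -/
lemma IsAdmissible.ae_mem_cell (hd : d.IsAdmissible) :
    ∀ᵐ x ∂volume.restrict d.Ω, ∃ K ∈ d.active, x ∈ cell K := by
  rw [ae_restrict_iff' hd.isOpen.measurableSet]
  have : ∀ᵐ x ∂(volume : Measure Plane), x ∉ d.skeleton :=
    measure_eq_zero_iff_ae_notMem.1 hd.volume_skeleton
  filter_upwards [this] with x hx hxΩ
  exact (hd.mem_cell_or_skeleton hxΩ).resolve_right hx

/-- Faces through `x` are perpendicular to `n` and so miss the cone, where `⟪x - y, n⟫ > 0`. The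
finitely many other faces are closed and stay away from `x`. -/
lemma IsAdmissible.approach_avoids_skeleton (hd : d.IsAdmissible) {x n : Plane}
    (hperp : ∀ F ∈ d.mesh.faces, F.card ≤ 2 → x ∈ convexHull ℝ (F : Set Plane) →
      ∀ y ∈ convexHull ℝ (F : Set Plane), ⟪y - x, n⟫ = 0) {c : ℝ} (hc : 0 < c) :
    ∀ᶠ y in 𝓝 x, c * ‖y - x‖ < ⟪x - y, n⟫ → y ∉ d.skeleton := by
  have key : ∀ F ∈ {F | F ∈ d.mesh.faces ∧ F.card ≤ 2},
      ∀ᶠ y in 𝓝 x, c * ‖y - x‖ < ⟪x - y, n⟫ → y ∉ convexHull ℝ (F : Set Plane) := by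
    intro F hF
    by_cases hx : x ∈ convexHull ℝ (F : Set Plane)
    · refine Eventually.of_forall fun y hy hyF => ?_
      have h0 := hperp F hF.1 hF.2 hx y hyF
      rw [← neg_sub y x, inner_neg_left, h0] at hy
      have : 0 ≤ c * ‖y - x‖ := by positivity
      linarith
    · filter_upwards [(isClosed_convexHull_finset F).isOpen_compl.mem_nhds hx] with y hy _
      exact hy
  filter_upwards [(hd.finite_low_faces.eventually_all).2 key] with y hy hcone hsk
  obtain ⟨F, hF, hyF⟩ := mem_iUnion₂.1 hsk
  exact hy F hF hcone hyF

/-- A truncated cone is convex, hence connected, and is covered by disjoint open cells, so it lies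
in one of them. Different apertures give the same cell, because all these cones share the inner
normal ray. -/
lemma IsAdmissible.approach_le_cell (hd : d.IsAdmissible) {x n : Plane} (hn : IsOuterNormal d.Ω x n)
    (hperp : ∀ F ∈ d.mesh.faces, F.card ≤ 2 → x ∈ convexHull ℝ (F : Set Plane) →
      ∀ y ∈ convexHull ℝ (F : Set Plane), ⟪y - x, n⟫ = 0) :
    ∃ K ∈ d.active, approach d.Ω x ≤ 𝓟 (cell K) := by
  -- The bound `1 / 2` ensures that the cone contains the ray. Larger constants give narrower cones
  -- and are reduced to `min c (1 / 2)` at the end.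
  have key : ∀ c : ℝ, 0 < c → c ≤ 1 / 2 → ∃ K ∈ d.active, ∀ᶠ y in 𝓝 x,
      c * ‖y - x‖ < ⟪x - y, n⟫ → y ∈ cell K := by
    intro c hc hc2
    have h1 := hd.approach_avoids_skeleton hperp hc
    have h2 := mem_approach.1 (le_principal_iff.1 hn.approach_le) c hc
    rw [hn.outerNormal_eq] at h2
    obtain ⟨r, hr, hball⟩ := Metric.eventually_nhds_iff_ball.1 (h1.and h2)
    set C := {y : Plane | c * ‖y - x‖ < ⟪x - y, n⟫} ∩ Metric.ball x r
    have hconv : Convex ℝ C := (convex_cone x n c hc.le).inter (convex_ball x r)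
    have hcover : ∀ y ∈ C, ∃ K ∈ d.active, y ∈ cell K := fun y hy =>
      (hd.mem_cell_or_skeleton ((hball y hy.2).2 hy.1)).resolve_right ((hball y hy.2).1 hy.1)
    have hnn : ⟪n, n⟫ = 1 := by rw [real_inner_self_eq_norm_sq, hn.1]; norm_num
    set y₀ : Plane := x + (r / 2) • (-n)
    have hy₀ : y₀ ∈ C := by
      refine ⟨?_, ?_⟩
      · simp only [mem_ofPred_eq, y₀, add_sub_cancel_left, sub_add_cancel_left, smul_neg, neg_neg,
          norm_neg, norm_smul, hn.1, inner_smul_left, hnn, Real.norm_eq_abs,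
          abs_of_pos (half_pos hr), conj_trivial, mul_one]
        nlinarith
      · simp only [y₀, Metric.mem_ball, dist_eq_norm, add_sub_cancel_left, norm_smul, norm_neg,
          hn.1, Real.norm_eq_abs, abs_of_pos (half_pos hr), mul_one]
        linarith
    obtain ⟨K, hK, hyK⟩ := hcover y₀ hy₀
    refine ⟨K, hK, Metric.eventually_nhds_iff_ball.2 ⟨r, hr, fun y hy hcone => ?_⟩⟩
    have hV : IsOpen (⋃ K' ∈ d.active \ {K}, cell K') :=
      isOpen_biUnion fun K' _ => isOpen_cell K'
    refine hconv.isPreconnected.subset_left_of_subset_union (isOpen_cell K) hV ?_ ?_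
      ⟨y₀, hy₀, hyK⟩ ⟨hcone, hy⟩
    · rw [disjoint_iUnion₂_right]
      intro K' hK'
      exact disjoint_cell hK.1 hK'.1.1 fun h => hK'.2 h.symm
    · intro z hz
      obtain ⟨K', hK', hzK⟩ := hcover z hz
      by_cases hKK : K' = K
      · exact Or.inl (hKK ▸ hzK)
      · exact Or.inr (mem_biUnion (show K' ∈ d.active \ {K} from ⟨hK', hKK⟩) hzK)
  have hray := tendsto_approach hn
  have hhalf : (0 : ℝ) < 1 / 2 := by norm_num
  have hray' : ∀ c : ℝ, 0 < c → c ≤ 1 / 2 → ∀ᶠ s in 𝓝[>] (0 : ℝ),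
      c * ‖x + s • (-n) - x‖ < ⟪x - (x + s • (-n)), n⟫ := by
    intro c _ hc2
    filter_upwards [self_mem_nhdsWithin] with s (hs : 0 < s)
    have hnn : ⟪n, n⟫ = 1 := by rw [real_inner_self_eq_norm_sq, hn.1]; norm_num
    simp only [add_sub_cancel_left, sub_add_cancel_left, smul_neg, neg_neg,
      norm_neg, norm_smul, hn.1, inner_smul_left, hnn, Real.norm_eq_abs,
      abs_of_pos hs, conj_trivial, mul_one]
    nlinarith
  obtain ⟨K, hK, hKe⟩ := key (1 / 2) hhalf le_rfl
  refine ⟨K, hK, ?_⟩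
  rw [le_principal_iff, mem_approach, hn.outerNormal_eq]
  intro c hc
  set c' := min c (1 / 2)
  have hc' : 0 < c' := lt_min hc hhalf
  obtain ⟨K', hK', hKe'⟩ := key c' hc' (min_le_right _ _)
  have hKK : K' = K := by
    by_contra hne
    obtain ⟨s, ⟨⟨h1, h2⟩, h3⟩, h4⟩ := ((((tendsto_ray x (-n)).eventually hKe).and
      ((tendsto_ray x (-n)).eventually hKe')).and (hray' _ hhalf le_rfl)
      |>.and (hray' _ hc' (min_le_right _ _))).exists
    exact Set.disjoint_left.1 (disjoint_cell hK'.1 hK.1 hne) (h2 h4) (h1 h3)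
  rw [hKK] at hKe'
  filter_upwards [hKe'] with y hy hcone
  refine hy (lt_of_le_of_lt ?_ hcone)
  gcongr
  exact min_le_left _ _

lemma IsAdmissible.isBounded (hd : d.IsAdmissible) : Bornology.IsBounded d.Ω := hd.isBounded_hat.subset hd.subset_hat

/-- A mesh edge that is not tangent to the boundary meets it in isolated points only. -/
lemma measure_transversal_edge {Ω : Set Plane} (p q : Plane) :
    μH[1] {x | x ∈ frontier Ω ∧ x ∈ segment ℝ p q ∧
      ∃ n, IsOuterNormal Ω x n ∧ ⟪q - p, n⟫ ≠ 0} = 0 := by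
  have := Measure.nullSingletonClass_hausdorff Plane one_pos
  refine measure_null_of_locally_null _ fun x hx => ?_
  obtain ⟨hxΩ, hxs, n, hn, hpq⟩ := hx
  refine ⟨{x}, ?_, measure_singleton _⟩
  rw [mem_nhdsWithin_iff_eventually]
  -- The tolerance is below half of the normal slope of the edge: two distinct points of the edge
  -- differ too much in normal direction to both be frontier points near `x`.
  have hε : 0 < |⟪q - p, n⟫| / (2 * (‖q - p‖ + 1)) := by positivity
  filter_upwards [hn.abs_inner_le hε] with y hy hyS
  have h1 := hy hyS.1
  have hys := hyS.2.1
  rw [segment_eq_image'] at hxs hys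
  obtain ⟨s, -, rfl⟩ := hxs
  obtain ⟨t, -, rfl⟩ := hys
  have h2 : p + t • (q - p) - (p + s • (q - p)) = (t - s) • (q - p) := by module
  simp only [h2, inner_smul_left, norm_smul, conj_trivial, abs_mul, Real.norm_eq_abs] at h1
  have hpos : 0 < |⟪q - p, n⟫| := abs_pos.2 hpq
  have h3 : |⟪q - p, n⟫| / (2 * (‖q - p‖ + 1)) * ‖q - p‖ ≤ |⟪q - p, n⟫| / 2 := by
    rw [div_mul_eq_mul_div, div_le_div_iff₀ (by positivity) (by norm_num)]
    nlinarith [norm_nonneg (q - p)]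
  have h4 : |t - s| * |⟪q - p, n⟫| ≤ |t - s| * (|⟪q - p, n⟫| / 2) := by
    refine h1.trans ?_
    calc _ = |t - s| * (|⟪q - p, n⟫| / (2 * (‖q - p‖ + 1)) * ‖q - p‖) := by ring
      _ ≤ _ := by gcongr
  have h5 : |t - s| = 0 := by
    have := abs_nonneg (t - s)
    by_contra hne
    have : 0 < |t - s| := lt_of_le_of_ne this (Ne.symm hne)
    nlinarith
  rw [mem_singleton_iff, sub_eq_zero.1 (abs_eq_zero.1 h5)]

/-- At almost every boundary point of `Ω` there is a normal, and nontangential approach takes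
place within a single active cell. -/
lemma IsAdmissible.ae_approach_le_cell (hd : d.IsAdmissible) :
    ∀ᵐ x ∂μH[1].restrict (frontier d.Ω), (∃ n, IsOuterNormal d.Ω x n) ∧
      ∃ K ∈ d.active, approach d.Ω x ≤ 𝓟 (cell K) := by
  have key : ∀ F ∈ {F | F ∈ d.mesh.faces ∧ F.card ≤ 2}, ∀ᵐ x ∂μH[1].restrict (frontier d.Ω),
      ∀ n, IsOuterNormal d.Ω x n → x ∈ convexHull ℝ (F : Set Plane) →
        ∀ y ∈ convexHull ℝ (F : Set Plane), ⟪y - x, n⟫ = 0 := by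
    intro F hF
    rcases Nat.lt_or_ge F.card 2 with h1 | h2
    · refine Eventually.of_forall fun x n _ hx y hy => ?_
      obtain ⟨p, hp⟩ := Finset.card_eq_one.1
        (le_antisymm (by omega) (d.mesh.nonempty_of_mem_faces hF.1).card_pos)
      simp [hp] at hx hy
      simp [hx, hy]
    · obtain ⟨p, q, hpq, rfl⟩ := Finset.card_eq_two.1 (le_antisymm hF.2 h2)
      have hcoe : ((({p, q} : Finset Plane)) : Set Plane) = {p, q} := by simp
      rw [hcoe, convexHull_pair]
      rw [ae_restrict_iff' isClosed_frontier.measurableSet]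
      have := measure_eq_zero_iff_ae_notMem.1 (measure_transversal_edge (Ω := d.Ω) p q)
      filter_upwards [this] with x hx hxΩ n hn hxs y hys
      have h0 : ⟪q - p, n⟫ = 0 := by
        by_contra hne
        exact hx ⟨hxΩ, hxs, n, hn, hne⟩
      rw [segment_eq_image'] at hxs hys
      obtain ⟨s, -, rfl⟩ := hxs
      obtain ⟨t, -, rfl⟩ := hys
      have h2 : p + t • (q - p) - (p + s • (q - p)) = (t - s) • (q - p) := by module
      rw [h2, inner_smul_left, h0, mul_zero]
  have key' := (ae_ball_iff hd.finite_low_faces.countable).2 key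
  filter_upwards [key', hd.lipschitz.ae_exists_isOuterNormal] with x hx ⟨n, hn⟩
  exact ⟨⟨n, hn⟩, hd.approach_le_cell hn fun F hF hc => hx F ⟨hF, hc⟩ n hn⟩

end Discretization

/-! ### Differentiation of integrals that depend on a parameter -/

section ParametricIntegral

variable {E X : Type*} [NormedAddCommGroup E]

/-- A `C¹` function is Lipschitz near each `(0, y)`, and compactness makes radius and constant
uniform. The continuity clause serves to integrate `Φ (t, ·)` for `t ≠ 0`. -/
lemma IsCompact.exists_uniform_lipschitz [NormedSpace ℝ E] {Q : Set E} (hQ : IsCompact Q) {Φ : ℝ × E → ℝ}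
    (hΦ : ∀ y ∈ Q, ContDiffAt ℝ 1 Φ (0, y)) :
    ∃ δ > 0, ∃ C : ℝ≥0, ∀ y ∈ Q,
      LipschitzOnWith C (fun t => Φ (t, y)) (Metric.ball 0 δ) ∧
      ∀ t ∈ Metric.ball (0 : ℝ) δ, ContinuousAt Φ (t, y) := by
  refine hQ.induction_on (p := fun s => ∃ δ > 0, ∃ C : ℝ≥0, ∀ y ∈ s,
      LipschitzOnWith C (fun t => Φ (t, y)) (Metric.ball 0 δ) ∧
      ∀ t ∈ Metric.ball (0 : ℝ) δ, ContinuousAt Φ (t, y)) ?_ ?_ ?_ ?_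
  · exact ⟨1, one_pos, 0, by simp⟩
  · rintro s t hst ⟨δ, hδ, C, h⟩
    exact ⟨δ, hδ, C, fun y hy => h y (hst hy)⟩
  · rintro s t ⟨δ, hδ, C, h⟩ ⟨δ', hδ', C', h'⟩
    refine ⟨min δ δ', lt_min hδ hδ', max C C', ?_⟩
    have e1 := Metric.ball_subset_ball (x := (0 : ℝ)) (min_le_left δ δ')
    have e2 := Metric.ball_subset_ball (x := (0 : ℝ)) (min_le_right δ δ')
    rintro y (hy | hy)
    · exact ⟨((h y hy).1.mono e1).weaken (le_max_left _ _), fun t ht => (h y hy).2 t (e1 ht)⟩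
    · exact ⟨((h' y hy).1.mono e2).weaken (le_max_right _ _), fun t ht => (h' y hy).2 t (e2 ht)⟩
  · intro y hy
    obtain ⟨K, u, hu, hK⟩ := (hΦ y hy).exists_lipschitzOnWith
    have hc : ∀ᶠ z in 𝓝 ((0 : ℝ), y), ContinuousAt Φ z :=
      ((hΦ y hy).eventually (by simp)).mono fun z hz => hz.continuousAt
    obtain ⟨v, hv, w, hw, hvw⟩ := mem_nhds_prod_iff.1 (hc.and hu)
    obtain ⟨δ, hδ, hball⟩ := Metric.mem_nhds_iff.1 hv
    refine ⟨w, mem_nhdsWithin_of_mem_nhds hw, δ, hδ, K, fun z hz => ⟨?_, fun t ht =>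
      (hvw (mk_mem_prod (hball ht) hz)).1⟩⟩
    refine LipschitzOnWith.of_dist_le_mul fun s hs t ht => ?_
    have := hK.dist_le_mul (s, z) (hvw (mk_mem_prod (hball hs) hz)).2 (t, z)
      (hvw (mk_mem_prod (hball ht) hz)).2
    simpa [Prod.dist_eq] using this

variable [MeasurableSpace X] {μ : Measure X} [IsFiniteMeasure μ]
  [MeasurableSpace E] [BorelSpace E]

lemma integrable_comp_of_continuousOn [SecondCountableTopology E] {Q : Set E} (hQ : IsCompact Q)
    {φ : E → ℝ} (hφ : ContinuousOn φ Q) {q : X → E} (hq : AEMeasurable q μ)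
    (hqQ : ∀ᵐ x ∂μ, q x ∈ Q) : Integrable (fun x => φ (q x)) μ := by
  obtain ⟨C, hC⟩ := hQ.exists_bound_of_continuousOn hφ
  refine Integrable.of_bound ?_ C (hqQ.mono fun x hx => hC _ hx)
  have h1 : AEStronglyMeasurable φ ((μ.map q).restrict Q) :=
    hφ.aestronglyMeasurable hQ.measurableSet
  have h2 : (μ.map q).restrict Q = μ.map q := Measure.restrict_eq_self_of_ae_mem
    ((ae_map_iff hq hQ.measurableSet).2 hqQ)
  rw [h2] at h1
  exact h1.comp_aemeasurable hq

/-- Differentiation under the integral sign; the dominating function is the uniform Lipschitz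
constant, integrable since the measure is finite. -/
lemma hasDerivAt_integral_of_compact [NormedSpace ℝ E] [SecondCountableTopology E] {Q : Set E} (hQ : IsCompact Q)
    {Φ : ℝ × E → ℝ} (hΦ : ∀ y ∈ Q, ContDiffAt ℝ 1 Φ (0, y)) {q : X → E} (hq : AEMeasurable q μ)
    (hqQ : ∀ᵐ x ∂μ, q x ∈ Q) {Φ' : X → ℝ}
    (hd : ∀ᵐ x ∂μ, HasDerivAt (fun t => Φ (t, q x)) (Φ' x) 0) :
    Integrable Φ' μ ∧
      HasDerivAt (fun t => ∫ x, Φ (t, q x) ∂μ) (∫ x, Φ' x ∂μ) 0 := by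
  obtain ⟨δ, hδ, C, h⟩ := IsCompact.exists_uniform_lipschitz hQ hΦ
  have hint : ∀ t ∈ Metric.ball (0 : ℝ) δ, Integrable (fun x => Φ (t, q x)) μ := fun t ht =>
    integrable_comp_of_continuousOn hQ (φ := fun y => Φ (t, y)) (fun y hy =>
      (((h y hy).2 t ht).comp (by fun_prop : ContinuousAt (fun y : E => (t, y)) y)
        ).continuousWithinAt) hq hqQ
  have hball : Metric.ball (0 : ℝ) δ ∈ 𝓝 0 := Metric.ball_mem_nhds 0 hδ
  refine hasDerivAt_integral_of_dominated_loc_of_lip (bound := fun _ => (C : ℝ)) hball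
    (Filter.mem_of_superset hball fun t ht => (hint t ht).1) (hint 0 (Metric.mem_ball_self hδ))
    ?_ ?_ (integrable_const _) hd
  -- `Φ'` is measurable as an almost everywhere limit of difference quotients along a sequence; the
  -- `+ 2` keeps even its first term inside the open ball.
  · set s : ℕ → ℝ := fun n => δ / ((n : ℝ) + 2)
    have hs0 : ∀ n, 0 < s n := fun n => by positivity
    have hsb : ∀ n, s n ∈ Metric.ball (0 : ℝ) δ := fun n => by
      rw [mem_ball_zero_iff, Real.norm_of_nonneg (hs0 n).le, div_lt_iff₀ (by positivity)]
      have : (0 : ℝ) ≤ n := n.cast_nonneg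
      nlinarith
    have hst : Tendsto s atTop (𝓝[≠] 0) := by
      refine tendsto_nhdsWithin_iff.2 ⟨?_, Eventually.of_forall fun n => (hs0 n).ne'⟩
      exact tendsto_const_nhds.div_atTop
        (tendsto_atTop_add_const_right _ _ tendsto_natCast_atTop_atTop)
    refine aestronglyMeasurable_of_tendsto_ae atTop
      (f := fun n x => (s n)⁻¹ • (Φ (0 + s n, q x) - Φ (0, q x))) (fun n => ?_) ?_
    · have h1 := hint _ (hsb n)
      have h0 := hint 0 (Metric.mem_ball_self hδ)
      simp only [zero_add]
      exact ((h1.sub h0).smul (s n)⁻¹).1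
    · filter_upwards [hd] with x hx
      exact (hasDerivAt_iff_tendsto_slope_zero.1 hx).comp hst
  · filter_upwards [hqQ] with x hx
    simpa using (h _ hx).1

end ParametricIntegral

/-! ### The integrands -/

/-- The data on which the integrands depend: the derivative of the deformation, a normal, and
the gradients and values of two functions. -/
abbrev Jet : Type := (Plane →L[ℝ] Plane) × Plane × (Plane × ℝ) × (Plane × ℝ)

/-- Integrands that are bilinear in the two functions, and smooth for nondegenerate
deformations. -/
structure IsFormIntegrand (Ψ : Jet → ℝ) : Prop where
  left : ∀ N n (c : ℝ) w₁ w₂ w', Ψ (N, n, w₁ + c • w₂, w') = Ψ (N, n, w₁, w') + c * Ψ (N, n, w₂, w')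
  right : ∀ N n (c : ℝ) w w₁ w₂, Ψ (N, n, w, w₁ + c • w₂) = Ψ (N, n, w, w₁) + c * Ψ (N, n, w, w₂)
  smooth : ∀ N n w w', det₂ N ≠ 0 → n ≠ 0 → ContDiffAt ℝ 1 Ψ (N, n, w, w')

/-- The integrand of `(∇w, ∇v)`. -/
def bulkIntegrand (z : Jet) : ℝ := ⟪cof z.1 z.2.2.1.1, cof z.1 z.2.2.2.1⟫ * (det₂ z.1)⁻¹

/-- The integrand of `⟨D_n w, v⟩`. -/
def fluxIntegrand (z : Jet) : ℝ :=
  ⟪cof z.1 z.2.2.1.1, cof z.1 z.2.1⟫ * (det₂ z.1)⁻¹ * z.2.2.2.2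

/-- The integrand of `⟨w, v⟩`. -/
def massIntegrand (z : Jet) : ℝ := ‖cof z.1 z.2.1‖ * z.2.2.1.2 * z.2.2.2.2

/-- The integrand of the ghost penalty. -/
def ghostIntegrand (z : Jet) : ℝ :=
  ⟪cof z.1 z.2.2.1.1, cof z.1 z.2.1⟫ * ⟪cof z.1 z.2.2.2.1, cof z.1 z.2.1⟫ *
    ((det₂ z.1)⁻¹ ^ 2 * ‖cof z.1 z.2.1‖⁻¹)

lemma contDiff_det₂ : ContDiff ℝ 1 det₂ := by
  have h : ∀ (v : Plane) (i : Fin 2), ContDiff ℝ 1 fun N : Plane →L[ℝ] Plane => N v i :=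
    fun v i => (EuclideanSpace.proj (𝕜 := ℝ) i).contDiff.comp
      (ContinuousLinearMap.apply ℝ Plane v).contDiff
  exact ((h _ _).mul (h _ _)).sub ((h _ _).mul (h _ _))

lemma ContDiffAt.cof {E : Type*} [NormedAddCommGroup E] [NormedSpace ℝ E]
    {N : E → Plane →L[ℝ] Plane} {v : E → Plane} {z : E} (hN : ContDiffAt ℝ 1 N z)
    (hv : ContDiffAt ℝ 1 v z) : ContDiffAt ℝ 1 (fun z => CutFEM.cof (N z) (v z)) z := by
  have h1 : ContDiffAt ℝ 1 (fun z => -rot (v z)) z := (rot.contDiff.contDiffAt.comp z hv).neg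
  exact rot.contDiff.contDiffAt.comp z (hN.clm_apply h1)

lemma contDiffAt_det₂_inv {E : Type*} [NormedAddCommGroup E] [NormedSpace ℝ E]
    {N : E → Plane →L[ℝ] Plane} {z : E} (hN : ContDiffAt ℝ 1 N z) (h : det₂ (N z) ≠ 0) :
    ContDiffAt ℝ 1 (fun z => (det₂ (N z))⁻¹) z :=
  (contDiff_det₂.contDiffAt.comp z hN).inv h

lemma contDiffAt_norm_cof {E : Type*} [NormedAddCommGroup E] [NormedSpace ℝ E]
    {N : E → Plane →L[ℝ] Plane} {v : E → Plane} {z : E} (hN : ContDiffAt ℝ 1 N z)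
    (hv : ContDiffAt ℝ 1 v z) (h : cof (N z) (v z) ≠ 0) :
    ContDiffAt ℝ 1 (fun z => ‖cof (N z) (v z)‖) z :=
  (ContDiffAt.cof hN hv).norm ℝ h

section Smooth

variable {N : Plane →L[ℝ] Plane} {n : Plane} {w w' : Plane × ℝ}

lemma contDiffAt_jet_cof {f : Jet → Plane} {z : Jet} (hf : ContDiff ℝ 1 f) :
    ContDiffAt ℝ 1 (fun z : Jet => cof z.1 (f z)) z :=
  ContDiffAt.cof contDiffAt_fst hf.contDiffAt

lemma isFormIntegrand_bulk : IsFormIntegrand bulkIntegrand where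
  left N n c w₁ w₂ w' := by
    simp [bulkIntegrand, inner_add_left, inner_smul_left]; ring
  right N n c w₁ w₂ w' := by
    simp [bulkIntegrand, inner_add_right, inner_smul_right]; ring
  smooth N n w w' hN hn :=
    ((contDiffAt_jet_cof (by fun_prop)).inner ℝ (contDiffAt_jet_cof (by fun_prop))).mul
      (contDiffAt_det₂_inv contDiffAt_fst hN)

lemma isFormIntegrand_flux : IsFormIntegrand fluxIntegrand where
  left N n c w₁ w₂ w' := by
    simp [fluxIntegrand, inner_add_left, inner_smul_left]; ring
  right N n c w₁ w₂ w' := by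
    simp [fluxIntegrand]; ring
  smooth N n w w' hN hn := by
    refine (((contDiffAt_jet_cof (by fun_prop)).inner ℝ (contDiffAt_jet_cof (by fun_prop))).mul
      (contDiffAt_det₂_inv contDiffAt_fst hN)).mul ?_
    fun_prop

lemma isFormIntegrand_mass : IsFormIntegrand massIntegrand where
  left N n c w₁ w₂ w' := by
    simp [massIntegrand]; ring
  right N n c w₁ w₂ w' := by
    simp [massIntegrand]; ring
  smooth N n w w' hN hn := by
    have h1 : ContDiffAt ℝ 1 (fun z : Jet => ‖cof z.1 z.2.1‖) (N, n, w, w') :=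
      contDiffAt_norm_cof contDiffAt_fst (by fun_prop) (cof_ne_zero hN hn)
    have h2 : ContDiffAt ℝ 1 (fun z : Jet => z.2.2.1.2) (N, n, w, w') := by fun_prop
    have h3 : ContDiffAt ℝ 1 (fun z : Jet => z.2.2.2.2) (N, n, w, w') := by fun_prop
    exact (h1.mul h2).mul h3

lemma isFormIntegrand_ghost : IsFormIntegrand ghostIntegrand where
  left N n c w₁ w₂ w' := by
    simp [ghostIntegrand, inner_add_left, inner_smul_left]; ring
  right N n c w₁ w₂ w' := by
    simp [ghostIntegrand, inner_add_left, inner_smul_left]; ring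
  smooth N n w w' hN hn := by
    have h1 : ContDiffAt ℝ 1 (fun z : Jet => ‖cof z.1 z.2.1‖) (N, n, w, w') :=
      contDiffAt_norm_cof contDiffAt_fst (by fun_prop) (cof_ne_zero hN hn)
    have h2 : ContDiffAt ℝ 1 (fun z : Jet => ‖cof z.1 z.2.1‖⁻¹) (N, n, w, w') :=
      h1.inv (norm_ne_zero_iff.2 (cof_ne_zero hN hn))
    have h3 : ContDiffAt ℝ 1 (fun z : Jet => (det₂ z.1)⁻¹) (N, n, w, w') :=
      contDiffAt_det₂_inv contDiffAt_fst hN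
    exact (((contDiffAt_jet_cof (by fun_prop)).inner ℝ (contDiffAt_jet_cof (by fun_prop))).mul
      ((contDiffAt_jet_cof (by fun_prop)).inner ℝ (contDiffAt_jet_cof (by fun_prop)))).mul
      ((h3.pow 2).mul h2)

end Smooth

section Derivatives

variable (M : Plane →L[ℝ] Plane) (n g g' : Plane) (a b : ℝ)

lemma hasDerivAt_det₂ : HasDerivAt (fun t : ℝ => det₂ (1 + t • M)) (tr₂ M) 0 := by
  simp only [det₂_one_add_smul]
  have h := (((hasDerivAt_id (0 : ℝ)).mul_const (tr₂ M)).const_add 1).fun_add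
    (((hasDerivAt_id (0 : ℝ)).fun_pow 2).mul_const (det₂ M))
  simpa using h

lemma hasDerivAt_det₂_inv : HasDerivAt (fun t : ℝ => (det₂ (1 + t • M))⁻¹) (-tr₂ M) 0 := by
  have h0 : det₂ (1 + (0 : ℝ) • M) = 1 := by rw [det₂_one_add_smul]; simp
  have := (hasDerivAt_det₂ M).fun_inv (by rw [h0]; norm_num)
  rw [h0] at this
  simpa using this

lemma hasDerivAt_cof : HasDerivAt (fun t : ℝ => cof (1 + t • M) g) (cof M g) 0 := by
  have h : ∀ t : ℝ, cof (1 + t • M) g = g + t • cof M g := fun t => by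
    rw [cof_add, cof_smul, cof_one]; rfl
  simp only [h]
  simpa using ((hasDerivAt_id (0 : ℝ)).smul_const (cof M g)).const_add g

lemma cof_one_add_zero : cof (1 + (0 : ℝ) • M) g = g := by
  rw [cof_add, cof_smul, cof_one]; simp

lemma det₂_one_add_zero : det₂ (1 + (0 : ℝ) • M) = 1 := by
  rw [det₂_one_add_smul]; simp

lemma hasDerivAt_inner_cof : HasDerivAt (fun t : ℝ => ⟪cof (1 + t • M) g, cof (1 + t • M) g'⟫)
    (2 * tr₂ M * ⟪g, g'⟫ - ⟪M g, g'⟫ - ⟪g, M g'⟫) 0 := by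
  have h := (hasDerivAt_cof M g).inner ℝ (hasDerivAt_cof M g')
  rw [cof_one_add_zero, cof_one_add_zero] at h
  refine h.congr_deriv ?_
  rw [cof_eq, real_inner_comm (cof M g') g, cof_eq, real_inner_comm g g', real_inner_comm (M g) g']
  ring

/-- The arc length factor is the root of `⟪cof N n, cof N n⟫`, which equals `1` at `t = 0`. For `M =
Dθ` its derivative is the tangential divergence. -/
lemma hasDerivAt_norm_cof (hn : ‖n‖ = 1) :
    HasDerivAt (fun t : ℝ => ‖cof (1 + t • M) n‖) (tr₂ M - ⟪M n, n⟫) 0 := by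
  have h := hasDerivAt_inner_cof M n n
  have hnn : ⟪n, n⟫ = 1 := by rw [real_inner_self_eq_norm_sq, hn]; norm_num
  have h0 : ⟪cof (1 + (0 : ℝ) • M) n, cof (1 + (0 : ℝ) • M) n⟫ = 1 := by
    rw [cof_one_add_zero, hnn]
  have h1 := h.sqrt (by rw [h0]; norm_num)
  rw [h0] at h1
  have h2 : (fun t : ℝ => √⟪cof (1 + t • M) n, cof (1 + t • M) n⟫) =
      fun t : ℝ => ‖cof (1 + t • M) n‖ := by
    funext t
    rw [real_inner_self_eq_norm_sq, Real.sqrt_sq (norm_nonneg _)]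
  rw [h2] at h1
  refine h1.congr_deriv ?_
  rw [hnn, real_inner_comm (M n) n]
  simp; ring

lemma hasDerivAt_bulkIntegrand :
    HasDerivAt (fun t : ℝ => bulkIntegrand (1 + t • M, n, (g, a), (g', b)))
      (tr₂ M * ⟪g, g'⟫ - ⟪M g, g'⟫ - ⟪g, M g'⟫) 0 := by
  have h := (hasDerivAt_inner_cof M g g').fun_mul (hasDerivAt_det₂_inv M)
  rw [cof_one_add_zero, cof_one_add_zero, det₂_one_add_zero] at h
  refine h.congr_deriv ?_
  ring

lemma hasDerivAt_fluxIntegrand :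
    HasDerivAt (fun t : ℝ => fluxIntegrand (1 + t • M, n, (g, a), (g', b)))
      ((tr₂ M * ⟪g, n⟫ - ⟪M g, n⟫ - ⟪g, M n⟫) * b) 0 := by
  have h := ((hasDerivAt_inner_cof M g n).fun_mul (hasDerivAt_det₂_inv M)).mul_const b
  rw [cof_one_add_zero, cof_one_add_zero, det₂_one_add_zero] at h
  refine h.congr_deriv ?_
  ring

lemma hasDerivAt_massIntegrand (hn : ‖n‖ = 1) :
    HasDerivAt (fun t : ℝ => massIntegrand (1 + t • M, n, (g, a), (g', b)))
      ((tr₂ M - ⟪M n, n⟫) * a * b) 0 :=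
  ((hasDerivAt_norm_cof M n hn).mul_const a).mul_const b

/-- Each of the two flux factors contributes `2 tr M`, and `det⁻²` takes back one trace from each.
The inverse arc length factor yields the last term, with its minus sign. -/
lemma hasDerivAt_ghostIntegrand (hn : ‖n‖ = 1) :
    HasDerivAt (fun t : ℝ => ghostIntegrand (1 + t • M, n, (g, a), (g', b)))
      ((tr₂ M * ⟪g, n⟫ - ⟪M g, n⟫ - ⟪g, M n⟫) * ⟪g', n⟫ +
        (tr₂ M * ⟪g', n⟫ - ⟪M g', n⟫ - ⟪g', M n⟫) * ⟪g, n⟫ -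
        ⟪g, n⟫ * ⟪g', n⟫ * (tr₂ M - ⟪M n, n⟫)) 0 := by
  have h1 := (hasDerivAt_norm_cof M n hn).fun_inv (by rw [cof_one_add_zero, hn]; norm_num)
  have h := ((hasDerivAt_inner_cof M g n).fun_mul (hasDerivAt_inner_cof M g' n)).fun_mul
    (((hasDerivAt_det₂_inv M).fun_pow 2).fun_mul h1)
  simp only [cof_one_add_zero, det₂_one_add_zero, hn] at h
  refine h.congr_deriv ?_
  norm_num
  ring

end Derivatives

/-! ### Forms given by integrands -/

/-- A measure, a field of normals, and an evaluation of coefficient vectors to gradients and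
values. -/
structure EvalData (C : Type*) [AddCommGroup C] [Module ℝ C] where
  μ : Measure Plane
  normal : Plane → Plane
  eval : C →ₗ[ℝ] (Plane → Plane × ℝ)

/-- Finiteness, measurability and boundedness of evaluation data. -/
structure EvalData.IsRegular {C : Type*} [AddCommGroup C] [Module ℝ C] (s : EvalData C) :
    Prop where
  finite : IsFiniteMeasure s.μ
  measurable_normal : Measurable s.normal
  norm_normal : ∀ᵐ x ∂s.μ, ‖s.normal x‖ = 1
  measurable_eval : ∀ α, Measurable (s.eval α)
  bounded_eval : ∀ α, ∃ R, ∀ᵐ x ∂s.μ, ‖s.eval α x‖ ≤ R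

/-- The bilinear form with integrand `Ψ` for a deformation with derivative `N`. -/
def EvalData.form {C : Type*} [AddCommGroup C] [Module ℝ C] (s : EvalData C) (Ψ : Jet → ℝ)
    (N : Plane → Plane →L[ℝ] Plane) (α β : C) : ℝ :=
  ∫ x, Ψ (N x, s.normal x, s.eval α x, s.eval β x) ∂s.μ

/-- Uniformly nondegenerate orientation preserving fields of linear maps. -/
structure IsNondegenerate (N : Plane → Plane →L[ℝ] Plane) : Prop where
  continuous : Continuous N
  bounded : ∃ R, ∀ x, ‖N x‖ ≤ R
  det_pos : ∃ c : ℝ, 0 < c ∧ ∀ x, c ≤ det₂ (N x)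

instance : ProperSpace Jet := FiniteDimensional.proper_real Jet

/-- The arguments that occur stay in a compact part of the region where the integrands are `C¹`:
`det N` is bounded below and the normal has length one. -/
lemma isCompact_jets (R c : ℝ) :
    IsCompact {z : Jet | ‖z‖ ≤ R ∧ c ≤ det₂ z.1 ∧ ‖z.2.1‖ = 1} := by
  have h1 : IsClosed {z : Jet | c ≤ det₂ z.1 ∧ ‖z.2.1‖ = 1} :=
    (isClosed_le continuous_const (continuous_det₂.comp continuous_fst)).inter
      (isClosed_eq (by fun_prop) continuous_const)
  have : {z : Jet | ‖z‖ ≤ R ∧ c ≤ det₂ z.1 ∧ ‖z.2.1‖ = 1} =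
      Metric.closedBall 0 R ∩ {z : Jet | c ≤ det₂ z.1 ∧ ‖z.2.1‖ = 1} := by
    ext z; simp
  rw [this]
  exact (isCompact_closedBall _ _).inter_right h1

section Form

variable {C : Type*} [AddCommGroup C] [Module ℝ C] {s : EvalData C} {Ψ : Jet → ℝ}

lemma EvalData.IsRegular.aemeasurable_jet (hs : s.IsRegular)
    {N : Plane → Plane →L[ℝ] Plane} (hN : Continuous N) (α β : C) :
    AEMeasurable (fun x => ((N x, s.normal x, s.eval α x, s.eval β x) : Jet)) s.μ :=
  (hN.measurable.prodMk (hs.measurable_normal.prodMk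
    ((hs.measurable_eval α).prodMk (hs.measurable_eval β)))).aemeasurable

lemma EvalData.IsRegular.exists_jet_bound (hs : s.IsRegular)
    {N : Plane → Plane →L[ℝ] Plane} (hN : ∃ R, ∀ x, ‖N x‖ ≤ R) (α β : C) :
    ∃ R, ∀ᵐ x ∂s.μ, ‖((N x, s.normal x, s.eval α x, s.eval β x) : Jet)‖ ≤ R := by
  obtain ⟨R₁, h₁⟩ := hN
  obtain ⟨R₂, h₂⟩ := hs.bounded_eval α
  obtain ⟨R₃, h₃⟩ := hs.bounded_eval β
  refine ⟨max R₁ (max 1 (max R₂ R₃)), ?_⟩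
  filter_upwards [h₂, h₃, hs.norm_normal] with x hx₂ hx₃ hx
  simp only [Prod.norm_mk]
  exact max_le_max (h₁ x) (max_le_max hx.le (max_le_max hx₂ hx₃))

lemma EvalData.IsRegular.integrable (hs : s.IsRegular) (hΨ : IsFormIntegrand Ψ)
    {N : Plane → Plane →L[ℝ] Plane} (hN : IsNondegenerate N) (α β : C) :
    Integrable (fun x => Ψ (N x, s.normal x, s.eval α x, s.eval β x)) s.μ := by
  have := hs.finite
  obtain ⟨R, hR⟩ := hs.exists_jet_bound hN.bounded α β
  obtain ⟨c, hc, hdet⟩ := hN.det_pos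
  refine integrable_comp_of_continuousOn (isCompact_jets R c) (φ := Ψ) ?_
    (hs.aemeasurable_jet hN.continuous α β) ?_
  · rintro ⟨N, n, w, w'⟩ ⟨-, hd, hn⟩
    refine (hΨ.smooth N n w w' (hc.trans_le hd).ne' ?_).continuousAt.continuousWithinAt
    rintro rfl
    simp at hn
  · filter_upwards [hR, hs.norm_normal] with x h1 h2
    exact ⟨h1, hdet x, h2⟩

lemma EvalData.IsRegular.form_left (hs : s.IsRegular) (hΨ : IsFormIntegrand Ψ)
    {N : Plane → Plane →L[ℝ] Plane} (hN : IsNondegenerate N) (c : ℝ) (α₁ α₂ β : C) :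
    s.form Ψ N (α₁ + c • α₂) β = s.form Ψ N α₁ β + c * s.form Ψ N α₂ β := by
  rw [EvalData.form, EvalData.form, EvalData.form, ← integral_const_mul,
    ← integral_add (hs.integrable hΨ hN _ _) ((hs.integrable hΨ hN _ _).const_mul c)]
  refine integral_congr_ae (Eventually.of_forall fun x => ?_)
  simp only [map_add, map_smul, Pi.add_apply, Pi.smul_apply]
  exact hΨ.left _ _ _ _ _ _

lemma EvalData.IsRegular.form_right (hs : s.IsRegular) (hΨ : IsFormIntegrand Ψ)
    {N : Plane → Plane →L[ℝ] Plane} (hN : IsNondegenerate N) (c : ℝ) (α β₁ β₂ : C) :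
    s.form Ψ N α (β₁ + c • β₂) = s.form Ψ N α β₁ + c * s.form Ψ N α β₂ := by
  rw [EvalData.form, EvalData.form, EvalData.form, ← integral_const_mul,
    ← integral_add (hs.integrable hΨ hN _ _) ((hs.integrable hΨ hN _ _).const_mul c)]
  refine integral_congr_ae (Eventually.of_forall fun x => ?_)
  simp only [map_add, map_smul, Pi.add_apply, Pi.smul_apply]
  exact hΨ.right _ _ _ _ _ _

/-- The first component of `z` is here the derivative of `θ`. At `t = 0` the deformation is the
identity whatever it is, so no determinant condition on it is needed. -/
lemma contDiffAt_perturbed (hΨ : IsFormIntegrand Ψ) {z : Jet} (hz : z.2.1 ≠ 0) :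
    ContDiffAt ℝ 1 (fun p : ℝ × Jet => Ψ (1 + p.1 • p.2.1, p.2.2)) (0, z) := by
  have h0 : ((1 : Plane →L[ℝ] Plane) + (0 : ℝ) • z.1) = 1 := by ext; simp
  have hdet : det₂ (1 : Plane →L[ℝ] Plane) ≠ 0 := by simp [det₂]
  have h1 : ContDiffAt ℝ 1 Ψ ((1 : Plane →L[ℝ] Plane) + (0 : ℝ) • z.1, z.2) := by
    rw [h0]
    exact hΨ.smooth 1 z.2.1 z.2.2.1 z.2.2.2 hdet hz
  have h2 : ContDiffAt ℝ 1 (fun p : ℝ × Jet =>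
      (((1 : Plane →L[ℝ] Plane) + p.1 • p.2.1, p.2.2) : Jet)) (0, z) := by fun_prop
  exact ContDiffAt.comp (0, z) (g := Ψ) (f := fun p : ℝ × Jet =>
      (((1 : Plane →L[ℝ] Plane) + p.1 • p.2.1, p.2.2) : Jet)) h1 h2

/-- The shape derivative of a form. -/
lemma EvalData.IsRegular.hasDerivAt_form (hs : s.IsRegular) (hΨ : IsFormIntegrand Ψ)
    {M : Plane → Plane →L[ℝ] Plane} (hM : Continuous M) (hMb : ∃ R, ∀ x, ‖M x‖ ≤ R) (α β : C)
    {Ψ' : Plane → ℝ}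
    (hd : ∀ᵐ x ∂s.μ, HasDerivAt
      (fun t : ℝ => Ψ (1 + t • M x, s.normal x, s.eval α x, s.eval β x)) (Ψ' x) 0) :
    Integrable Ψ' s.μ ∧
    HasDerivAt (fun t : ℝ => s.form Ψ (fun x => 1 + t • M x) α β) (∫ x, Ψ' x ∂s.μ) 0 := by
  have := hs.finite
  obtain ⟨R, hR⟩ := hs.exists_jet_bound hMb α β
  have hQ : IsCompact {z : Jet | ‖z‖ ≤ R ∧ ‖z.2.1‖ = 1} := by
    have : {z : Jet | ‖z‖ ≤ R ∧ ‖z.2.1‖ = 1} =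
        Metric.closedBall 0 R ∩ {z : Jet | ‖z.2.1‖ = 1} := by
      ext z; simp
    rw [this]
    exact (isCompact_closedBall _ _).inter_right (isClosed_eq (by fun_prop) continuous_const)
  refine hasDerivAt_integral_of_compact hQ
    (Φ := fun p : ℝ × Jet => Ψ (1 + p.1 • p.2.1, p.2.2)) ?_ (hs.aemeasurable_jet hM α β) ?_ hd
  · rintro z ⟨-, hz⟩
    refine contDiffAt_perturbed hΨ fun h => ?_
    simp [h] at hz
  · filter_upwards [hR, hs.norm_normal] with x h1 h2
    exact ⟨h1, h2⟩

end Form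

/-! ### Coefficient vectors of discrete functions -/

/-- The gradient and the value at `x` of the affine function with coefficients `c`. -/
def affineJet (x : Plane) : Plane × ℝ →ₗ[ℝ] Plane × ℝ where
  toFun c := (c.1, ⟪c.1, x⟫ + c.2)
  map_add' c c' := by ext <;> simp [inner_add_left]; ring
  map_smul' r c := by ext <;> simp [inner_smul_left]; ring

@[simp] lemma affineJet_apply (x : Plane) (c : Plane × ℝ) : affineJet x c = (c.1, ⟪c.1, x⟫ + c.2) :=
  rfl

section Pick

variable {ι : Type*} [Fintype ι]

open Classical in
/-- The jet of the piecewise affine function with coefficients `α` on the pieces `B`. -/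
def pick (B : ι → Set Plane) : (ι → Plane × ℝ) →ₗ[ℝ] (Plane → Plane × ℝ) where
  toFun α x := ∑ i, if x ∈ B i then affineJet x (α i) else 0
  map_add' α β := by
    ext1 x
    simp only [Pi.add_apply, map_add, ← Finset.sum_add_distrib]
    refine Finset.sum_congr rfl fun i _ => ?_
    split_ifs <;> simp
  map_smul' c α := by
    ext1 x
    simp only [Pi.smul_apply, map_smul, RingHom.id_apply, Finset.smul_sum]
    refine Finset.sum_congr rfl fun i _ => ?_
    split_ifs <;> simp

lemma pick_eq {B : ι → Set Plane} {x : Plane} {i : ι} (hi : x ∈ B i)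
    (h : ∀ j, j ≠ i → x ∉ B j) (α : ι → Plane × ℝ) : pick B α x = affineJet x (α i) := by
  classical
  simp only [pick, LinearMap.coe_mk, AddHom.coe_mk]
  rw [Finset.sum_eq_single i (fun j _ hj => if_neg (h j hj)) (by simp), if_pos hi]

lemma measurable_pick {B : ι → Set Plane} (hB : ∀ i, MeasurableSet (B i)) (α : ι → Plane × ℝ) :
    Measurable (pick B α) := by
  classical
  simp only [pick, LinearMap.coe_mk, AddHom.coe_mk]
  refine Finset.measurable_sum _ fun i _ => Measurable.ite (hB i) ?_ measurable_const
  simp only [affineJet_apply]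
  exact (by fun_prop : Continuous fun x : Plane => ((α i).1, ⟪(α i).1, x⟫ + (α i).2)).measurable

lemma norm_pick_le (B : ι → Set Plane) (α : ι → Plane × ℝ) {R : ℝ} {x : Plane} (hx : ‖x‖ ≤ R) :
    ‖pick B α x‖ ≤ ∑ i, (‖α i‖ + ‖α i‖ * R) := by
  classical
  have hR : 0 ≤ R := (norm_nonneg x).trans hx
  simp only [pick, LinearMap.coe_mk, AddHom.coe_mk]
  refine norm_sum_le_of_le _ fun i _ => ?_
  have h1 : ‖(α i).1‖ ≤ ‖α i‖ := norm_fst_le _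
  have h2 : ‖(α i).2‖ ≤ ‖α i‖ := norm_snd_le _
  split_ifs
  · rw [affineJet_apply, Prod.norm_mk]
    refine max_le (by nlinarith [norm_nonneg (α i)]) ?_
    calc _ ≤ ‖⟪(α i).1, x⟫‖ + ‖(α i).2‖ := norm_add_le _ _
      _ ≤ ‖(α i).1‖ * ‖x‖ + ‖(α i).2‖ := by gcongr; exact norm_inner_le_norm _ _
      _ ≤ ‖α i‖ * R + ‖α i‖ := by gcongr
      _ = _ := by ring
  · rw [norm_zero]; positivity

end Pick

/-! ### Deformations -/

/-- Orientation preserving `C¹` diffeomorphisms of the plane with uniform bounds. -/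
structure IsDeformation (T : Plane ≃ₜ Plane) : Prop where
  contDiff : ContDiff ℝ 1 T
  lipschitz : ∃ C : ℝ≥0, LipschitzWith C T
  nondegenerate : IsNondegenerate (fderiv ℝ T)

section Deformation

variable {T : Plane ≃ₜ Plane}

lemma IsDeformation.hasFDerivAt (hT : IsDeformation T) (x : Plane) :
    HasFDerivAt T (fderiv ℝ T x) x :=
  (hT.contDiff.differentiable (by norm_num) x).hasFDerivAt

lemma IsDeformation.det_pos (hT : IsDeformation T) (x : Plane) : 0 < det₂ (fderiv ℝ T x) := by
  obtain ⟨c, hc, h⟩ := hT.nondegenerate.det_pos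
  exact hc.trans_le (h x)

lemma hasGradientAt_affine (c : Plane × ℝ) (x : Plane) :
    HasGradientAt (fun y => (affineJet y c).2) c.1 x := by
  rw [hasGradientAt_iff_hasFDerivAt]
  have h : (fun y : Plane => (affineJet y c).2) =
      fun y => InnerProductSpace.toDual ℝ Plane c.1 y + c.2 := by
    funext y; simp
  rw [h]
  exact ((InnerProductSpace.toDual ℝ Plane c.1 : Plane →L[ℝ] ℝ).hasFDerivAt).add_const c.2

lemma gradient_eq_of_affine (hT : IsDeformation T) {v : Plane → ℝ} {U : Set Plane} (hU : IsOpen U)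
    {c : Plane × ℝ} (hv : ∀ y ∈ U, v (T y) = (affineJet y c).2) {y : Plane} (hy : y ∈ U) :
    ∇ v (T y) = (det₂ (fderiv ℝ T y))⁻¹ • cof (fderiv ℝ T y) c.1 := by
  have h1 : HasGradientAt (v ∘ T) c.1 y :=
    (hasGradientAt_affine c y).congr_of_eventuallyEq
      (by filter_upwards [hU.mem_nhds hy] with z hz using hv z hz)
  exact (hasGradientAt_of_comp (hT.hasFDerivAt y) (hT.det_pos y).ne' h1).gradient

lemma tendsto_comp_of_affine {v : Plane → ℝ} {U : Set Plane} {T : Plane → Plane}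
    {c : Plane × ℝ} (hv : ∀ y ∈ U, v (T y) = (affineJet y c).2) {x : Plane} {l : Filter Plane}
    (hl : l ≤ 𝓝 x) (hlU : l ≤ 𝓟 U) : Tendsto (v ∘ T) l (𝓝 (affineJet x c).2) := by
  have hc : Continuous fun y : Plane => (affineJet y c).2 := by
    simp only [affineJet_apply]; fun_prop
  refine ((hc.tendsto x).mono_left hl).congr' ?_
  filter_upwards [le_principal_iff.1 hlU] with y hy using (hv y hy).symm

lemma continuous_cof_apply {N : Plane → Plane →L[ℝ] Plane} (hN : Continuous N) (g : Plane) :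
    Continuous fun y => cof (N y) g :=
  rot.continuous.comp (hN.clm_apply continuous_const)

/-- On the curved cell `v` is not affine, but its pulled-back gradient is the restriction of a
function continuous on the whole plane, whose value at `x` is therefore the limit. -/
lemma tendsto_gradient_of_affine (hT : IsDeformation T) {v : Plane → ℝ} {U : Set Plane}
    (hU : IsOpen U) {c : Plane × ℝ} (hv : ∀ y ∈ U, v (T y) = (affineJet y c).2) {x : Plane}
    {l : Filter Plane} (hl : l ≤ 𝓝 x) (hlU : l ≤ 𝓟 U) :
    Tendsto (∇ v ∘ T) l (𝓝 ((det₂ (fderiv ℝ T x))⁻¹ • cof (fderiv ℝ T x) c.1)) := by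
  have hd : Continuous (fderiv ℝ T) := hT.nondegenerate.continuous
  have hc : Continuous fun y : Plane => (det₂ (fderiv ℝ T y))⁻¹ • cof (fderiv ℝ T y) c.1 :=
    ((continuous_det₂.comp hd).inv₀ fun y => (hT.det_pos y).ne').smul (continuous_cof_apply hd _)
  refine ((hc.tendsto x).mono_left hl).congr' ?_
  filter_upwards [le_principal_iff.1 hlU] with y hy
  exact (gradient_eq_of_affine hT hU hv hy).symm

end Deformation

namespace Discretization

variable {d : Discretization}

/-! ### Evaluation of discrete functions on the boundary and on the edges -/

variable (d) in
/-- The points that are approached along the normal from within the cell `K`. -/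
def boundaryCell (K : Finset Plane) : Set Plane :=
  -- Sampling the inner normal ray at countably many points makes this a Borel set.
  {x | ∀ᶠ k : ℕ in atTop, x + (1 / ((k : ℝ) + 1)) • (-outerNormal d.Ω x) ∈ cell K}

lemma measurableSet_boundaryCell (K : Finset Plane) : MeasurableSet (d.boundaryCell K) := by
  have h : d.boundaryCell K = ⋃ N : ℕ, ⋂ k : ℕ, ⋂ _ : N ≤ k,
      {x | x + (1 / ((k : ℝ) + 1)) • (-outerNormal d.Ω x) ∈ cell K} := by
    ext x; simp [boundaryCell, eventually_atTop]
  rw [h]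
  refine MeasurableSet.iUnion fun N => MeasurableSet.iInter fun k => MeasurableSet.iInter fun _ => ?_
  have hm : Measurable (id + (1 / ((k : ℝ) + 1)) • -outerNormal d.Ω) :=
    measurable_id.add ((measurable_outerNormal d.Ω).neg.const_smul (1 / ((k : ℝ) + 1)))
  exact hm (isOpen_cell K).measurableSet

lemma mem_boundaryCell {K : Finset Plane} {x n : Plane} (hn : IsOuterNormal d.Ω x n)
    (hK : approach d.Ω x ≤ 𝓟 (cell K)) : x ∈ d.boundaryCell K := by
  have h1 : Tendsto (fun k : ℕ => 1 / ((k : ℝ) + 1)) atTop (𝓝[>] 0) :=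
    tendsto_nhdsWithin_iff.2 ⟨tendsto_one_div_add_atTop_nhds_zero_nat,
      Eventually.of_forall fun k => by simp only [mem_Ioi]; positivity⟩
  have h2 := ((tendsto_approach hn).comp h1).eventually (le_principal_iff.1 hK)
  rw [boundaryCell, mem_ofPred_eq, hn.outerNormal_eq]
  exact h2

lemma boundaryCell_unique {K K' : Finset Plane} (hK : K ∈ d.triangles) (hK' : K' ∈ d.triangles)
    {x : Plane} (h : x ∈ d.boundaryCell K) (h' : x ∈ d.boundaryCell K') : K' = K := by
  by_contra hne
  obtain ⟨k, h1, h2⟩ := (Filter.Eventually.and h h').exists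
  exact Set.disjoint_left.1 (disjoint_cell hK' hK hne) h2 h1

variable (d) in
/-- Coefficient vectors of functions that are affine on the active cells. -/
abbrev Coeff : Type := d.active → Plane × ℝ

/-- A unit normal to the edge `F` that points out of the triangle `K`. -/
def edgeNormal (K F : Finset Plane) : Plane :=
  Classical.epsilon fun n => ‖n‖ = 1 ∧ (∀ a ∈ F, ∀ b ∈ F, ⟪b - a, n⟫ = 0) ∧
    ∀ x ∈ convexHull ℝ (F : Set Plane), x ∉ F → IsOuterNormal (cell K) x n

lemma edgeNormal_spec {K F : Finset Plane} (hK : IsTriangle K) (hFK : F ⊆ K) (hF : F.card = 2) :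
    ‖edgeNormal K F‖ = 1 ∧ (∀ a ∈ F, ∀ b ∈ F, ⟪b - a, edgeNormal K F⟫ = 0) ∧
    ∀ x ∈ convexHull ℝ (F : Set Plane), x ∉ F → IsOuterNormal (cell K) x (edgeNormal K F) :=
  Classical.epsilon_spec (hK.exists_edge_normal hFK hF).2

lemma faceNormal_spec {F : Finset Plane} (hF : F.card = 2) :
    ‖faceNormal F‖ = 1 ∧ ∀ a ∈ F, ∀ b ∈ F, ⟪b - a, faceNormal F⟫ = 0 := by
  refine Classical.epsilon_spec (p := fun n : Plane => ‖n‖ = 1 ∧ ∀ a ∈ F, ∀ b ∈ F, ⟪b - a, n⟫ = 0) ?_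
  classical
  obtain ⟨p, q, hpq, rfl⟩ := Finset.card_eq_two.1 hF
  have hv : ‖q - p‖ ≠ 0 := norm_ne_zero_iff.2 (sub_ne_zero.2 hpq.symm)
  refine ⟨‖q - p‖⁻¹ • rot (q - p), ?_, ?_⟩
  · rw [norm_smul, norm_inv, norm_norm, norm_rot, inv_mul_cancel₀ hv]
  · have hperp : ∀ u : Plane, ⟪u, rot u⟫ = 0 := fun u => by
      rw [inner_plane, rot_zero_coord, rot_one_coord]; ring
    have h1 := hperp (q - p)
    have h2 : ⟪p - q, rot (q - p)⟫ = 0 := by rw [← neg_sub, inner_neg_left, h1, neg_zero]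
    intro a ha b hb
    simp only [Finset.mem_insert, Finset.mem_singleton] at ha hb
    rw [inner_smul_right]
    rcases ha with rfl | rfl <;> rcases hb with rfl | rfl <;>
      first | rw [h1, mul_zero] | rw [h2, mul_zero] | rw [sub_self, inner_zero_left, mul_zero]

/-- The orientation of the edge `F` with respect to the triangle `K`. -/
def edgeSign (K F : Finset Plane) : ℝ := ⟪edgeNormal K F, faceNormal F⟫

/-- In the plane two vectors orthogonal to the same edge are parallel. -/
lemma edgeNormal_eq {K F : Finset Plane} (hK : IsTriangle K) (hFK : F ⊆ K) (hF : F.card = 2) :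
    edgeNormal K F = edgeSign K F • faceNormal F := by
  obtain ⟨hm, hmF⟩ := faceNormal_spec hF
  obtain ⟨-, hnF, -⟩ := edgeNormal_spec hK hFK hF
  classical
  obtain ⟨p, q, hpq, rfl⟩ := Finset.card_eq_two.1 hF
  set F : Finset Plane := {p, q}
  have h1 := hmF p (by simp [F]) q (by simp [F])
  have h2 := hnF p (by simp [F]) q (by simp [F])
  have h3 := eq_normal_add_tangential hm (q - p)
  rw [h1, zero_smul, zero_add] at h3
  have h4 : ⟪q - p, rot (faceNormal F)⟫ ≠ 0 := fun h0 => by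
    rw [h0, zero_smul] at h3
    exact hpq (sub_eq_zero.1 h3).symm
  rw [h3, inner_smul_left] at h2
  have h5 : ⟪rot (faceNormal F), edgeNormal K F⟫ = 0 := (mul_eq_zero.1 h2).resolve_left h4
  have h6 := eq_normal_add_tangential hm (edgeNormal K F)
  rwa [real_inner_comm (rot (faceNormal F)), h5, zero_smul, add_zero] at h6

lemma abs_edgeSign {K F : Finset Plane} (hK : IsTriangle K) (hFK : F ⊆ K) (hF : F.card = 2) :
    |edgeSign K F| = 1 := by
  have h1 := congrArg norm (edgeNormal_eq hK hFK hF)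
  rw [norm_smul, (faceNormal_spec hF).1, (edgeNormal_spec hK hFK hF).1, mul_one] at h1
  exact h1.symm

lemma finsum_adjacent_eq [Fintype d.active] {F : Finset Plane} (hF : d.adjacent F ⊆ d.active)
    (f : Finset Plane → ℝ) [∀ K : d.active, Decidable (F ⊆ (K : Finset Plane))] :
    ∑ᶠ K ∈ d.adjacent F, f K = ∑ K : d.active, if F ⊆ (K : Finset Plane) then f K else 0 := by
  classical
  rw [← finsum_eq_sum_of_fintype]
  have h1 : ∑ᶠ K : d.active, (if F ⊆ (K : Finset Plane) then f K else 0) =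
      ∑ᶠ K ∈ d.active, if F ⊆ K then f K else 0 :=
    (finsum_set_coe_eq_finsum_mem d.active (f := fun K => if F ⊆ K then f K else 0)).symm ▸ by
      refine finsum_congr fun K => ?_
      split_ifs <;> rfl
  rw [h1]
  refine finsum_congr fun K => ?_
  by_cases hK : K ∈ d.adjacent F
  · have hKa := hF hK
    have hFK : F ⊆ K := hK.2
    simp [hK, hKa, hFK]
  · by_cases hKa : K ∈ d.active
    · have hFK : ¬ F ⊆ K := fun h => hK ⟨hKa.1, h⟩
      simp [hK, hKa, hFK]
    · simp [hK, hKa]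

/-! ### Pulling integrals over boundary and edges back to `Ω`. -/

section Boundary

variable {T : Plane ≃ₜ Plane}

lemma norm_cof_outerNormal_ne_zero (hT : IsDeformation T) {x : Plane}
    (hn : ∃ n, IsOuterNormal d.Ω x n) : ‖cof (fderiv ℝ T x) (outerNormal d.Ω x)‖ ≠ 0 :=
  norm_ne_zero_iff.2 (cof_ne_zero (hT.det_pos x).ne' (isOuterNormal_outerNormal hn).ne_zero)

variable (d) in
lemma measurableSet_free :
    MeasurableSet (frontier d.Ω \ d.Γf) :=
  isClosed_frontier.measurableSet.diff isClosed_frontier.measurableSet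

/-- A homeomorphism carries frontier to frontier, and `Γ_f` is fixed pointwise. -/
lemma Γfree_image (hfix : ∀ x ∈ d.Γf, T x = x) : d.Γfree T = T '' (frontier d.Ω \ d.Γf) := by
  have h : T '' d.Γf = d.Γf := by
    ext y
    constructor
    · rintro ⟨x, hx, rfl⟩
      rwa [hfix x hx]
    · exact fun hy => ⟨y, hy, hfix y hy⟩
  rw [Γfree, image_sdiff T.injective, h, T.image_frontier]

/-- Integrals over the free boundary pulled back to the free boundary of `Ω`. -/
lemma integral_free_eq (hd : d.IsAdmissible) (hT : IsDeformation T)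
    (hfix : ∀ x ∈ d.Γf, T x = x) (g : Plane → ℝ) :
    ∫ x in d.Γfree T, g x ∂μH[1] = ∫ x in frontier d.Ω \ d.Γf,
      ‖cof (fderiv ℝ T x) (outerNormal d.Ω x)‖ * g (T x) ∂μH[1] := by
  obtain ⟨C, hC⟩ := hT.lipschitz
  rw [Γfree_image hfix]
  refine setIntegral_image_boundary sdiff_subset d.measurableSet_free ?_ ?_ hC hT.contDiff g
  · exact ((measure_mono sdiff_subset).trans_lt
      (hd.lipschitz.measure_frontier_lt_top hd.isBounded)).ne
  · exact ae_restrict_of_ae_restrict_of_subset sdiff_subset hd.lipschitz.ae_exists_isOuterNormal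

lemma IsAdmissible.ae_free (hd : d.IsAdmissible) :
    ∀ᵐ x ∂μH[1].restrict (frontier d.Ω \ d.Γf), (∃ n, IsOuterNormal d.Ω x n) ∧
      ∃ K ∈ d.active, approach d.Ω x ≤ 𝓟 (cell K) :=
  ae_restrict_of_ae_restrict_of_subset sdiff_subset hd.ae_approach_le_cell

lemma IsAdmissible.ae_fixed (hd : d.IsAdmissible) :
    ∀ᵐ x ∂μH[1].restrict d.Γf, (∃ n, IsOuterNormal d.Ω x n) ∧
      ∃ K ∈ d.active, approach d.Ω x ≤ 𝓟 (cell K) :=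
  ae_restrict_of_ae_restrict_of_subset hd.fixed_subset hd.ae_approach_le_cell

lemma measure_segment_lt_top {F : Finset Plane} (hF : F.card = 2) :
    μH[1] (convexHull ℝ (F : Set Plane)) < ⊤ := by
  classical
  obtain ⟨p, q, hpq, rfl⟩ := Finset.card_eq_two.1 hF
  have hcoe : ((({p, q} : Finset Plane)) : Set Plane) = {p, q} := by simp
  rw [hcoe, convexHull_pair, segment_eq_image_lineMap]
  refine (hausdorffMeasure_one_image_le ((lipschitzWith_lineMap p q).lipschitzOnWith)).trans_lt ?_
  rw [hausdorffMeasure_real]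
  exact ENNReal.mul_lt_top ENNReal.coe_lt_top isCompact_Icc.measure_lt_top

lemma ae_notMem_vertices (F : Finset Plane) :
    ∀ᵐ x ∂μH[1].restrict (convexHull ℝ (F : Set Plane)),
      x ∈ convexHull ℝ (F : Set Plane) ∧ x ∉ F := by
  have := Measure.nullSingletonClass_hausdorff Plane one_pos
  refine (ae_restrict_mem (isClosed_convexHull_finset F).measurableSet).and
    (ae_restrict_of_ae ?_)
  exact measure_eq_zero_iff_ae_notMem.1 (F.finite_toSet.measure_zero _)

end Boundary

/-! ### The bilinear form as a function of coefficient vectors. -/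

section Jets

variable (d) [Fintype d.active]

/-- The jets of discrete functions in `Ω`. -/
def bulkJet : d.Coeff →ₗ[ℝ] (Plane → Plane × ℝ) := pick fun K : d.active => cell K

/-- The jets of discrete functions on the boundary of `Ω`. -/
def boundaryJet : d.Coeff →ₗ[ℝ] (Plane → Plane × ℝ) := pick fun K : d.active => d.boundaryCell K

open Classical in
/-- The jumps of the gradients of discrete functions over the edge `F`. -/
def faceJet (F : Finset Plane) : d.Coeff →ₗ[ℝ] (Plane → Plane × ℝ) where
  toFun α _ := (∑ K : d.active,
    if F ⊆ (K : Finset Plane) then edgeSign K F • (α K).1 else 0, 0)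
  map_add' α β := by
    ext1 x
    simp only [Pi.add_apply, Prod.mk_add_mk, add_zero, ← Finset.sum_add_distrib]
    congr 1
    refine Finset.sum_congr rfl fun i _ => ?_
    split_ifs <;> simp
  map_smul' c α := by
    ext1 x
    simp only [Pi.smul_apply, RingHom.id_apply, Prod.smul_mk, smul_zero, Finset.smul_sum]
    congr 1
    refine Finset.sum_congr rfl fun i _ => ?_
    split_ifs <;> simp [smul_comm c]

/-- The evaluation data in `Ω`. -/
def bulkData : EvalData d.Coeff := ⟨volume.restrict d.Ω, fun _ => e₀, d.bulkJet⟩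

/-- The evaluation data on the free boundary. -/
def freeData : EvalData d.Coeff :=
  ⟨μH[1].restrict (frontier d.Ω \ d.Γf), outerNormal d.Ω, d.boundaryJet⟩

/-- The evaluation data on the edge `F`. -/
def faceData (F : Finset Plane) : EvalData d.Coeff :=
  ⟨μH[1].restrict (convexHull ℝ (F : Set Plane)), fun _ => faceNormal F, d.faceJet F⟩

/-- The bilinear form `a_h` in coefficients, for a deformation with derivative `N`. -/
def formA (N : Plane → Plane →L[ℝ] Plane) (α β : d.Coeff) : ℝ :=
  d.bulkData.form bulkIntegrand N α β - d.freeData.form fluxIntegrand N α β -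
    d.freeData.form fluxIntegrand N β α +
    d.β * d.h⁻¹ * d.freeData.form massIntegrand N α β +
    ∑ᶠ F ∈ d.interiorFaces, d.γ * d.h * (d.faceData F).form ghostIntegrand N α β

end Jets

/-! ### Discrete functions and their coefficients; the pulled-back form. -/

section Represents

variable [Fintype d.active]

/-- `v ∘ T` is on the active cells the affine function with coefficients `α`. -/
def Represents (T : Plane → Plane) (v : Plane → ℝ) (α : d.Coeff) : Prop :=
  ∀ K : d.active, ∀ y ∈ cell K, v (T y) = (affineJet y (α K)).2

lemma bulkJet_eq {K : d.active} {x : Plane} (hx : x ∈ cell K) (α : d.Coeff) :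
    d.bulkJet α x = affineJet x (α K) :=
  pick_eq (B := fun K : d.active => cell K) hx (fun K' hK' hx' => Set.disjoint_left.1
    (disjoint_cell K'.2.1 K.2.1 fun h => hK' (Subtype.ext h)) hx' hx) α

lemma boundaryJet_eq {K : d.active} {x n : Plane} (hn : IsOuterNormal d.Ω x n)
    (hK : approach d.Ω x ≤ 𝓟 (cell K)) (α : d.Coeff) :
    d.boundaryJet α x = affineJet x (α K) := by
  have hx := mem_boundaryCell hn hK
  exact pick_eq (B := fun K : d.active => d.boundaryCell K) hx (fun K' hK' hx' =>
    hK' (Subtype.ext (boundaryCell_unique K.2.1 K'.2.1 hx hx'))) α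

variable {T : Plane ≃ₜ Plane} {v w : Plane → ℝ} {α β : d.Coeff}

lemma Represents.trace_eq (hT : IsDeformation T) (hv : Represents T v α) {x : Plane}
    (hn : ∃ n, IsOuterNormal d.Ω x n) (hK : ∃ K ∈ d.active, approach d.Ω x ≤ 𝓟 (cell K)) :
    trace (T '' d.Ω) v (T x) = (d.boundaryJet α x).2 := by
  obtain ⟨n, hn⟩ := hn
  obtain ⟨K, hK, hle⟩ := hK
  rw [boundaryJet_eq (K := ⟨K, hK⟩) hn hle]
  exact trace_image_eq hn (hT.hasFDerivAt x) (hT.det_pos x)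
    (tendsto_comp_of_affine (hv ⟨K, hK⟩) (approach_le_nhds _ _) hle)

lemma Represents.trace_gradient_eq (hT : IsDeformation T) (hv : Represents T v α) {x : Plane}
    (hn : ∃ n, IsOuterNormal d.Ω x n) (hK : ∃ K ∈ d.active, approach d.Ω x ≤ 𝓟 (cell K)) :
    trace (T '' d.Ω) (∇ v) (T x) =
      (det₂ (fderiv ℝ T x))⁻¹ • cof (fderiv ℝ T x) (d.boundaryJet α x).1 := by
  obtain ⟨n, hn⟩ := hn
  obtain ⟨K, hK, hle⟩ := hK
  rw [boundaryJet_eq (K := ⟨K, hK⟩) hn hle]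
  exact trace_image_eq hn (hT.hasFDerivAt x) (hT.det_pos x)
    (tendsto_gradient_of_affine hT (isOpen_cell K) (hv ⟨K, hK⟩) (approach_le_nhds _ _) hle)

lemma Represents.normalDeriv_eq (hT : IsDeformation T) (hv : Represents T v α) {x : Plane}
    (hn : ∃ n, IsOuterNormal d.Ω x n) (hK : ∃ K ∈ d.active, approach d.Ω x ≤ 𝓟 (cell K)) :
    normalDeriv (T '' d.Ω) v (T x) =
      ⟪cof (fderiv ℝ T x) (d.boundaryJet α x).1, cof (fderiv ℝ T x) (outerNormal d.Ω x)⟫ *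
        (det₂ (fderiv ℝ T x))⁻¹ * ‖cof (fderiv ℝ T x) (outerNormal d.Ω x)‖⁻¹ := by
  have h := isOuterNormal_outerNormal hn
  rw [normalDeriv, hv.trace_gradient_eq hT hn hK,
    (h.image (hT.hasFDerivAt x) (hT.det_pos x)).outerNormal_eq, inner_smul_left, inner_smul_right]
  simp only [conj_trivial]
  ring

/-- The volume integral in `a_h` pulled back to `Ω`. -/
lemma integral_bulk_eq (hd : d.IsAdmissible) (hT : IsDeformation T) (hw : Represents T w α)
    (hv : Represents T v β) :
    ∫ x in T '' d.Ω, ⟪∇ w x, ∇ v x⟫ = d.bulkData.form bulkIntegrand (fderiv ℝ T) α β := by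
  rw [integral_image_eq_integral_abs_det_fderiv_smul volume hd.isOpen.measurableSet
    (fun x _ => (hT.hasFDerivAt x).hasFDerivWithinAt) T.injective.injOn]
  refine integral_congr_ae ?_
  filter_upwards [hd.ae_mem_cell] with x ⟨K, hK, hx⟩
  have h1 := gradient_eq_of_affine hT (isOpen_cell K) (hw ⟨K, hK⟩) hx
  have h2 := gradient_eq_of_affine hT (isOpen_cell K) (hv ⟨K, hK⟩) hx
  have hdet := hT.det_pos x
  simp only [bulkData, bulkIntegrand, bulkJet_eq (K := ⟨K, hK⟩) hx, affineJet_apply]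
  rw [h1, h2, det_eq_det₂, abs_of_pos hdet, inner_smul_left, inner_smul_right, smul_eq_mul]
  simp only [conj_trivial]
  field_simp

/-- The arc length factor cancels the normalization of the transformed normal. -/
lemma integral_flux_eq (hd : d.IsAdmissible) (hT : IsDeformation T)
    (hfix : ∀ x ∈ d.Γf, T x = x) (hw : Represents T w α) (hv : Represents T v β) :
    ∫ x in d.Γfree T, normalDeriv (T '' d.Ω) w x * trace (T '' d.Ω) v x ∂μH[1] =
      d.freeData.form fluxIntegrand (fderiv ℝ T) α β := by
  rw [integral_free_eq hd hT hfix]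
  refine integral_congr_ae ?_
  filter_upwards [hd.ae_free] with x ⟨hn, hK⟩
  have hne := norm_cof_outerNormal_ne_zero hT hn
  simp only [freeData, fluxIntegrand]
  rw [hw.normalDeriv_eq hT hn hK, hv.trace_eq hT hn hK]
  field_simp

lemma integral_mass_eq (hd : d.IsAdmissible) (hT : IsDeformation T)
    (hfix : ∀ x ∈ d.Γf, T x = x) (hw : Represents T w α) (hv : Represents T v β) :
    ∫ x in d.Γfree T, trace (T '' d.Ω) w x * trace (T '' d.Ω) v x ∂μH[1] =
      d.freeData.form massIntegrand (fderiv ℝ T) α β := by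
  rw [integral_free_eq hd hT hfix]
  refine integral_congr_ae ?_
  filter_upwards [hd.ae_free] with x ⟨hn, hK⟩
  simp only [freeData, massIntegrand]
  rw [hw.trace_eq hT hn hK, hv.trace_eq hT hn hK]
  ring

/-- The jump over an edge of a broken field with the one-sided limits `G`. -/
lemma normalJump_eq {F : Finset Plane} (hF : F ∈ d.interiorFaces) (hT : IsDeformation T)
    {x : Plane} (hx : x ∈ convexHull ℝ (F : Set Plane)) (hxF : x ∉ F) {H : Plane → Plane}
    {G : d.active → Plane} {L : Plane →L[ℝ] Plane}
    (hG : ∀ K : d.active, F ⊆ (K : Finset Plane) →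
      Tendsto (H ∘ T) (approach (cell K) x) (𝓝 (L (G K)))) :
    d.normalJump T F H (T x) = ⟪L (d.faceJet F (fun K => (G K, 0)) x).1,
      ‖cof (fderiv ℝ T x) (faceNormal F)‖⁻¹ • cof (fderiv ℝ T x) (faceNormal F)⟫ := by
  classical
  rw [normalJump, finsum_adjacent_eq hF.2.2.2]
  simp only [faceJet, LinearMap.coe_mk, AddHom.coe_mk, map_sum, sum_inner]
  refine Finset.sum_congr rfl fun K _ => ?_
  split_ifs with hFK
  · have hK := isTriangle_of_mem K.2.1
    have hn := (edgeNormal_spec hK hFK hF.2.1).2.2 x hx hxF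
    have hs := abs_edgeSign hK hFK hF.2.1
    -- The outer normal of `K` is the fixed edge normal up to sign. The sign moves onto the
    -- one-sided limit, where `faceJet` has it; it does not affect the length of the transformed
    -- normal.
    rw [trace_image_eq hn (hT.hasFDerivAt x) (hT.det_pos x) (hG K hFK),
      (hn.image (hT.hasFDerivAt x) (hT.det_pos x)).outerNormal_eq, edgeNormal_eq hK hFK hF.2.1,
      map_smul, norm_smul, Real.norm_eq_abs, hs, one_mul]
    simp only [map_smul, inner_smul_left, inner_smul_right, conj_trivial]
  · simp

lemma Represents.normalJump_gradient {F : Finset Plane} (hF : F ∈ d.interiorFaces)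
    (hT : IsDeformation T) (hv : Represents T v α) {x : Plane}
    (hx : x ∈ convexHull ℝ (F : Set Plane)) (hxF : x ∉ F) :
    d.normalJump T F (∇ v) (T x) =
      ⟪cof (fderiv ℝ T x) (d.faceJet F α x).1, cof (fderiv ℝ T x) (faceNormal F)⟫ *
        (det₂ (fderiv ℝ T x))⁻¹ * ‖cof (fderiv ℝ T x) (faceNormal F)‖⁻¹ := by
  rw [normalJump_eq hF hT hx hxF (G := fun K => (α K).1)
    (L := (det₂ (fderiv ℝ T x))⁻¹ • cof (fderiv ℝ T x))]
  · have h : (d.faceJet F (fun K => ((α K).1, 0)) x).1 = (d.faceJet F α x).1 := rfl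
    rw [h]
    simp only [smul_apply, inner_smul_left, inner_smul_right, conj_trivial]
    ring
  · intro K hFK
    have hn := (edgeNormal_spec (isTriangle_of_mem K.2.1) hFK hF.2.1).2.2 x hx hxF
    exact tendsto_gradient_of_affine hT (isOpen_cell K) (hv K) (approach_le_nhds _ _)
      hn.approach_le

lemma integral_ghost_eq (hT : IsDeformation T) (hw : Represents T w α) (hv : Represents T v β)
    {F : Finset Plane} (hF : F ∈ d.interiorFaces) :
    ∫ x in T '' convexHull ℝ (F : Set Plane),
      d.normalJump T F (∇ w) x * d.normalJump T F (∇ v) x ∂μH[1] =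
      (d.faceData F).form ghostIntegrand (fderiv ℝ T) α β := by
  classical
  -- Without neighbouring triangles both sides vanish. Otherwise any neighbour serves as the set
  -- whose frontier contains the edge in the change of variables.
  rcases (d.adjacent F).eq_empty_or_nonempty with hempty | ⟨K, hK⟩
  · have h1 : ∀ G x, d.normalJump T F G x = 0 := fun G x => by
      rw [normalJump, hempty]; simp
    have h2 : ∀ α : d.Coeff, d.faceJet F α = 0 := fun α => by
      have : ∀ K : d.active, ¬ F ⊆ (K : Finset Plane) := fun K hFK => by
        have : (K : Finset Plane) ∈ d.adjacent F := ⟨K.2.1, hFK⟩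
        rw [hempty] at this
        exact this
      ext1 x
      simp [faceJet, this]
    simp [h1, EvalData.form, faceData, h2, ghostIntegrand]
  · obtain ⟨C, hC⟩ := hT.lipschitz
    have hKT := isTriangle_of_mem hK.1
    have hn := (edgeNormal_spec hKT hK.2 hF.2.1).2.2
    rw [setIntegral_image_boundary (hKT.exists_edge_normal hK.2 hF.2.1).1
      (isClosed_convexHull_finset F).measurableSet (measure_segment_lt_top hF.2.1).ne
      ((ae_notMem_vertices F).mono fun x hx => ⟨_, hn x hx.1 hx.2⟩) hC hT.contDiff]
    refine integral_congr_ae ?_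
    filter_upwards [ae_notMem_vertices F] with x hx
    have hne : ‖cof (fderiv ℝ T x) (faceNormal F)‖ ≠ 0 := by
      refine norm_ne_zero_iff.2 (cof_ne_zero (hT.det_pos x).ne' fun h0 => ?_)
      have := (faceNormal_spec hF.2.1).1
      rw [h0] at this
      simp at this
    simp only [faceData, ghostIntegrand]
    rw [hw.normalJump_gradient hF hT hx.1 hx.2, hv.normalJump_gradient hF hT hx.1 hx.2,
      (hn x hx.1 hx.2).outerNormal_eq, edgeNormal_eq hKT hK.2 hF.2.1, map_smul, norm_smul,
      Real.norm_eq_abs, abs_edgeSign hKT hK.2 hF.2.1, one_mul]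
    field_simp

/-- The form `a_h` on the deformed domain in coefficients. -/
lemma a_eq_formA (hd : d.IsAdmissible) (hT : IsDeformation T) (hfix : ∀ x ∈ d.Γf, T x = x)
    (hw : Represents T w α) (hv : Represents T v β) :
    d.a T w v = d.formA (fderiv ℝ T) α β := by
  rw [a, formA, integral_bulk_eq hd hT hw hv, integral_flux_eq hd hT hfix hw hv,
    integral_flux_eq hd hT hfix hv hw, integral_mass_eq hd hT hfix hw hv, ghost]
  congr 1
  exact finsum_mem_congr rfl fun F hF => by rw [integral_ghost_eq hT hw hv hF]

end Represents

end Discretization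

namespace Discretization

variable {d : Discretization}

lemma IsAdmissible.exists_norm_le (hd : d.IsAdmissible) : ∃ R, ∀ x ∈ closure d.Ω, ‖x‖ ≤ R :=
  hd.isBounded.closure.exists_norm_le

lemma IsAdmissible.finite_interiorFaces (hd : d.IsAdmissible) : d.interiorFaces.Finite :=
  hd.finite_mesh.subset fun _ h => h.1

lemma IsAdmissible.isCompact_closure (hd : d.IsAdmissible) : IsCompact (closure d.Ω) :=
  hd.isBounded.isCompact_closure

variable [Fintype d.active]

/-! ### The bilinear form in coefficients -/

lemma IsAdmissible.isRegular_bulkData (hd : d.IsAdmissible) : d.bulkData.IsRegular where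
  finite := by
    have := hd.isBounded.measure_lt_top (μ := volume)
    exact ⟨by simpa [bulkData] using this⟩
  measurable_normal := measurable_const
  norm_normal := Eventually.of_forall fun x => by simp [bulkData]
  measurable_eval := fun α => measurable_pick (fun K => (isOpen_cell _).measurableSet) α
  bounded_eval α := by
    obtain ⟨R, hR⟩ := hd.exists_norm_le
    refine ⟨_, (ae_restrict_mem hd.isOpen.measurableSet).mono fun x hx =>
      norm_pick_le _ α (hR x (subset_closure hx))⟩

lemma measurable_boundaryJet (α : d.Coeff) : Measurable (d.boundaryJet α) :=
  measurable_pick (B := fun K : d.active => d.boundaryCell K)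
    (fun K => measurableSet_boundaryCell (K : Finset Plane)) α

lemma IsAdmissible.exists_boundaryJet_le (hd : d.IsAdmissible) (α : d.Coeff) :
    ∃ R, ∀ x ∈ frontier d.Ω, ‖d.boundaryJet α x‖ ≤ R := by
  obtain ⟨R, hR⟩ := hd.exists_norm_le
  exact ⟨_, fun x hx => norm_pick_le _ α (hR x (frontier_subset_closure hx))⟩

lemma IsAdmissible.isRegular_freeData (hd : d.IsAdmissible) : d.freeData.IsRegular where
  finite := by
    have : μH[1] (frontier d.Ω \ d.Γf) < ⊤ := (measure_mono sdiff_subset).trans_lt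
      (hd.lipschitz.measure_frontier_lt_top hd.isBounded)
    exact ⟨by simpa [freeData] using this⟩
  measurable_normal := measurable_outerNormal _
  norm_normal := hd.ae_free.mono fun x hx => (isOuterNormal_outerNormal hx.1).1
  measurable_eval := measurable_boundaryJet
  bounded_eval α := by
    obtain ⟨R, hR⟩ := hd.exists_boundaryJet_le α
    exact ⟨R, (ae_restrict_mem d.measurableSet_free).mono fun x hx => hR x hx.1⟩

lemma isRegular_faceData {F : Finset Plane} (hF : F.card = 2) : (d.faceData F).IsRegular where
  finite := ⟨by simpa [faceData] using measure_segment_lt_top hF⟩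
  measurable_normal := measurable_const
  norm_normal := Eventually.of_forall fun x => (faceNormal_spec hF).1
  measurable_eval := fun α => measurable_const
  bounded_eval α := ⟨‖d.faceJet F α 0‖, Eventually.of_forall fun x => le_rfl⟩

lemma formA_left (hd : d.IsAdmissible) {N : Plane → Plane →L[ℝ] Plane} (hN : IsNondegenerate N)
    (c : ℝ) (α₁ α₂ β : d.Coeff) :
    d.formA N (α₁ + c • α₂) β = d.formA N α₁ β + c * d.formA N α₂ β := by
  have hfree := hd.isRegular_freeData
  simp only [formA]
  rw [finsum_mem_eq_finite_toFinset_sum _ hd.finite_interiorFaces,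
    finsum_mem_eq_finite_toFinset_sum _ hd.finite_interiorFaces,
    finsum_mem_eq_finite_toFinset_sum _ hd.finite_interiorFaces,
    hd.isRegular_bulkData.form_left isFormIntegrand_bulk hN,
    hfree.form_left isFormIntegrand_flux hN, hfree.form_right isFormIntegrand_flux hN,
    hfree.form_left isFormIntegrand_mass hN]
  have h : ∀ F ∈ hd.finite_interiorFaces.toFinset,
      d.γ * d.h * (d.faceData F).form ghostIntegrand N (α₁ + c • α₂) β =
        d.γ * d.h * (d.faceData F).form ghostIntegrand N α₁ β +
        c * (d.γ * d.h * (d.faceData F).form ghostIntegrand N α₂ β) := fun F hF => by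
    rw [(isRegular_faceData ((Set.Finite.mem_toFinset _).1 hF).2.1).form_left
      isFormIntegrand_ghost hN]
    ring
  have hsum := Finset.sum_congr rfl h
  rw [Finset.sum_add_distrib, ← Finset.mul_sum _ _ c] at hsum
  rw [hsum]
  ring

lemma formA_symm (N : Plane → Plane →L[ℝ] Plane) (α β : d.Coeff) :
    d.formA N α β = d.formA N β α := by
  have h1 : d.bulkData.form bulkIntegrand N α β = d.bulkData.form bulkIntegrand N β α :=
    integral_congr_ae (Eventually.of_forall fun x => by
      simp only [bulkIntegrand]; rw [real_inner_comm])
  have h2 : d.freeData.form massIntegrand N α β = d.freeData.form massIntegrand N β α :=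
    integral_congr_ae (Eventually.of_forall fun x => by simp only [massIntegrand]; ring)
  have h3 : ∀ F, (d.faceData F).form ghostIntegrand N α β =
      (d.faceData F).form ghostIntegrand N β α := fun F =>
    integral_congr_ae (Eventually.of_forall fun x => by simp only [ghostIntegrand]; ring)
  simp only [formA, h1, h2, h3]
  ring

/-! ### The shape derivative of the bilinear form. -/

/-- The shape derivative of the integrand of `⟨D_n w, v⟩`. -/
def fluxDeriv (θ : Plane → Plane) (n : Plane) (x : Plane) (w w' : Plane × ℝ) : ℝ :=
  (div θ x * ⟪w.1, n⟫ - ⟪S θ x w.1, n⟫) * w'.2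

/-- The shape derivative of the integrand of the ghost penalty. -/
def ghostDeriv (θ : Plane → Plane) (n : Plane) (x : Plane) (w w' : Plane × ℝ) : ℝ :=
  (div θ x * ⟪w.1, n⟫ - ⟪S θ x w.1, n⟫) * ⟪w'.1, n⟫ +
    (div θ x * ⟪w'.1, n⟫ - ⟪S θ x w'.1, n⟫) * ⟪w.1, n⟫ -
    ⟪w.1, n⟫ * ⟪w'.1, n⟫ * tangentialDiv θ n x

variable (d) in
/-- The shape derivative of the bilinear form in coefficients. -/
def formADeriv (θ : Plane → Plane) (α β : d.Coeff) : ℝ :=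
  (∫ x in d.Ω, (div θ x * ⟪(d.bulkJet α x).1, (d.bulkJet β x).1⟫ -
      ⟪S θ x (d.bulkJet α x).1, (d.bulkJet β x).1⟫)) -
    (∫ x in frontier d.Ω \ d.Γf,
      fluxDeriv θ (outerNormal d.Ω x) x (d.boundaryJet α x) (d.boundaryJet β x) ∂μH[1]) -
    (∫ x in frontier d.Ω \ d.Γf,
      fluxDeriv θ (outerNormal d.Ω x) x (d.boundaryJet β x) (d.boundaryJet α x) ∂μH[1]) +
    d.β * d.h⁻¹ * (∫ x in frontier d.Ω \ d.Γf, tangentialDiv θ (outerNormal d.Ω x) x *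
      (d.boundaryJet α x).2 * (d.boundaryJet β x).2 ∂μH[1]) +
    ∑ᶠ F ∈ d.interiorFaces, d.γ * d.h * ∫ x in convexHull ℝ (F : Set Plane),
      ghostDeriv θ (faceNormal F) x (d.faceJet F α x) (d.faceJet F β x) ∂μH[1]

lemma hasDerivAt_formA (hd : d.IsAdmissible) {θ : Plane → Plane} (hθ : Continuous (fderiv ℝ θ))
    (hθb : ∃ R, ∀ x, ‖fderiv ℝ θ x‖ ≤ R) (α β : d.Coeff) :
    HasDerivAt (fun t : ℝ => d.formA (fun x => 1 + t • fderiv ℝ θ x) α β)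
      (d.formADeriv θ α β) 0 := by
  have hfree := hd.isRegular_freeData
  have h1 := (hd.isRegular_bulkData.hasDerivAt_form isFormIntegrand_bulk hθ hθb α β
    (Eventually.of_forall fun x => hasDerivAt_bulkIntegrand (fderiv ℝ θ x) e₀ (d.bulkJet α x).1
      (d.bulkJet β x).1 (d.bulkJet α x).2 (d.bulkJet β x).2)).2
  have h2 := fun α β : d.Coeff => (hfree.hasDerivAt_form isFormIntegrand_flux hθ hθb α β
    (Eventually.of_forall fun x => hasDerivAt_fluxIntegrand (fderiv ℝ θ x) (outerNormal d.Ω x)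
      (d.boundaryJet α x).1 (d.boundaryJet β x).1 (d.boundaryJet α x).2 (d.boundaryJet β x).2)).2
  have h3 := (hfree.hasDerivAt_form isFormIntegrand_mass hθ hθb α β
    (hfree.norm_normal.mono fun x hx => hasDerivAt_massIntegrand (fderiv ℝ θ x)
      (outerNormal d.Ω x) (d.boundaryJet α x).1 (d.boundaryJet β x).1 (d.boundaryJet α x).2
      (d.boundaryJet β x).2 hx)).2
  have h4 := fun F (hF : F ∈ hd.finite_interiorFaces.toFinset) =>
    ((isRegular_faceData ((Set.Finite.mem_toFinset _).1 hF).2.1).hasDerivAt_form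
      isFormIntegrand_ghost hθ hθb α β
      ((isRegular_faceData (d := d) ((Set.Finite.mem_toFinset _).1 hF).2.1).norm_normal.mono
        fun x hx => hasDerivAt_ghostIntegrand (fderiv ℝ θ x) (faceNormal F) (d.faceJet F α x).1
          (d.faceJet F β x).1 (d.faceJet F α x).2 (d.faceJet F β x).2 hx)).2.const_mul
      (d.γ * d.h)
  have h := (((h1.fun_sub (h2 α β)).fun_sub (h2 β α)).fun_add
    (h3.const_mul (d.β * d.h⁻¹))).fun_add (HasDerivAt.fun_sum h4)
  simp only [formA, finsum_mem_eq_finite_toFinset_sum _ hd.finite_interiorFaces]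
  refine h.congr_deriv ?_
  simp only [formADeriv, finsum_mem_eq_finite_toFinset_sum _ hd.finite_interiorFaces, fluxDeriv,
    ghostDeriv, inner_S, tangentialDiv, div_eq_tr₂, sub_sub]
  rfl

/-! ### The linear form in coefficients -/

/-- The difference of the two functions has vanishing `H^{1/2}` norm, so the bounded functional
annihilates it. Hence it suffices to know traces almost everywhere. -/
lemma MemHNegHalf.congr {Γ : Set Plane} {l : (Plane → ℝ) →ₗ[ℝ] ℝ} (hl : MemHNegHalf Γ l)
    {u v : Plane → ℝ} (h : u =ᵐ[μH[1].restrict Γ] v) : l u = l v := by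
  obtain ⟨C, hC⟩ := hl
  have h0 : ∀ᵐ x ∂μH[1].restrict Γ, (u - v) x = 0 := h.mono fun x hx => by simp [hx]
  have h1 : hHalfNormSq Γ (u - v) = 0 := by
    rw [hHalfNormSq]
    have e1 : ∫⁻ x in Γ, ‖(u - v) x‖ₑ ^ 2 ∂μH[1] = 0 := by
      rw [lintegral_congr_ae (g := fun _ => 0) (h0.mono fun x hx => by simp [hx])]
      simp
    have e2 : ∫⁻ x in Γ, ∫⁻ y in Γ, ‖(u - v) x - (u - v) y‖ₑ ^ 2 / ‖x - y‖ₑ ^ 2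
        ∂μH[1] ∂μH[1] = 0 := by
      rw [lintegral_congr_ae (g := fun _ => 0)]
      · simp
      · filter_upwards [h0] with x hx
        rw [lintegral_congr_ae (g := fun _ => 0)]
        · simp
        · filter_upwards [h0] with y hy
          rw [hx, hy]; simp
    rw [e1, e2, add_zero]
  have h2 := hC (u - v) ((aestronglyMeasurable_const (b := (0 : ℝ))).congr
    (h0.mono fun x hx => hx.symm))
  rw [h1, mul_zero, nonpos_iff_eq_zero, ENNReal.ofReal_eq_zero] at h2
  have h3 : l (u - v) = 0 := pow_eq_zero_iff (two_ne_zero) |>.1 (le_antisymm h2 (sq_nonneg _))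
  rw [map_sub] at h3
  exact sub_eq_zero.1 h3

variable (d) in
/-- The linear form `l_h` on the domain deformed by `T`, in coefficients. -/
def formL (g : Data) (T : Plane → Plane) (α : d.Coeff) : ℝ :=
  (∫ x in d.Ω, g.f (T x) * (d.bulkJet α x).2 * det₂ (fderiv ℝ T x)) +
    g.gN fun x => (d.boundaryJet α x).2

variable {T : Plane ≃ₜ Plane} {v w : Plane → ℝ} {α β : d.Coeff}

lemma Represents.ae_trace_fixed (hd : d.IsAdmissible) (hT : IsDeformation T)
    (hfix : ∀ x ∈ d.Γf, T x = x) (hv : Represents T v α) :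
    ∀ᵐ x ∂μH[1].restrict d.Γf, trace (T '' d.Ω) v x = (d.boundaryJet α x).2 := by
  filter_upwards [hd.ae_fixed, ae_restrict_mem isClosed_frontier.measurableSet] with x ⟨hn, hK⟩ hx
  have := hv.trace_eq hT hn hK
  rwa [hfix x hx] at this

/-- As `T` fixes `Γ_f`, the trace there, and with it the pairing with `g_N`, depends on the
coefficients only and not on `T`. -/
lemma l_eq_formL (hd : d.IsAdmissible) (hT : IsDeformation T) (hfix : ∀ x ∈ d.Γf, T x = x)
    {g : Data} (hgN : MemHNegHalf d.Γf g.gN) (hv : Represents T v α) :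
    d.l g T v = d.formL g T α := by
  rw [l, formL, MemHNegHalf.congr hgN (hv.ae_trace_fixed hd hT hfix),
    integral_image_eq_integral_abs_det_fderiv_smul volume hd.isOpen.measurableSet
      (fun x _ => (hT.hasFDerivAt x).hasFDerivWithinAt) T.injective.injOn]
  congr 1
  refine integral_congr_ae ?_
  filter_upwards [hd.ae_mem_cell] with x ⟨K, hK, hx⟩
  simp only [bulkJet_eq (K := ⟨K, hK⟩) hx]
  rw [det_eq_det₂, abs_of_pos (hT.det_pos x), smul_eq_mul, hv ⟨K, hK⟩ x hx]
  ring

lemma formL_add_smul (hd : d.IsAdmissible) (hT : IsDeformation T) {g : Data} {U : Set Plane}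
    (hU : ContinuousOn g.f U) (hTU : MapsTo T (closure d.Ω) U) (c : ℝ) (α₁ α₂ : d.Coeff) :
    d.formL g T (α₁ + c • α₂) = d.formL g T α₁ + c * d.formL g T α₂ := by
  have hreg := hd.isRegular_bulkData
  have : IsFiniteMeasure (volume.restrict d.Ω) := hreg.finite
  have hint : ∀ α : d.Coeff, Integrable
      (fun x => g.f (T x) * (d.bulkJet α x).2 * det₂ (fderiv ℝ T x)) (volume.restrict d.Ω) := by
    intro α
    obtain ⟨R, hR⟩ := hreg.bounded_eval α
    refine integrable_comp_of_continuousOn (μ := volume.restrict d.Ω)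
      (hd.isCompact_closure.prod (isCompact_closedBall (0 : ℝ) R))
      (φ := fun z : Plane × ℝ => g.f (T z.1) * z.2 * det₂ (fderiv ℝ T z.1))
      (q := fun x => (x, (d.bulkJet α x).2)) ?_
      (measurable_id.prodMk (hreg.measurable_eval α).snd).aemeasurable ?_
    · refine ContinuousOn.mul (ContinuousOn.mul ?_ continuousOn_snd) ?_
      · exact hU.comp (T.continuous.comp continuous_fst).continuousOn fun z hz => hTU hz.1
      · exact (continuous_det₂.comp (hT.nondegenerate.continuous.comp
          continuous_fst)).continuousOn
    · filter_upwards [hR, ae_restrict_mem hd.isOpen.measurableSet] with x hx hxΩ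
      refine ⟨subset_closure hxΩ, ?_⟩
      rw [mem_closedBall_zero_iff]
      exact (norm_snd_le (d.bulkJet α x)).trans hx
  have hgN : (fun x => (d.boundaryJet (α₁ + c • α₂) x).2) =
      (fun x => (d.boundaryJet α₁ x).2) + c • fun x => (d.boundaryJet α₂ x).2 := by
    funext x; simp
  rw [formL, formL, formL, hgN, map_add g.gN, map_smul g.gN, smul_eq_mul]
  have h : (∫ x in d.Ω, g.f (T x) * (d.bulkJet (α₁ + c • α₂) x).2 * det₂ (fderiv ℝ T x)) =
      (∫ x in d.Ω, g.f (T x) * (d.bulkJet α₁ x).2 * det₂ (fderiv ℝ T x)) +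
      c * ∫ x in d.Ω, g.f (T x) * (d.bulkJet α₂ x).2 * det₂ (fderiv ℝ T x) := by
    rw [← integral_const_mul, ← integral_add (hint _) ((hint _).const_mul c)]
    refine integral_congr_ae (Eventually.of_forall fun x => ?_)
    simp
    ring
  rw [h]
  ring

variable (d) in
/-- The shape derivative of the linear form in coefficients. -/
def formLDeriv (g : Data) (θ : Plane → Plane) (α : d.Coeff) : ℝ :=
  ∫ x in d.Ω, (⟪∇ g.f x, θ x⟫ * (d.bulkJet α x).2 + div θ x * (g.f x * (d.bulkJet α x).2))

/-- The pairing with `g_N` is constant in `t`; the volume part is the product rule for `f (x + t θ)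
det (1 + t Dθ)`. -/
lemma hasDerivAt_formL (hd : d.IsAdmissible) {θ : Plane → Plane} (hθ : ContDiff ℝ 1 θ)
    (hθb : ∃ R, ∀ x, ‖fderiv ℝ θ x‖ ≤ R) (hθb' : ∃ R, ∀ x, ‖θ x‖ ≤ R) {g : Data}
    {U : Set Plane} (hU : IsOpen U) (hΩU : closure d.Ω ⊆ U) (hf : ContDiffOn ℝ 1 g.f U)
    (α : d.Coeff) :
    HasDerivAt (fun t : ℝ => d.formL g (perturb θ t) α) (d.formLDeriv g θ α) 0 := by
  have hreg := hd.isRegular_bulkData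
  have : IsFiniteMeasure (volume.restrict d.Ω) := hreg.finite
  obtain ⟨R, hR⟩ := hreg.bounded_eval α
  obtain ⟨R₁, h₁⟩ := hθb
  obtain ⟨R₂, h₂⟩ := hθb'
  have hfd : Continuous (fderiv ℝ θ) := hθ.continuous_fderiv (by norm_num)
  set Q : Set (Plane × Plane × (Plane →L[ℝ] Plane) × ℝ) := closure d.Ω ×ˢ
    (Metric.closedBall 0 R₂ ×ˢ (Metric.closedBall 0 R₁ ×ˢ Metric.closedBall 0 R))
  have : ProperSpace (Plane →L[ℝ] Plane) := FiniteDimensional.proper_real _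
  have hQ : IsCompact Q := hd.isCompact_closure.prod ((isCompact_closedBall _ _).prod
    ((isCompact_closedBall _ _).prod (isCompact_closedBall _ _)))
  have hfderiv : ∀ (t : ℝ) x, fderiv ℝ (perturb θ t) x = 1 + t • fderiv ℝ θ x := fun t x => by
    have h1 : HasFDerivAt θ (fderiv ℝ θ x) x := (hθ.differentiable (by norm_num) x).hasFDerivAt
    exact ((hasFDerivAt_id x).add (h1.const_smul t)).fderiv
  have hat : ∀ x ∈ closure d.Ω, ContDiffAt ℝ 1 g.f x := fun x hx =>
    hf.contDiffAt (hU.mem_nhds (hΩU hx))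
  have hmain := (hasDerivAt_integral_of_compact (μ := volume.restrict d.Ω) hQ
    (Φ := fun p : ℝ × (Plane × Plane × (Plane →L[ℝ] Plane) × ℝ) =>
      g.f (p.2.1 + p.1 • p.2.2.1) * p.2.2.2.2 * det₂ (1 + p.1 • p.2.2.2.1))
    (q := fun x => (x, θ x, fderiv ℝ θ x, (d.bulkJet α x).2))
    (Φ' := fun x => ⟪∇ g.f x, θ x⟫ * (d.bulkJet α x).2 +
      div θ x * (g.f x * (d.bulkJet α x).2)) ?_ ?_ ?_ ?_).2
  · refine (hmain.add_const (g.gN fun x => (d.boundaryJet α x).2)).congr_of_eventuallyEq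
      (Eventually.of_forall fun t => ?_)
    simp only [formL, hfderiv]
    rfl
  · rintro ⟨x, y, M, b⟩ ⟨hx, -⟩
    have hx' : ContDiffAt ℝ 1 g.f (x + (0 : ℝ) • y) := by
      simpa using hat x hx
    have h1 : ContDiffAt ℝ 1 (fun p : ℝ × (Plane × Plane × (Plane →L[ℝ] Plane) × ℝ) =>
        p.2.1 + p.1 • p.2.2.1) (0, (x, y, M, b)) := by fun_prop
    have h2 : ContDiffAt ℝ 1 (fun p : ℝ × (Plane × Plane × (Plane →L[ℝ] Plane) × ℝ) =>
        g.f (p.2.1 + p.1 • p.2.2.1)) (0, (x, y, M, b)) :=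
      ContDiffAt.comp (0, (x, y, M, b)) (g := g.f) (f := fun p : ℝ × (Plane × Plane ×
        (Plane →L[ℝ] Plane) × ℝ) => p.2.1 + p.1 • p.2.2.1) hx' h1
    have h3 : ContDiffAt ℝ 1 (fun p : ℝ × (Plane × Plane × (Plane →L[ℝ] Plane) × ℝ) =>
        det₂ (1 + p.1 • p.2.2.2.1)) (0, (x, y, M, b)) :=
      contDiff_det₂.contDiffAt.comp (f := fun p : ℝ × (Plane × Plane ×
        (Plane →L[ℝ] Plane) × ℝ) => (1 : Plane →L[ℝ] Plane) + p.1 • p.2.2.2.1) _ (by fun_prop)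
    have h4 : ContDiffAt ℝ 1 (fun p : ℝ × (Plane × Plane × (Plane →L[ℝ] Plane) × ℝ) =>
        p.2.2.2.2) (0, (x, y, M, b)) := by fun_prop
    exact (h2.mul h4).mul h3
  · exact (measurable_id.prodMk (hθ.continuous.measurable.prodMk
      (hfd.measurable.prodMk (hreg.measurable_eval α).snd))).aemeasurable
  · filter_upwards [hR, ae_restrict_mem hd.isOpen.measurableSet] with x hx hxΩ
    refine ⟨subset_closure hxΩ, ?_, ?_, ?_⟩
    · exact mem_closedBall_zero_iff.2 (h₂ x)
    · exact mem_closedBall_zero_iff.2 (h₁ x)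
    · exact mem_closedBall_zero_iff.2 ((norm_snd_le (d.bulkJet α x)).trans hx)
  · filter_upwards [ae_restrict_mem hd.isOpen.measurableSet] with x hxΩ
    have hdiff : HasGradientAt g.f (∇ g.f x) (x + (0 : ℝ) • θ x) := by
      rw [zero_smul, add_zero]
      exact ((hat x (subset_closure hxΩ)).differentiableAt (by norm_num)).hasGradientAt
    have hline : HasDerivAt (fun t : ℝ => x + t • θ x) (θ x) 0 := by
      simpa using ((hasDerivAt_id (0 : ℝ)).smul_const (θ x)).const_add x
    have h1 : HasDerivAt (fun t : ℝ => g.f (x + t • θ x)) ⟪∇ g.f x, θ x⟫ 0 := by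
      have h0 := hdiff.hasFDerivAt.comp_hasDerivAt (0 : ℝ) hline
      exact h0.congr_deriv (by simp)
    have h := (h1.mul_const (d.bulkJet α x).2).fun_mul (hasDerivAt_det₂ (fderiv ℝ θ x))
    rw [det₂_one_add_zero, zero_smul, add_zero] at h
    refine h.congr_deriv ?_
    rw [div_eq_tr₂]
    ring

end Discretization

/-! ### Parametric linear systems -/

section LinearSystem

variable {m : ℕ}

open Matrix in
lemma differentiableAt_det {A : ℝ → Matrix (Fin m) (Fin m) ℝ} {t : ℝ}
    (hA : ∀ i j, DifferentiableAt ℝ (fun t => A t i j) t) :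
    DifferentiableAt ℝ (fun t => (A t).det) t := by
  simp only [det_apply]
  refine DifferentiableAt.fun_sum fun σ _ => DifferentiableAt.fun_const_smul ?_ _
  exact DifferentiableAt.fun_finsetProd fun i _ => hA _ _

open Matrix in
lemma differentiableAt_inv {A : ℝ → Matrix (Fin m) (Fin m) ℝ} {t : ℝ}
    (hA : ∀ i j, DifferentiableAt ℝ (fun t => A t i j) t) (h : (A t).det ≠ 0) (i j : Fin m) :
    DifferentiableAt ℝ (fun t => (A t)⁻¹ i j) t := by
  simp only [inv_def, Ring.inverse_eq_inv', Matrix.smul_apply, smul_eq_mul, adjugate_apply]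
  refine ((differentiableAt_det hA).fun_inv h).fun_mul (differentiableAt_det fun k l => ?_)
  by_cases hk : k = j
  · subst hk; simp
  · simpa [updateRow_ne hk] using hA k l

open Matrix in
/-- The derivative of a quadratic functional along the solutions of a parametric linear system,
by means of the solution of the adjoint system. -/
lemma hasDerivAt_quadratic_of_linear_system {A : ℝ → Matrix (Fin m) (Fin m) ℝ}
    {A' : Matrix (Fin m) (Fin m) ℝ} {L : ℝ → Fin m → ℝ} {L' : Fin m → ℝ}
    (hA : ∀ i j, HasDerivAt (fun t => A t i j) (A' i j) 0)
    (hL : ∀ i, HasDerivAt (fun t => L t i) (L' i) 0) (hdet : (A 0).det ≠ 0)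
    (hsymm : (A 0)ᵀ = A 0) {Q : Matrix (Fin m) (Fin m) ℝ} (hQ : Qᵀ = Q) (c₀ : ℝ) (c : Fin m → ℝ)
    {U : ℝ → Fin m → ℝ} (hU : ∀ᶠ t in 𝓝 0, A t *ᵥ U t = L t) {P : Fin m → ℝ}
    (hP : A 0 *ᵥ P = Q *ᵥ U 0 - c) :
    HasDerivAt (fun t => c₀ - c ⬝ᵥ U t + 1 / 2 * (U t ⬝ᵥ Q *ᵥ U t))
      (P ⬝ᵥ L' - P ⬝ᵥ A' *ᵥ U 0) 0 := by
  have hAd : ∀ i j, DifferentiableAt ℝ (fun t => A t i j) 0 := fun i j =>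
    (hA i j).differentiableAt
  have hdet' : ∀ᶠ t in 𝓝 0, (A t).det ≠ 0 :=
    (differentiableAt_det hAd).continuousAt.eventually_ne hdet
  -- No regularity of `U` is assumed; it is inherited from Cramer's rule, since the determinant
  -- stays nonzero near `0`.
  have hsol : ∀ᶠ t in 𝓝 0, U t = (A t)⁻¹ *ᵥ L t := by
    filter_upwards [hU, hdet'] with t h1 h2
    rw [← h1, mulVec_mulVec, nonsing_inv_mul _ (Ne.isUnit h2), one_mulVec]
  have hUd : ∀ i, DifferentiableAt ℝ (fun t => U t i) 0 := by
    intro i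
    have h1 : DifferentiableAt ℝ (fun t => ∑ j, (A t)⁻¹ i j * L t j) 0 :=
      DifferentiableAt.fun_sum fun j _ =>
        (differentiableAt_inv hAd hdet i j).fun_mul (hL j).differentiableAt
    refine h1.congr_of_eventuallyEq (hsol.mono fun t ht => ?_)
    show U t i = _
    rw [ht]; rfl
  set U' : Fin m → ℝ := fun i => deriv (fun t => U t i) 0
  have hU' : ∀ i, HasDerivAt (fun t => U t i) (U' i) 0 := fun i => (hUd i).hasDerivAt
  have hAU : A' *ᵥ U 0 + A 0 *ᵥ U' = L' := by
    funext i
    have h1 : HasDerivAt (fun t => ∑ j, A t i j * U t j)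
        (∑ j, (A' i j * U 0 j + A 0 i j * U' j)) 0 :=
      HasDerivAt.fun_sum fun j _ => (hA i j).fun_mul (hU' j)
    have h2 : (fun t => L t i) =ᶠ[𝓝 0] fun t => ∑ j, A t i j * U t j :=
      hU.mono fun t ht => (congrFun ht i).symm
    have h3 := (h1.congr_of_eventuallyEq h2).unique (hL i)
    rw [← h3, Finset.sum_add_distrib]; rfl
  have hc : HasDerivAt (fun t => c ⬝ᵥ U t) (c ⬝ᵥ U') 0 :=
    HasDerivAt.fun_sum fun j _ => (hU' j).const_mul (c j)
  have hq : HasDerivAt (fun t => U t ⬝ᵥ Q *ᵥ U t) (U' ⬝ᵥ Q *ᵥ U 0 + U 0 ⬝ᵥ Q *ᵥ U') 0 := by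
    have h1 : HasDerivAt (fun t => ∑ i, U t i * ∑ j, Q i j * U t j)
        (∑ i, (U' i * (∑ j, Q i j * U 0 j) + U 0 i * ∑ j, Q i j * U' j)) 0 :=
      HasDerivAt.fun_sum fun i _ => (hU' i).fun_mul
        (HasDerivAt.fun_sum fun j _ => (hU' j).const_mul (Q i j))
    rw [Finset.sum_add_distrib] at h1
    exact h1
  have hsw : ∀ (B : Matrix (Fin m) (Fin m) ℝ), Bᵀ = B → ∀ x y, x ⬝ᵥ B *ᵥ y = y ⬝ᵥ B *ᵥ x := by
    intro B hB x y
    rw [dotProduct_mulVec, ← mulVec_transpose, hB, dotProduct_comm]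
  refine ((hc.const_sub c₀).fun_add (hq.const_mul (1 / 2))).congr_deriv ?_
  -- By the symmetry of `A 0` the right side is `U' · A 0 P`, and the adjoint equation turns this
  -- into `U' · (Q U(0) - c)`, the derivative of the functional.
  have h5 : P ⬝ᵥ L' - P ⬝ᵥ A' *ᵥ U 0 = P ⬝ᵥ A 0 *ᵥ U' := by
    rw [← hAU, dotProduct_add]; ring
  rw [h5, hsw _ hsymm P U', hP, dotProduct_sub, hsw Q hQ (U 0) U', dotProduct_comm c U']
  ring

lemma map_sum_of_add_smul {C : Type*} [AddCommGroup C] [Module ℝ C] {f : C → ℝ}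
    (hf : ∀ (c : ℝ) a b, f (a + c • b) = f a + c * f b) {ι : Type*} (s : Finset ι) (x : ι → ℝ)
    (v : ι → C) : f (∑ i ∈ s, x i • v i) = ∑ i ∈ s, x i * f (v i) := by
  classical
  induction s using Finset.induction_on with
  | empty =>
    -- The affine-looking identity at `a = b = 0`, `c = 1` forces `f 0 = 0`.
    have := hf 1 0 0
    simp only [smul_zero, add_zero, one_mul] at this
    simp only [Finset.sum_empty]
    linarith
  | insert i s hi ih =>
    rw [Finset.sum_insert hi, Finset.sum_insert hi, add_comm, hf, ih, add_comm]

end LinearSystem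

/-! ### Perturbations of the identity -/

lemma hasFDerivAt_perturb {θ : Plane → Plane} (hθ : ContDiff ℝ 1 θ) (t : ℝ) (x : Plane) :
    HasFDerivAt (perturb θ t) (1 + t • fderiv ℝ θ x) x := by
  have h1 : HasFDerivAt θ (fderiv ℝ θ x) x := (hθ.differentiable (by norm_num) x).hasFDerivAt
  exact (hasFDerivAt_id x).add (h1.const_smul t)

lemma abs_map_coord_le (M : Plane →L[ℝ] Plane) {C : ℝ} (hM : ‖M‖ ≤ C) (i j : Fin 2) :
    |M (EuclideanSpace.single j 1) i| ≤ C := by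
  refine (abs_coord_le_norm _ i).trans ((M.le_opNorm _).trans ?_)
  simpa using hM

/-- `det (1 + t M) = 1 + t tr M + t² det M` with `|tr M| ≤ 2 C` and `|det M| ≤ 2 C²`. From `|t| C ≤
1/8` the two corrections are at most `1/4` and `1/32`. -/
lemma half_le_det₂ {M : Plane →L[ℝ] Plane} {C t : ℝ} (hM : ‖M‖ ≤ C)
    (ht : |t| * (C + 1) ≤ 1 / 8) : 1 / 2 ≤ det₂ (1 + t • M) := by
  have hC : 0 ≤ C := (norm_nonneg M).trans hM
  have hb := fun i j => abs_map_coord_le M hM i j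
  rw [det₂_one_add_smul]
  have h1 : |tr₂ M| ≤ 2 * C := by
    refine (abs_add_le _ _).trans ?_
    linarith [hb 0 0, hb 1 1]
  have h2 : |det₂ M| ≤ 2 * C ^ 2 := by
    refine (abs_sub _ _).trans ?_
    rw [abs_mul, abs_mul]
    nlinarith [hb 0 0, hb 1 1, hb 0 1, hb 1 0, abs_nonneg (M e₀ 0), abs_nonneg (M e₀ 1),
      abs_nonneg (M e₁ 0), abs_nonneg (M e₁ 1), mul_le_mul (hb 0 0) (hb 1 1) (abs_nonneg _) hC,
      mul_le_mul (hb 0 1) (hb 1 0) (abs_nonneg _) hC]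
  have ht0 := abs_nonneg t
  have htC : |t| * C ≤ 1 / 8 := by nlinarith
  have h3 : |t * tr₂ M| ≤ 1 / 4 := by
    rw [abs_mul]
    calc |t| * |tr₂ M| ≤ |t| * (2 * C) := by gcongr
      _ ≤ 1 / 4 := by linarith
  have h4 : |t ^ 2 * det₂ M| ≤ 1 / 32 := by
    rw [abs_mul, abs_pow]
    calc |t| ^ 2 * |det₂ M| ≤ |t| ^ 2 * (2 * C ^ 2) := by gcongr
      _ = 2 * (|t| * C) ^ 2 := by ring
      _ ≤ 2 * (1 / 8) ^ 2 := by gcongr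
      _ = 1 / 32 := by norm_num
  linarith [(abs_le.1 h3).1, (abs_le.1 h4).1]

/-- Small perturbations of the identity are deformations. -/
lemma eventually_exists_deformation {θ : Plane → Plane} (hθ : ContDiff ℝ 1 θ) {C : ℝ≥0}
    (hC : LipschitzWith C θ) :
    ∀ᶠ t in 𝓝 (0 : ℝ), ∃ T : Plane ≃ₜ Plane, ⇑T = perturb θ t ∧ IsDeformation T := by
  have hb : ∀ x, ‖fderiv ℝ θ x‖ ≤ C := fun x => norm_fderiv_le_of_lipschitz ℝ hC
  have hev : ∀ᶠ t in 𝓝 (0 : ℝ), |t| * ((C : ℝ) + 1) < 1 / 8 := by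
    have : Continuous fun t : ℝ => |t| * ((C : ℝ) + 1) := by fun_prop
    exact (this.tendsto 0).eventually (gt_mem_nhds (by simp))
  filter_upwards [hev] with t ht
  have ht0 := abs_nonneg t
  have htC : |t| * C < 1 := by nlinarith [C.2]
  have hlip : LipschitzWith (‖t‖₊ * C) fun x => t • θ x := by
    refine LipschitzWith.of_dist_le_mul fun x y => ?_
    rw [dist_smul₀, NNReal.coe_mul, mul_assoc]
    exact mul_le_mul_of_nonneg_left (hC.dist_le_mul x y) (norm_nonneg t)
  -- The identity plus a map of Lipschitz constant below `1` is a homeomorphism of the plane, by the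
  -- global form of the inverse function theorem.
  have happ : ApproximatesLinearOn (perturb θ t)
      ((ContinuousLinearEquiv.refl ℝ Plane : Plane ≃L[ℝ] Plane) : Plane →L[ℝ] Plane) univ
      (‖t‖₊ * C) := by
    intro x _ y _
    have := hlip.dist_le_mul x y
    rw [dist_eq_norm, dist_eq_norm] at this
    have h : perturb θ t x - perturb θ t y -
        ((ContinuousLinearEquiv.refl ℝ Plane : Plane ≃L[ℝ] Plane) : Plane →L[ℝ] Plane) (x - y) =
        t • θ x - t • θ y := by
      show x + t • θ x - (y + t • θ y) - (x - y) = _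
      abel
    rw [h]
    exact this
  have hsmall : Subsingleton Plane ∨ ‖t‖₊ * C <
      ‖((ContinuousLinearEquiv.refl ℝ Plane).symm : Plane →L[ℝ] Plane)‖₊⁻¹ := by
    right
    have h1 : ‖((ContinuousLinearEquiv.refl ℝ Plane).symm : Plane →L[ℝ] Plane)‖₊ = 1 := by
      have : ((ContinuousLinearEquiv.refl ℝ Plane).symm : Plane →L[ℝ] Plane) =
        ContinuousLinearMap.id ℝ Plane := rfl
      rw [this, ← NNReal.coe_inj, coe_nnnorm, ContinuousLinearMap.norm_id, NNReal.coe_one]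
    rw [h1, inv_one, ← NNReal.coe_lt_coe]
    simpa using htC
  have hfd : fderiv ℝ (perturb θ t) = fun x => 1 + t • fderiv ℝ θ x :=
    funext fun x => (hasFDerivAt_perturb hθ t x).fderiv
  refine ⟨happ.toHomeomorph _ hsmall, rfl, ?_⟩
  have hcoe : ⇑(happ.toHomeomorph (perturb θ t) hsmall) = perturb θ t := rfl
  refine ⟨?_, ⟨1 + ‖t‖₊ * C, ?_⟩, ?_⟩
  · rw [hcoe]
    exact contDiff_id.add (hθ.const_smul t)
  · rw [hcoe]
    exact LipschitzWith.id.add hlip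
  · rw [hcoe, hfd]
    refine ⟨?_, ⟨‖(1 : Plane →L[ℝ] Plane)‖ + |t| * C, fun x => ?_⟩, 1 / 2, by norm_num,
      fun x => half_le_det₂ (hb x) ht.le⟩
    · exact continuous_const.add ((hθ.continuous_fderiv (by norm_num)).const_smul t)
    · refine (norm_add_le _ _).trans ?_
      rw [norm_smul, Real.norm_eq_abs]
      gcongr
      exact hb x

/-! ### The discrete space in coefficients -/

lemma MemH1.congr {D : Set Plane} {v w : Plane → ℝ} (hv : MemH1 D v)
    (h : v =ᵐ[volume.restrict D] w) : MemH1 D w := by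
  obtain ⟨h1, g, hg, h2⟩ := hv
  refine ⟨h1.ae_eq h, g, hg, fun φ hφ hc hs => ?_⟩
  rw [← h2 φ hφ hc hs]
  exact integral_congr_ae (h.mono fun x hx => by simp only [hx])

lemma memLp_gradient {φ : Plane → ℝ} (hφ : ContDiff ℝ ∞ φ) (hc : HasCompactSupport φ)
    (D : Set Plane) : MemLp (∇ φ) 2 (volume.restrict D) := by
  have h1 : Continuous (∇ φ) :=
    (InnerProductSpace.toDual ℝ Plane).symm.continuous.comp (hφ.continuous_fderiv (by simp))
  have h2 : HasCompactSupport (∇ φ) := (hc.fderiv ℝ).comp_left (map_zero _)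
  exact (h1.memLp_of_hasCompactSupport h2).restrict D

lemma memLp_test {φ : Plane → ℝ} (hφ : ContDiff ℝ ∞ φ) (hc : HasCompactSupport φ)
    (D : Set Plane) : MemLp φ 2 (volume.restrict D) :=
  (hφ.continuous.memLp_of_hasCompactSupport hc).restrict D

lemma integrable_smul_of_memLp {μ : Measure Plane} {v : Plane → ℝ} {g : Plane → Plane}
    (hv : MemLp v 2 μ) (hg : MemLp g 2 μ) : Integrable (fun x => v x • g x) μ :=
  memLp_one_iff_integrable.1 (hg.smul hv)

lemma MemH1.add_smul {D : Set Plane} {v w : Plane → ℝ} (hv : MemH1 D v) (hw : MemH1 D w)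
    (c : ℝ) : MemH1 D fun x => v x + c * w x := by
  obtain ⟨h1, g, hg, h2⟩ := hv
  obtain ⟨h1', g', hg', h2'⟩ := hw
  refine ⟨h1.add (h1'.const_mul c), g + c • g', hg.add (hg'.const_smul c),
    fun φ hφ hc hs => ?_⟩
  have e1 := integrable_smul_of_memLp h1 (memLp_gradient hφ hc D)
  have e2 := integrable_smul_of_memLp h1' (memLp_gradient hφ hc D)
  have e3 := integrable_smul_of_memLp (memLp_test hφ hc D) hg
  have e4 := integrable_smul_of_memLp (memLp_test hφ hc D) hg'
  have h3 : ∀ x, (v x + c * w x) • ∇ φ x = v x • ∇ φ x + c • (w x • ∇ φ x) := fun x => by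
    module
  have h4 : ∀ x, φ x • (g + c • g') x = φ x • g x + c • (φ x • g' x) := fun x => by
    simp only [Pi.add_apply, Pi.smul_apply]; module
  simp only [h3, h4]
  have e2' : Integrable (fun x => c • (w x • ∇ φ x)) (volume.restrict D) := e2.smul c
  have e4' : Integrable (fun x => c • (φ x • g' x)) (volume.restrict D) := e4.smul c
  rw [integral_add e1 e2', integral_add e3 e4', integral_smul, integral_smul,
    h2 φ hφ hc hs, h2' φ hφ hc hs]
  module

lemma memH1_zero (D : Set Plane) : MemH1 D fun _ => 0 :=
  ⟨MemLp.zero, 0, MemLp.zero, fun φ _ _ _ => by simp⟩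

namespace Discretization

variable {d : Discretization}

/-- An active cell meets `Ω` in a nonempty open set, and an affine function that vanishes there is
zero. So the values on `Ω` determine the coefficients. -/
lemma Represents.eq_zero {v : Plane → ℝ} {α : d.Coeff} (hd : d.IsAdmissible)
    (hv : Represents id v α) (h0 : v =ᵐ[volume.restrict d.Ω] 0) : α = 0 := by
  funext K
  have hU : IsOpen (cell K ∩ d.Ω) := (isOpen_cell _).inter hd.isOpen
  obtain ⟨y, hy⟩ := K.2.2
  have hae : (fun y => (affineJet y (α K)).2) =ᵐ[volume.restrict (cell K ∩ d.Ω)] 0 := by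
    have h1 : v =ᵐ[volume.restrict (cell K ∩ d.Ω)] 0 :=
      ae_restrict_of_ae_restrict_of_subset inter_subset_right h0
    filter_upwards [h1, ae_restrict_mem hU.measurableSet] with x hx hxU
    rw [← hv K x hxU.1]
    exact hx
  have heq : EqOn (fun y => (affineJet y (α K)).2) 0 (cell K ∩ d.Ω) := by
    refine Measure.eqOn_open_of_ae_eq hae hU ?_ continuousOn_const
    simp only [affineJet_apply]
    fun_prop
  have hg : (α K).1 = 0 := by
    have h1 := hasGradientAt_affine (α K) y
    have h2 : HasGradientAt (fun y => (affineJet y (α K)).2) 0 y :=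
      (hasGradientAt_const y (0 : ℝ)).congr_of_eventuallyEq
        (by filter_upwards [hU.mem_nhds hy] with z hz using heq hz)
    exact h1.unique h2
  have hc := heq hy
  simp only [affineJet_apply, hg, inner_zero_left, zero_add, Pi.zero_apply] at hc
  exact Prod.ext hg hc

/-- The coefficients fix the function on the deformed cells, and the deformed skeleton is null
because a differentiable map preserves null sets. -/
lemma Represents.ae_eq {T : Plane ≃ₜ Plane} (hd : d.IsAdmissible) (hT : IsDeformation T)
    {v w : Plane → ℝ} {α : d.Coeff} (hv : Represents T v α) (hw : Represents T w α) :
    v =ᵐ[volume.restrict (T '' d.Ω)] w := by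
  have hnull : volume (T '' d.skeleton) = 0 :=
    addHaar_image_eq_zero_of_differentiableOn_of_addHaar_eq_zero volume
      (hT.contDiff.differentiable (by norm_num)).differentiableOn hd.volume_skeleton
  have hmeas : MeasurableSet (T '' d.Ω) := (T.isOpenMap _ hd.isOpen).measurableSet
  rw [EventuallyEq, ae_restrict_iff' hmeas]
  filter_upwards [measure_eq_zero_iff_ae_notMem.1 hnull] with z hz hzΩ
  obtain ⟨x, hx, rfl⟩ := hzΩ
  obtain ⟨K, hK, hxK⟩ := (hd.mem_cell_or_skeleton hx).resolve_right
    fun h => hz (mem_image_of_mem T h)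
  rw [hv ⟨K, hK⟩ x hxK, hw ⟨K, hK⟩ x hxK]

variable [Fintype d.active]

variable (d) in
/-- The coefficient vectors of the functions in `V_h(Ω)`. -/
def coeffSpace : Submodule ℝ d.Coeff where
  -- Matching across the edges is encoded in the `H¹` condition alone; only its linearity is ever
  -- used.
  carrier := {α | MemH1 d.Ω fun x => (d.bulkJet α x).2}
  add_mem' := fun {α β} hα hβ => by
    have := MemH1.add_smul hα hβ 1
    simpa using this
  zero_mem' := by simpa using memH1_zero d.Ω
  smul_mem' := fun c α hα => by
    have := MemH1.add_smul (memH1_zero d.Ω) hα c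
    simpa using this

lemma exists_affineJet (a : Plane →ᵃ[ℝ] ℝ) :
    ∃ c : Plane × ℝ, ∀ y, a y = (affineJet y c).2 := by
  refine ⟨((InnerProductSpace.toDual ℝ Plane).symm a.linear.toContinuousLinearMap, a 0),
    fun y => ?_⟩
  have h : ⟪(InnerProductSpace.toDual ℝ Plane).symm a.linear.toContinuousLinearMap, y⟫ =
      a.linear y := InnerProductSpace.toDual_symm_apply
  rw [affineJet_apply, h]
  conv_lhs => rw [AffineMap.decomp a]
  rfl

lemma MemVhMapped.exists_coeff (hd : d.IsAdmissible) {T : Plane → Plane} {v : Plane → ℝ}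
    (hv : d.MemVhMapped T v) : ∃ α ∈ d.coeffSpace, Represents T v α := by
  have h : ∀ K : d.active, ∃ c : Plane × ℝ, ∀ y ∈ cell K, v (T y) = (affineJet y c).2 := by
    intro K
    obtain ⟨a, ha⟩ := hv.2 K K.2
    obtain ⟨c, hc⟩ := exists_affineJet a
    exact ⟨c, fun y hy => (ha hy).trans (hc y)⟩
  choose α hα using h
  refine ⟨α, MemH1.congr hv.1 ?_, hα⟩
  filter_upwards [hd.ae_mem_cell] with x ⟨K, hK, hx⟩
  rw [bulkJet_eq (K := ⟨K, hK⟩) hx]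
  exact hα ⟨K, hK⟩ x hx

variable (d) in
/-- The discrete function with coefficients `α` on the domain deformed by `T`. -/
def realize (T : Plane ≃ₜ Plane) (α : d.Coeff) (x : Plane) : ℝ := (d.bulkJet α (T.symm x)).2

lemma represents_realize (T : Plane ≃ₜ Plane) (α : d.Coeff) : Represents T (d.realize T α) α := by
  intro K y hy
  rw [realize, T.symm_apply_apply, bulkJet_eq hy]

lemma memVhMapped_realize (T : Plane ≃ₜ Plane) {α : d.Coeff} (hα : α ∈ d.coeffSpace) :
    d.MemVhMapped T (d.realize T α) := by
  have h : d.realize T α ∘ T = fun x => (d.bulkJet α x).2 := by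
    funext x
    simp [realize]
  refine ⟨by rw [h]; exact hα, fun K hK => ?_⟩
  refine ⟨(((InnerProductSpace.toDual ℝ Plane (α ⟨K, hK⟩).1 : Plane →L[ℝ] ℝ) :
    Plane →ₗ[ℝ] ℝ).toAffineMap + AffineMap.const ℝ Plane (α ⟨K, hK⟩).2), fun y hy => ?_⟩
  rw [h]
  simp [bulkJet_eq (K := ⟨K, hK⟩) hy]

end Discretization

/-! ### The undeformed domain -/

lemma det₂_one : det₂ (1 : Plane →L[ℝ] Plane) = 1 := by simp [det₂]

lemma fderiv_refl : fderiv ℝ (Homeomorph.refl Plane) = fun _ => 1 :=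
  funext fun _ => fderiv_id

lemma isDeformation_refl : IsDeformation (Homeomorph.refl Plane) where
  contDiff := contDiff_id
  lipschitz := ⟨1, LipschitzWith.id⟩
  nondegenerate := by
    rw [fderiv_refl]
    exact ⟨continuous_const, ⟨_, fun _ => le_rfl⟩, 1, one_pos, fun _ => det₂_one.ge⟩

lemma continuous_div {θ : Plane → Plane} (hθ : ContDiff ℝ 1 θ) : Continuous (div θ) := by
  have h : Continuous (fderiv ℝ θ) := hθ.continuous_fderiv (by norm_num)
  unfold div
  fun_prop

lemma continuous_S {θ : Plane → Plane} (hθ : ContDiff ℝ 1 θ) : Continuous (S θ) := by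
  have h : Continuous (fderiv ℝ θ) := hθ.continuous_fderiv (by norm_num)
  exact h.add (ContinuousLinearMap.adjoint.continuous.comp h)

lemma continuous_tangentialDiv {θ : Plane → Plane} (hθ : ContDiff ℝ 1 θ) (n : Plane) :
    Continuous (tangentialDiv θ n) := by
  have h : Continuous (fderiv ℝ θ) := hθ.continuous_fderiv (by norm_num)
  have h' := continuous_div hθ
  unfold tangentialDiv
  fun_prop

lemma inner_S_comm (θ : Plane → Plane) (x u v : Plane) : ⟪S θ x u, v⟫ = ⟪u, S θ x v⟫ := by
  rw [inner_S, ← real_inner_comm u (S θ x v), inner_S, add_comm, real_inner_comm u, real_inner_comm _ v]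

namespace Discretization

variable {d : Discretization} {u p : Plane → ℝ} {α β : d.Coeff} {θ : Plane → Plane}

lemma Represents.gradient_id_eq (hu : Represents id u α) {K : d.active} {x : Plane}
    (hx : x ∈ cell K) : ∇ u x = (α K).1 := by
  have h : ∇ u x = _ := gradient_eq_of_affine isDeformation_refl (isOpen_cell K) (hu K) hx
  rwa [fderiv_refl, det₂_one, inv_one, one_smul, cof_one] at h

variable [Fintype d.active]

lemma IsAdmissible.integrable_bulk (hd : d.IsAdmissible)
    {φ : Plane × (Plane × ℝ) × (Plane × ℝ) → ℝ} (hφ : ContinuousOn φ (closure d.Ω ×ˢ univ))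
    (α β : d.Coeff) :
    Integrable (fun x => φ (x, d.bulkJet α x, d.bulkJet β x)) (volume.restrict d.Ω) := by
  have hreg := hd.isRegular_bulkData
  have : IsFiniteMeasure (volume.restrict d.Ω) := hreg.finite
  obtain ⟨R, hR⟩ := hreg.bounded_eval α
  obtain ⟨R', hR'⟩ := hreg.bounded_eval β
  refine integrable_comp_of_continuousOn (μ := volume.restrict d.Ω)
    (hd.isCompact_closure.prod
      ((isCompact_closedBall (0 : Plane × ℝ) R).prod (isCompact_closedBall (0 : Plane × ℝ) R')))
    (q := fun x => (x, d.bulkJet α x, d.bulkJet β x))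
    (hφ.mono (prod_mono_right (subset_univ _)))
    (measurable_id.prodMk ((hreg.measurable_eval α).prodMk (hreg.measurable_eval β))).aemeasurable
    ?_
  filter_upwards [hR, hR', ae_restrict_mem hd.isOpen.measurableSet] with x h h' hx
  exact ⟨subset_closure hx, mem_closedBall_zero_iff.2 h, mem_closedBall_zero_iff.2 h'⟩

lemma integrable_face {F : Finset Plane} (hF : F.card = 2) {φ : Plane → ℝ} (hφ : Continuous φ) :
    Integrable φ (μH[1].restrict (convexHull ℝ (F : Set Plane))) := by
  have : IsFiniteMeasure (μH[1].restrict (convexHull ℝ (F : Set Plane))) :=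
    ⟨by simpa using measure_segment_lt_top hF⟩
  exact integrable_comp_of_continuousOn (μ := μH[1].restrict (convexHull ℝ (F : Set Plane)))
    (F.finite_toSet.isCompact_convexHull ℝ) (q := fun x => x) hφ.continuousOn
    aemeasurable_id ((ae_notMem_vertices F).mono fun x hx => hx.1)

lemma Represents.trace_id_eq (hu : Represents id u α) {x : Plane}
    (hn : ∃ n, IsOuterNormal d.Ω x n) (hK : ∃ K ∈ d.active, approach d.Ω x ≤ 𝓟 (cell K)) :
    trace d.Ω u x = (d.boundaryJet α x).2 := by
  have h : trace (id '' d.Ω) u x = (d.boundaryJet α x).2 :=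
    Represents.trace_eq isDeformation_refl hu hn hK
  rwa [image_id] at h

lemma Represents.trace_gradient_id_eq (hu : Represents id u α) {x : Plane}
    (hn : ∃ n, IsOuterNormal d.Ω x n) (hK : ∃ K ∈ d.active, approach d.Ω x ≤ 𝓟 (cell K)) :
    trace d.Ω (∇ u) x = (d.boundaryJet α x).1 := by
  have h : trace (id '' d.Ω) (∇ u) x = _ :=
    Represents.trace_gradient_eq isDeformation_refl hu hn hK
  rwa [image_id, fderiv_refl, det₂_one, inv_one, one_smul, cof_one] at h

lemma nitscheTerm_eq (hd : d.IsAdmissible) (hu : Represents id u α) (hp : Represents id p β) :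
    d.nitscheTerm θ u p = ∫ x in frontier d.Ω \ d.Γf,
      fluxDeriv θ (outerNormal d.Ω x) x (d.boundaryJet α x) (d.boundaryJet β x) ∂μH[1] := by
  rw [nitscheTerm, Γfree, image_id]
  refine integral_congr_ae ?_
  filter_upwards [hd.ae_free] with x ⟨hn, hK⟩
  rw [normalDeriv, hu.trace_gradient_id_eq hn hK, hp.trace_id_eq hn hK, fluxDeriv]
  ring

/-- The tensor `div θ - S(θ)` is continuous across the edge, so its value at `x` can be pulled out
of the jump and applied to the jump of the gradient. -/
lemma Represents.normalJump_id {F : Finset Plane} (hF : F ∈ d.interiorFaces)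
    (hu : Represents id u α) (hθ : ContDiff ℝ 1 θ) {x : Plane}
    (hx : x ∈ convexHull ℝ (F : Set Plane)) (hxF : x ∉ F) :
    d.normalJump id F (∇ u) x = ⟪(d.faceJet F α x).1, faceNormal F⟫ ∧
    d.normalJump id F (fun y => div θ y • ∇ u y - S θ y (∇ u y)) x =
      div θ x * ⟪(d.faceJet F α x).1, faceNormal F⟫ -
        ⟪S θ x (d.faceJet F α x).1, faceNormal F⟫ := by
  have hfn := (faceNormal_spec hF.2.1).1
  have hone : (1 : Plane →L[ℝ] Plane) (faceNormal F) = faceNormal F := rfl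
  have hG : ∀ K : d.active, F ⊆ (K : Finset Plane) → ∀ᶠ y in approach (cell K) x,
      ∇ u y = (α K).1 := by
    intro K hFK
    have hn := (edgeNormal_spec (isTriangle_of_mem K.2.1) hFK hF.2.1).2.2 x hx hxF
    filter_upwards [le_principal_iff.1 hn.approach_le] with y hy using hu.gradient_id_eq hy
  constructor
  · have h : d.normalJump id F (∇ u) x = _ := normalJump_eq hF isDeformation_refl hx hxF
      (H := ∇ u) (G := fun K => (α K).1) (L := 1) fun K hFK =>
        (tendsto_const_nhds (x := (α K).1)).congr' ((hG K hFK).mono fun y hy => hy.symm)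
    rw [h, fderiv_refl, cof_one, hone, hfn, inv_one, one_smul]
    rfl
  · have h : d.normalJump id F (fun y => div θ y • ∇ u y - S θ y (∇ u y)) x = _ :=
      normalJump_eq hF isDeformation_refl hx hxF
      (H := fun y => div θ y • ∇ u y - S θ y (∇ u y)) (G := fun K => (α K).1)
      (L := div θ x • 1 - S θ x) fun K hFK => by
        have hc : Continuous fun y => div θ y • (α K).1 - S θ y (α K).1 :=
          ((continuous_div hθ).smul continuous_const).sub
            ((continuous_S hθ).clm_apply continuous_const)
        refine ((hc.tendsto x).mono_left (approach_le_nhds _ _)).congr'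
          ((hG K hFK).mono fun y hy => ?_)
        show _ = div θ y • ∇ u y - S θ y (∇ u y)
        rw [hy]
    rw [h, fderiv_refl, cof_one, hone, hfn, inv_one, one_smul]
    show ⟪div θ x • (d.faceJet F α x).1 - S θ x (d.faceJet F α x).1, faceNormal F⟫ = _
    rw [inner_sub_left, inner_smul_left]
    rfl

lemma faceTerm_eq (hθ : ContDiff ℝ 1 θ) {F : Finset Plane} (hF : F ∈ d.interiorFaces)
    (hu : Represents id u α) (hp : Represents id p β) :
    d.faceTerm θ F u p = ∫ x in convexHull ℝ (F : Set Plane),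
      ghostDeriv θ (faceNormal F) x (d.faceJet F α x) (d.faceJet F β x) ∂μH[1] := by
  have hd := continuous_div hθ
  have hS := continuous_S hθ
  have ht := continuous_tangentialDiv hθ (faceNormal F)
  -- `faceJet` does not depend on the point, so it is evaluated at `0` to display the integrand as
  -- continuous in `x`.
  have hint : ∀ α β : d.Coeff, Integrable (fun x =>
      (div θ x * ⟪(d.faceJet F α 0).1, faceNormal F⟫ -
        ⟪S θ x (d.faceJet F α 0).1, faceNormal F⟫) * ⟪(d.faceJet F β 0).1, faceNormal F⟫)
      (μH[1].restrict (convexHull ℝ (F : Set Plane))) := fun α β =>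
    integrable_face hF.2.1 (by fun_prop)
  have h3 : Integrable (fun x => ⟪(d.faceJet F α 0).1, faceNormal F⟫ *
      ⟪(d.faceJet F β 0).1, faceNormal F⟫ * tangentialDiv θ (faceNormal F) x)
      (μH[1].restrict (convexHull ℝ (F : Set Plane))) :=
    integrable_face hF.2.1 (by fun_prop)
  have e : ∀ (u p : Plane → ℝ) (α β : d.Coeff), Represents id u α → Represents id p β →
      ∫ x in convexHull ℝ (F : Set Plane),
        d.normalJump id F (fun y => div θ y • ∇ u y - S θ y (∇ u y)) x *
          d.normalJump id F (∇ p) x ∂μH[1] =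
      ∫ x in convexHull ℝ (F : Set Plane), (div θ x * ⟪(d.faceJet F α 0).1, faceNormal F⟫ -
        ⟪S θ x (d.faceJet F α 0).1, faceNormal F⟫) * ⟪(d.faceJet F β 0).1, faceNormal F⟫ ∂μH[1] :=
    fun u p α β hu hp => integral_congr_ae ((ae_notMem_vertices F).mono fun x hx => by
      simp only [(hu.normalJump_id hF hθ hx.1 hx.2).2, (hp.normalJump_id hF hθ hx.1 hx.2).1]
      rfl)
  have e3 : ∫ x in convexHull ℝ (F : Set Plane), d.normalJump id F (∇ u) x *
        d.normalJump id F (∇ p) x * tangentialDiv θ (faceNormal F) x ∂μH[1] =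
      ∫ x in convexHull ℝ (F : Set Plane), ⟪(d.faceJet F α 0).1, faceNormal F⟫ *
        ⟪(d.faceJet F β 0).1, faceNormal F⟫ * tangentialDiv θ (faceNormal F) x ∂μH[1] :=
    integral_congr_ae ((ae_notMem_vertices F).mono fun x hx => by
      simp only [(hu.normalJump_id hF hθ hx.1 hx.2).1, (hp.normalJump_id hF hθ hx.1 hx.2).1]
      rfl)
  rw [faceTerm, e u p α β hu hp, e p u β α hp hu, e3, ← integral_add (hint α β) (hint β α),
    ← integral_sub ((hint α β).fun_add (hint β α)) h3]
  rfl

/-- The shape derivative of the Lagrangian in coefficients. -/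
lemma shapeDeriv_eq (hd : d.IsAdmissible) (hθ : ContDiff ℝ 1 θ) {g : Data} {U : Set Plane}
    (hU : IsOpen U) (hΩU : closure d.Ω ⊆ U) (hf : ContDiffOn ℝ 1 g.f U)
    (hu : Represents id u α) (hp : Represents id p β) :
    (∫ x in d.Ω, div θ x * (g.f x * p x - ⟪∇ u x, ∇ p x⟫))
      + (∫ x in d.Ω, ⟪∇ u x, S θ x (∇ p x)⟫)
      + (∫ x in d.Ω, ⟪∇ g.f x, θ x⟫ * p x)
      + d.nitscheTerm θ u p + d.nitscheTerm θ p u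
      - (∫ x in d.Γfree id, d.β * d.h⁻¹ * tangentialDiv θ (outerNormal d.Ω x) x *
          (trace d.Ω u x * trace d.Ω p x) ∂μH[1])
      - ∑ᶠ F ∈ d.interiorFaces, d.γ * d.h * d.faceTerm θ F u p =
    d.formLDeriv g θ β - d.formADeriv θ α β := by
  have hdiv := continuous_div hθ
  have hS := continuous_S hθ
  have hfc : ContinuousOn (fun z : Plane × (Plane × ℝ) × (Plane × ℝ) => g.f z.1)
      (closure d.Ω ×ˢ univ) :=
    hf.continuousOn.comp continuousOn_fst fun z hz => hΩU hz.1
  have hfd : ContinuousOn (fun z : Plane × (Plane × ℝ) × (Plane × ℝ) => ∇ g.f z.1)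
      (closure d.Ω ×ˢ univ) :=
    (InnerProductSpace.toDual ℝ Plane).symm.continuous.comp_continuousOn
      ((hf.continuousOn_fderiv_of_isOpen hU le_rfl).comp continuousOn_fst fun z hz => hΩU hz.1)
  have i1 : Integrable (fun x => div θ x * (g.f x * (d.bulkJet β x).2)) (volume.restrict d.Ω) :=
    hd.integrable_bulk (φ := fun z => div θ z.1 * (g.f z.1 * z.2.2.2))
      (ContinuousOn.mul (by fun_prop) (hfc.mul (by fun_prop))) α β
  have i2 : Integrable (fun x => div θ x * ⟪(d.bulkJet α x).1, (d.bulkJet β x).1⟫)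
      (volume.restrict d.Ω) :=
    hd.integrable_bulk (φ := fun z => div θ z.1 * ⟪z.2.1.1, z.2.2.1⟫) (by fun_prop) α β
  have i3 : Integrable (fun x => ⟪S θ x (d.bulkJet α x).1, (d.bulkJet β x).1⟫)
      (volume.restrict d.Ω) :=
    hd.integrable_bulk (φ := fun z => ⟪S θ z.1 z.2.1.1, z.2.2.1⟫) (by fun_prop) α β
  have i4 : Integrable (fun x => ⟪∇ g.f x, θ x⟫ * (d.bulkJet β x).2) (volume.restrict d.Ω) :=
    hd.integrable_bulk (φ := fun z => ⟪∇ g.f z.1, θ z.1⟫ * z.2.2.2)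
      ((hfd.inner (hθ.continuous.comp continuous_fst).continuousOn).mul (by fun_prop)) α β
  have e1 : ∫ x in d.Ω, div θ x * (g.f x * p x - ⟪∇ u x, ∇ p x⟫) =
      (∫ x in d.Ω, div θ x * (g.f x * (d.bulkJet β x).2)) -
        ∫ x in d.Ω, div θ x * ⟪(d.bulkJet α x).1, (d.bulkJet β x).1⟫ := by
    rw [← integral_sub i1 i2]
    refine integral_congr_ae ?_
    filter_upwards [hd.ae_mem_cell] with x ⟨K, hK, hx⟩
    have hpx : p x = _ := hp ⟨K, hK⟩ x hx
    simp only [bulkJet_eq (K := ⟨K, hK⟩) hx, hu.gradient_id_eq (K := ⟨K, hK⟩) hx,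
      hp.gradient_id_eq (K := ⟨K, hK⟩) hx, hpx, affineJet_apply]
    ring
  have e2 : ∫ x in d.Ω, ⟪∇ u x, S θ x (∇ p x)⟫ =
      ∫ x in d.Ω, ⟪S θ x (d.bulkJet α x).1, (d.bulkJet β x).1⟫ := by
    refine integral_congr_ae ?_
    filter_upwards [hd.ae_mem_cell] with x ⟨K, hK, hx⟩
    simp only [bulkJet_eq (K := ⟨K, hK⟩) hx, hu.gradient_id_eq (K := ⟨K, hK⟩) hx,
      hp.gradient_id_eq (K := ⟨K, hK⟩) hx, affineJet_apply]
    exact (inner_S_comm _ _ _ _).symm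
  have e3 : ∫ x in d.Ω, ⟪∇ g.f x, θ x⟫ * p x =
      ∫ x in d.Ω, ⟪∇ g.f x, θ x⟫ * (d.bulkJet β x).2 := by
    refine integral_congr_ae ?_
    filter_upwards [hd.ae_mem_cell] with x ⟨K, hK, hx⟩
    have hpx : p x = _ := hp ⟨K, hK⟩ x hx
    simp only [bulkJet_eq (K := ⟨K, hK⟩) hx, hpx]
  have e4 : ∫ x in d.Γfree id, d.β * d.h⁻¹ * tangentialDiv θ (outerNormal d.Ω x) x *
      (trace d.Ω u x * trace d.Ω p x) ∂μH[1] =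
      d.β * d.h⁻¹ * ∫ x in frontier d.Ω \ d.Γf, tangentialDiv θ (outerNormal d.Ω x) x *
        (d.boundaryJet α x).2 * (d.boundaryJet β x).2 ∂μH[1] := by
    rw [← integral_const_mul, Γfree, image_id]
    refine integral_congr_ae ?_
    filter_upwards [hd.ae_free] with x ⟨hn, hK⟩
    rw [hu.trace_id_eq hn hK, hp.trace_id_eq hn hK]
    ring
  have e5 : ∑ᶠ F ∈ d.interiorFaces, d.γ * d.h * d.faceTerm θ F u p =
      ∑ᶠ F ∈ d.interiorFaces, d.γ * d.h * ∫ x in convexHull ℝ (F : Set Plane),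
        ghostDeriv θ (faceNormal F) x (d.faceJet F α x) (d.faceJet F β x) ∂μH[1] :=
    finsum_mem_congr rfl fun F hF => by rw [faceTerm_eq hθ hF hu hp]
  rw [formLDeriv, formADeriv, integral_add i4 i1, integral_sub i2 i3, e1, e2, e3, e4, e5,
    nitscheTerm_eq hd hu hp, nitscheTerm_eq hd hp hu]
  ring

end Discretization

namespace Discretization

variable {d : Discretization}

/-! ### Forms on the fixed boundary -/

lemma IsAdmissible.isFiniteMeasure_fixed (hd : d.IsAdmissible) :
    IsFiniteMeasure (μH[1].restrict d.Γf) := by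
  have h : μH[1] d.Γf < ⊤ := (measure_mono hd.fixed_subset).trans_lt
    (hd.lipschitz.measure_frontier_lt_top hd.isBounded)
  exact ⟨by simpa using h⟩

variable [Fintype d.active]

lemma IsAdmissible.memLp_boundaryJet (hd : d.IsAdmissible) (α : d.Coeff) :
    MemLp (fun x => (d.boundaryJet α x).2) 2 (μH[1].restrict d.Γf) := by
  have := hd.isFiniteMeasure_fixed
  obtain ⟨R, hR⟩ := hd.exists_boundaryJet_le α
  refine MemLp.of_bound (measurable_boundaryJet α).snd.aestronglyMeasurable R ?_
  filter_upwards [ae_restrict_mem isClosed_frontier.measurableSet] with x hx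
  exact (norm_snd_le _).trans (hR x (hd.fixed_subset hx))

variable (d) in
/-- The scaled inner product of a function with a discrete function on the fixed boundary. -/
def fixedForm (k : Plane → ℝ) (α : d.Coeff) : ℝ :=
  d.h⁻¹ * ∫ x in d.Γf, k x * (d.boundaryJet α x).2 ∂μH[1]

lemma fixedForm_add_smul (hd : d.IsAdmissible) {k : Plane → ℝ}
    (hk : MemLp k 2 (μH[1].restrict d.Γf)) (c : ℝ) (α₁ α₂ : d.Coeff) :
    d.fixedForm k (α₁ + c • α₂) = d.fixedForm k α₁ + c * d.fixedForm k α₂ := by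
  have hint : ∀ α : d.Coeff, Integrable (fun x => k x * (d.boundaryJet α x).2)
      (μH[1].restrict d.Γf) := fun α => hk.integrable_mul (hd.memLp_boundaryJet α)
  have h : ∫ x in d.Γf, k x * (d.boundaryJet (α₁ + c • α₂) x).2 ∂μH[1] =
      (∫ x in d.Γf, k x * (d.boundaryJet α₁ x).2 ∂μH[1]) +
        c * ∫ x in d.Γf, k x * (d.boundaryJet α₂ x).2 ∂μH[1] := by
    rw [← integral_const_mul, ← integral_add (hint _) ((hint _).const_mul c)]
    refine integral_congr_ae (Eventually.of_forall fun x => ?_)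
    simp
    ring
  rw [fixedForm, h, fixedForm, fixedForm]
  ring

lemma fixedForm_symm (α β : d.Coeff) :
    d.fixedForm (fun x => (d.boundaryJet α x).2) β =
      d.fixedForm (fun x => (d.boundaryJet β x).2) α := by
  simp only [fixedForm, mul_comm]

lemma fixedForm_sub (hd : d.IsAdmissible) {k k' : Plane → ℝ}
    (hk : MemLp k 2 (μH[1].restrict d.Γf)) (hk' : MemLp k' 2 (μH[1].restrict d.Γf))
    (α : d.Coeff) :
    d.fixedForm (fun x => k x - k' x) α = d.fixedForm k α - d.fixedForm k' α := by
  have h1 : Integrable (fun x => k x * (d.boundaryJet α x).2) (μH[1].restrict d.Γf) :=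
    hk.integrable_mul (hd.memLp_boundaryJet α)
  have h2 : Integrable (fun x => k' x * (d.boundaryJet α x).2) (μH[1].restrict d.Γf) :=
    hk'.integrable_mul (hd.memLp_boundaryJet α)
  simp only [fixedForm, sub_mul]
  rw [integral_sub h1 h2]
  ring

/-- Expanding the square gives constant, linear and quadratic parts that are independent of the
deformation, as the adjoint argument requires. -/
lemma misfit_eq (hd : d.IsAdmissible) {k : Plane → ℝ}
    (hk : MemLp k 2 (μH[1].restrict d.Γf)) (α : d.Coeff) :
    1 / 2 * d.h⁻¹ * ∫ x in d.Γf, (k x - (d.boundaryJet α x).2) ^ 2 ∂μH[1] =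
      1 / 2 * d.h⁻¹ * (∫ x in d.Γf, k x ^ 2 ∂μH[1]) - d.fixedForm k α +
        1 / 2 * d.fixedForm (fun x => (d.boundaryJet α x).2) α := by
  have hB := hd.memLp_boundaryJet α
  have h1 : Integrable (fun x => k x ^ 2) (μH[1].restrict d.Γf) := hk.integrable_sq
  have h2 : Integrable (fun x => 2 * (k x * (d.boundaryJet α x).2)) (μH[1].restrict d.Γf) :=
    (hk.integrable_mul hB).const_mul 2
  have h3 : Integrable (fun x => (d.boundaryJet α x).2 * (d.boundaryJet α x).2)
      (μH[1].restrict d.Γf) := hB.integrable_mul hB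
  have h12 : Integrable (fun x => k x ^ 2 - 2 * (k x * (d.boundaryJet α x).2))
      (μH[1].restrict d.Γf) := h1.sub h2
  have h : ∫ x in d.Γf, (k x - (d.boundaryJet α x).2) ^ 2 ∂μH[1] =
      ∫ x in d.Γf, (k x ^ 2 - 2 * (k x * (d.boundaryJet α x).2) +
        (d.boundaryJet α x).2 * (d.boundaryJet α x).2) ∂μH[1] :=
    integral_congr_ae (Eventually.of_forall fun x => by ring)
  rw [h, integral_add h12 h3, integral_sub h1 h2, integral_const_mul, fixedForm, fixedForm]
  ring

/-! ### Galerkin systems -/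

section Galerkin

variable {m : ℕ} (b : Module.Basis (Fin m) ℝ d.coeffSpace)

/-- The coefficients of the discrete function with coordinates `x` in the basis `b`. -/
def comb (x : Fin m → ℝ) : d.Coeff := ∑ i, x i • (b i : d.Coeff)

lemma comb_eq_coe (x : Fin m → ℝ) :
    comb b x = ((∑ i, x i • b i : d.coeffSpace) : d.Coeff) := by
  simp [comb]

lemma comb_mem (x : Fin m → ℝ) : comb b x ∈ d.coeffSpace := by
  rw [comb_eq_coe]
  exact Subtype.property _

lemma exists_comb {α : d.Coeff} (hα : α ∈ d.coeffSpace) : ∃ x, comb b x = α :=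
  ⟨b.equivFun ⟨α, hα⟩, by rw [comb_eq_coe, b.sum_equivFun]⟩

lemma comb_eq_zero {x : Fin m → ℝ} (h : comb b x = 0) : x = 0 := by
  rw [comb_eq_coe, ZeroMemClass.coe_eq_zero] at h
  exact funext fun i => Fintype.linearIndependent_iff.1 b.linearIndependent x h i

/-- The matrix of the bilinear form `a_h` for a deformation with derivative `N`. -/
def stiffness (N : Plane → Plane →L[ℝ] Plane) : Matrix (Fin m) (Fin m) ℝ :=
  Matrix.of fun i j => d.formA N (b i) (b j)

/-- The vector of the linear form `l_h`. -/
def load (g : Data) (T : Plane → Plane) (i : Fin m) : ℝ := d.formL g T (b i)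

/-- The Gram matrix on the fixed boundary. -/
def fixedGram : Matrix (Fin m) (Fin m) ℝ :=
  Matrix.of fun i j => d.fixedForm (fun x => (d.boundaryJet (b i) x).2) (b j)

/-- The vector of a linear functional on the fixed boundary. -/
def fixedVec (k : Plane → ℝ) (i : Fin m) : ℝ := d.fixedForm k (b i)

variable {b}

lemma stiffness_transpose (N : Plane → Plane →L[ℝ] Plane) :
    (stiffness b N).transpose = stiffness b N := by
  ext i j
  exact formA_symm _ _ _

lemma fixedGram_transpose : (fixedGram b).transpose = fixedGram b := by
  ext i j
  exact fixedForm_symm _ _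

lemma formA_comb (hd : d.IsAdmissible) {N : Plane → Plane →L[ℝ] Plane} (hN : IsNondegenerate N)
    (x : Fin m → ℝ) (β : d.Coeff) :
    d.formA N (comb b x) β = ∑ i, x i * d.formA N (b i) β :=
  map_sum_of_add_smul (f := fun α => d.formA N α β) (fun c α₁ α₂ => formA_left hd hN c α₁ α₂ β)
    Finset.univ x fun i => (b i : d.Coeff)

lemma stiffness_mulVec (hd : d.IsAdmissible) {N : Plane → Plane →L[ℝ] Plane}
    (hN : IsNondegenerate N) (x : Fin m → ℝ) :
    (stiffness b N).mulVec x = fun i => d.formA N (comb b x) (b i) := by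
  funext i
  rw [formA_comb hd hN]
  show ∑ j, stiffness b N i j * x j = _
  exact Finset.sum_congr rfl fun j _ => by
    rw [mul_comm, stiffness, Matrix.of_apply, formA_symm]

lemma fixedGram_mulVec (hd : d.IsAdmissible) (x : Fin m → ℝ) :
    (fixedGram b).mulVec x =
      fun i => d.fixedForm (fun y => (d.boundaryJet (comb b x) y).2) (b i) := by
  funext i
  rw [fixedForm_symm, comb, map_sum_of_add_smul (f := d.fixedForm _)
    (fixedForm_add_smul hd (hd.memLp_boundaryJet _))]
  show ∑ j, fixedGram b i j * x j = _
  exact Finset.sum_congr rfl fun j _ => by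
    rw [mul_comm, fixedGram, Matrix.of_apply]

variable {T : Plane ≃ₜ Plane} {g : Data} {u p : Plane → ℝ} {x y : Fin m → ℝ}

lemma exists_comb_represents (hd : d.IsAdmissible) (b : Module.Basis (Fin m) ℝ d.coeffSpace)
    {T : Plane → Plane} (hu : d.MemVhMapped T u) : ∃ x, Represents T u (comb b x) := by
  obtain ⟨α, hα, h⟩ := hu.exists_coeff hd
  obtain ⟨x, rfl⟩ := exists_comb b hα
  exact ⟨x, h⟩

/-- Both sides of a discrete equation factor through the coefficients of the test function and are
linear in them, so a basis suffices for testing. -/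
lemma forall_memVhMapped_iff (hd : d.IsAdmissible) {f k : (Plane → ℝ) → ℝ} {F G : d.Coeff → ℝ}
    (hf : ∀ v α, Represents T v α → f v = F α) (hk : ∀ v α, Represents T v α → k v = G α)
    (hF : ∀ (c : ℝ) α₁ α₂, F (α₁ + c • α₂) = F α₁ + c * F α₂)
    (hG : ∀ (c : ℝ) α₁ α₂, G (α₁ + c • α₂) = G α₁ + c * G α₂) :
    (∀ v, d.MemVhMapped T v → f v = k v) ↔ ∀ i, F (b i) = G (b i) := by
  constructor
  · intro h i
    have hr := represents_realize T (b i : d.Coeff)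
    rw [← hf _ _ hr, ← hk _ _ hr]
    exact h _ (memVhMapped_realize T (b i).2)
  · intro h v hv
    obtain ⟨z, hz⟩ := exists_comb_represents hd b hv
    rw [hf _ _ hz, hk _ _ hz, comb, map_sum_of_add_smul hF, map_sum_of_add_smul hG]
    exact Finset.sum_congr rfl fun i _ => by rw [h]

lemma formA_right (hd : d.IsAdmissible) {N : Plane → Plane →L[ℝ] Plane} (hN : IsNondegenerate N)
    (c : ℝ) (α β₁ β₂ : d.Coeff) :
    d.formA N α (β₁ + c • β₂) = d.formA N α β₁ + c * d.formA N α β₂ := by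
  rw [formA_symm, formA_left hd hN, formA_symm N α, formA_symm N α]

lemma isPrimal_iff (hd : d.IsAdmissible) (hT : IsDeformation T) (hfix : ∀ x ∈ d.Γf, T x = x)
    (hgN : MemHNegHalf d.Γf g.gN) {U : Set Plane} (hU : ContinuousOn g.f U)
    (hTU : MapsTo T (closure d.Ω) U) (hmem : d.MemVhMapped T u) (hu : Represents T u (comb b x)) :
    d.IsPrimal g T u ↔ (stiffness b (fderiv ℝ T)).mulVec x = load b g T := by
  rw [IsPrimal, stiffness_mulVec hd hT.nondegenerate, funext_iff,
    forall_memVhMapped_iff (b := b) hd (f := d.a T u) (k := d.l g T)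
      (fun v α hv => a_eq_formA hd hT hfix hu hv) (fun v α hv => l_eq_formL hd hT hfix hgN hv)
      (fun c => formA_right hd hT.nondegenerate c _) (formL_add_smul hd hT hU hTU)]
  exact and_iff_right hmem

lemma isDual_iff (hd : d.IsAdmissible) (hT : IsDeformation T) (hfix : ∀ x ∈ d.Γf, T x = x)
    (hgD : MemLp g.gD 2 (μH[1].restrict d.Γf)) (hu : Represents T u (comb b x))
    (hmem : d.MemVhMapped T p) (hp : Represents T p (comb b y)) :
    d.IsDual g T u p ↔
      (stiffness b (fderiv ℝ T)).mulVec y = (fixedGram b).mulVec x - fixedVec b g.gD := by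
  have hB := hd.memLp_boundaryJet (comb b x)
  have hk : MemLp (fun z => (d.boundaryJet (comb b x) z).2 - g.gD z) 2 (μH[1].restrict d.Γf) :=
    hB.sub hgD
  rw [IsDual, stiffness_mulVec hd hT.nondegenerate, fixedGram_mulVec hd, funext_iff,
    forall_memVhMapped_iff (b := b) hd (f := d.a T p)
      (fun v α hv => a_eq_formA hd hT hfix hp hv) (G := d.fixedForm _) ?_
      (fun c => formA_right hd hT.nondegenerate c _) (fixedForm_add_smul hd hk)]
  · refine (and_iff_right hmem).trans (forall_congr' fun i => ?_)
    rw [fixedForm_sub hd hB hgD]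
    rfl
  · intro v α hv
    rw [fixedForm]
    congr 1
    refine integral_congr_ae ?_
    filter_upwards [hu.ae_trace_fixed hd hT hfix, hv.ae_trace_fixed hd hT hfix] with z h1 h2
    rw [h1, h2]

/-- The primal equation tested with `p` cancels `a_h` against `l_h`. What remains is the misfit, in
which neither `p` nor the deformation appears. -/
lemma lagrangian_eq (hd : d.IsAdmissible) (hT : IsDeformation T) (hfix : ∀ x ∈ d.Γf, T x = x)
    (hgD : MemLp g.gD 2 (μH[1].restrict d.Γf)) (hu : Represents T u (comb b x))
    (hup : d.a T u p = d.l g T p) :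
    d.lagrangian g T u p = 1 / 2 * d.h⁻¹ * (∫ z in d.Γf, g.gD z ^ 2 ∂μH[1]) -
      fixedVec b g.gD ⬝ᵥ x + 1 / 2 * (x ⬝ᵥ (fixedGram b).mulVec x) := by
  have h1 : ∫ z in d.Γf, (g.gD z - trace (T '' d.Ω) u z) ^ 2 ∂μH[1] =
      ∫ z in d.Γf, (g.gD z - (d.boundaryJet (comb b x) z).2) ^ 2 ∂μH[1] :=
    integral_congr_ae ((hu.ae_trace_fixed hd hT hfix).mono fun z hz => by simp only [hz])
  have h2 : fixedVec b g.gD ⬝ᵥ x = d.fixedForm g.gD (comb b x) := by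
    rw [comb, map_sum_of_add_smul (fixedForm_add_smul hd hgD)]
    exact Finset.sum_congr rfl fun i _ => mul_comm _ _
  have h3 : x ⬝ᵥ (fixedGram b).mulVec x =
      d.fixedForm (fun z => (d.boundaryJet (comb b x) z).2) (comb b x) := by
    rw [fixedGram_mulVec hd]
    conv_rhs => rw [comb, map_sum_of_add_smul (f := d.fixedForm _)
      (fixedForm_add_smul hd (hd.memLp_boundaryJet _))]
    rfl
  rw [lagrangian, hup, h1, misfit_eq hd hgD, h2, h3]
  ring

/-- A kernel vector is a discrete function annihilated by `a_h`. By nondegeneracy it vanishes on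
`Ω`, so its coefficients and then its coordinates vanish. -/
lemma det_stiffness_ne_zero (hd : d.IsAdmissible) (hwp : d.IsWellPosed) :
    (stiffness b fun _ => 1).det ≠ 0 := by
  intro h0
  obtain ⟨x, hx0, hx⟩ := Matrix.exists_mulVec_eq_zero_iff.2 h0
  have hT := isDeformation_refl
  have hN : IsNondegenerate fun _ : Plane => (1 : Plane →L[ℝ] Plane) := by
    have := hT.nondegenerate
    rwa [fderiv_refl] at this
  rw [stiffness_mulVec hd hN] at hx
  have hu : Represents id (d.realize (Homeomorph.refl Plane) (comb b x)) (comb b x) :=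
    represents_realize _ _
  have hmem : d.MemVh (d.realize (Homeomorph.refl Plane) (comb b x)) :=
    memVhMapped_realize (Homeomorph.refl Plane) (comb_mem b x)
  refine hx0 (comb_eq_zero b (hu.eq_zero hd (hwp _ hmem ?_)))
  refine (forall_memVhMapped_iff (b := b) (T := Homeomorph.refl Plane) hd
    (f := d.a id (d.realize (Homeomorph.refl Plane) (comb b x))) (k := fun _ => 0)
    (F := d.formA (fun _ => 1) (comb b x)) (G := fun _ => 0)
    (fun v α hv => ?_) (fun _ _ _ => rfl) (fun c => formA_right hd hN c _)
    (fun _ _ _ => by simp)).2 fun i => congrFun hx i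
  have h := a_eq_formA hd hT (fun _ _ => rfl) hu hv
  rwa [fderiv_refl] at h

end Galerkin

end Discretization

/-! ### The Galerkin system along the perturbation `T_t`. -/

lemma perturb_zero (θ : Plane → Plane) : perturb θ 0 = id := by
  funext x
  simp [perturb]

lemma one_add_zero_smul_fderiv (θ : Plane → Plane) :
    (fun x => (1 : Plane →L[ℝ] Plane) + (0 : ℝ) • fderiv ℝ θ x) = fun _ => 1 := by
  funext x
  ext1 v
  simp

lemma eventually_mapsTo_perturb {θ : Plane → Plane} (hθ : Continuous θ) {Q U : Set Plane}
    (hQ : IsCompact Q) (hU : IsOpen U) (hQU : Q ⊆ U) :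
    ∀ᶠ t in 𝓝 (0 : ℝ), MapsTo (perturb θ t) Q U := by
  have hc : Continuous fun z : ℝ × Plane => perturb θ z.1 z.2 := by
    unfold perturb
    fun_prop
  refine hQ.eventually_forall_of_forall_eventually (P := fun t x => perturb θ t x ∈ U) fun x hx =>
    hc.continuousAt.eventually (hU.mem_nhds ?_)
  simpa [perturb_zero] using hQU hx

namespace Discretization

variable {d : Discretization}

lemma eventually_deformation (hd : d.IsAdmissible) {U : Set Plane} (hU : IsOpen U)
    (hΩU : closure d.Ω ⊆ U) {θ : Plane → Plane} (hθ : ContDiff ℝ 1 θ) (hc : HasCompactSupport θ)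
    (hθ0 : ∀ x ∈ d.Γf, θ x = 0) :
    ∀ᶠ t in 𝓝 (0 : ℝ), ∃ T : Plane ≃ₜ Plane, ⇑T = perturb θ t ∧ IsDeformation T ∧
      (∀ x ∈ d.Γf, T x = x) ∧ MapsTo T (closure d.Ω) U ∧
      fderiv ℝ T = fun x => 1 + t • fderiv ℝ θ x := by
  obtain ⟨C, hC⟩ := hθ.lipschitzWith_of_hasCompactSupport hc one_ne_zero
  filter_upwards [eventually_exists_deformation hθ hC,
    eventually_mapsTo_perturb hθ.continuous hd.isCompact_closure hU hΩU] with t ⟨T, hT, hTd⟩ hm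
  refine ⟨T, hT, hTd, fun x hx => ?_, by rwa [hT], ?_⟩
  · rw [hT, perturb, hθ0 x hx, smul_zero, add_zero]
  · rw [hT]
    exact funext fun x => (hasFDerivAt_perturb hθ t x).fderiv

variable [Fintype d.active] {g : Data} {U : Set Plane} {θ : Plane → Plane}

section Deriv

variable {m : ℕ} {b : Module.Basis (Fin m) ℝ d.coeffSpace}

lemma hasDerivAt_stiffness (hd : d.IsAdmissible) (hθ : ContDiff ℝ 1 θ)
    (hc : HasCompactSupport θ) (i j : Fin m) :
    HasDerivAt (fun t : ℝ => stiffness b (fun x => 1 + t • fderiv ℝ θ x) i j)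
      (d.formADeriv θ (b i) (b j)) 0 :=
  have hθ' : Continuous (fderiv ℝ θ) := hθ.continuous_fderiv (by norm_num)
  hasDerivAt_formA hd hθ' (hθ'.bounded_above_of_compact_support (hc.fderiv ℝ)) _ _

lemma hasDerivAt_load (hd : d.IsAdmissible) (hU : IsOpen U) (hΩU : closure d.Ω ⊆ U)
    (hf : ContDiffOn ℝ 1 g.f U) (hθ : ContDiff ℝ 1 θ) (hc : HasCompactSupport θ)
    (α : d.Coeff) :
    HasDerivAt (fun t : ℝ => d.formL g (perturb θ t) α) (d.formLDeriv g θ α) 0 :=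
  hasDerivAt_formL hd hθ
    ((hθ.continuous_fderiv (by norm_num)).bounded_above_of_compact_support (hc.fderiv ℝ))
    (hθ.continuous.bounded_above_of_compact_support hc) hU hΩU hf α

/-- Linearity is inherited from the forms at small `t` by uniqueness of derivatives, which avoids
the integral formula. -/
lemma formLDeriv_comb (hd : d.IsAdmissible) (hU : IsOpen U) (hΩU : closure d.Ω ⊆ U)
    (hf : ContDiffOn ℝ 1 g.f U) (hθ : ContDiff ℝ 1 θ) (hc : HasCompactSupport θ)
    (hθ0 : ∀ x ∈ d.Γf, θ x = 0) (y : Fin m → ℝ) :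
    d.formLDeriv g θ (comb b y) = y ⬝ᵥ fun i => d.formLDeriv g θ (b i) := by
  refine (hasDerivAt_load hd hU hΩU hf hθ hc (comb b y)).unique ?_
  have h : HasDerivAt (fun t : ℝ => ∑ i, y i * d.formL g (perturb θ t) (b i))
      (∑ i, y i * d.formLDeriv g θ (b i)) 0 :=
    HasDerivAt.fun_sum fun i _ => (hasDerivAt_load hd hU hΩU hf hθ hc (b i)).const_mul (y i)
  refine h.congr_of_eventuallyEq ?_
  filter_upwards [eventually_deformation hd hU hΩU hθ hc hθ0] with t ⟨T, hT, hTd, _, hTU, _⟩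
  rw [comb, ← hT]
  exact map_sum_of_add_smul (formL_add_smul hd hTd hf.continuousOn hTU) Finset.univ y
    fun i => (b i : d.Coeff)

lemma formADeriv_comb (hd : d.IsAdmissible) (hθ : ContDiff ℝ 1 θ) (hc : HasCompactSupport θ)
    (hθ0 : ∀ x ∈ d.Γf, θ x = 0) (x y : Fin m → ℝ) :
    d.formADeriv θ (comb b x) (comb b y) =
      y ⬝ᵥ (Matrix.of fun i j => d.formADeriv θ (b i) (b j)).mulVec x := by
  have hθ' : Continuous (fderiv ℝ θ) := hθ.continuous_fderiv (by norm_num)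
  refine (hasDerivAt_formA hd hθ' (hθ'.bounded_above_of_compact_support (hc.fderiv ℝ))
    (comb b x) (comb b y)).unique ?_
  have h : HasDerivAt (fun t : ℝ => ∑ i, y i *
      ∑ j, stiffness b (fun x => 1 + t • fderiv ℝ θ x) i j * x j)
      (∑ i, y i * ∑ j, d.formADeriv θ (b i) (b j) * x j) 0 :=
    HasDerivAt.fun_sum fun i _ => (HasDerivAt.fun_sum fun j _ =>
      (hasDerivAt_stiffness hd hθ hc i j).mul_const (x j)).const_mul (y i)
  refine h.congr_of_eventuallyEq ?_
  filter_upwards [eventually_deformation hd isOpen_univ (subset_univ _) hθ hc hθ0] with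
    t ⟨T, hT, hTd, _, _, hfd⟩
  have hN := hTd.nondegenerate
  rw [hfd] at hN
  have h1 := stiffness_mulVec (b := b) hd hN x
  rw [formA_symm, formA_comb hd hN]
  refine Finset.sum_congr rfl fun i _ => ?_
  rw [formA_symm]
  exact congrArg (y i * ·) (congrFun h1 i).symm

end Deriv

lemma eventually_det_ne_zero (hd : d.IsAdmissible) (hwp : d.IsWellPosed) (hθ : ContDiff ℝ 1 θ)
    (hc : HasCompactSupport θ) {m : ℕ} (b : Module.Basis (Fin m) ℝ d.coeffSpace) :
    ∀ᶠ t in 𝓝 (0 : ℝ), (stiffness b fun x => 1 + t • fderiv ℝ θ x).det ≠ 0 := by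
  refine (differentiableAt_det fun i j =>
    (hasDerivAt_stiffness (b := b) hd hθ hc i j).differentiableAt).continuousAt.eventually_ne ?_
  rw [one_add_zero_smul_fderiv]
  exact det_stiffness_ne_zero hd hwp

/-- Primal and dual problems have the same matrix, invertible for small `t`. Uniqueness of
coordinates gives uniqueness of functions up to null sets. -/
lemma eventually_exists_unique (hd : d.IsAdmissible) (hwp : d.IsWellPosed) (hU : IsOpen U)
    (hΩU : closure d.Ω ⊆ U) (hf : ContDiffOn ℝ 1 g.f U)
    (hgD : MemLp g.gD 2 (μH[1].restrict d.Γf)) (hgN : MemHNegHalf d.Γf g.gN)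
    (hθ : ContDiff ℝ 1 θ) (hc : HasCompactSupport θ) (hθ0 : ∀ x ∈ d.Γf, θ x = 0) :
    ∀ᶠ t in 𝓝 (0 : ℝ), ∃ u p : Plane → ℝ,
      d.IsPrimal g (perturb θ t) u ∧ d.IsDual g (perturb θ t) u p ∧
      ∀ u' p' : Plane → ℝ,
        d.IsPrimal g (perturb θ t) u' → d.IsDual g (perturb θ t) u' p' →
          u' =ᵐ[volume.restrict (perturb θ t '' d.Ω)] u ∧
          p' =ᵐ[volume.restrict (perturb θ t '' d.Ω)] p := by
  have b := Module.finBasis ℝ d.coeffSpace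
  filter_upwards [eventually_deformation hd hU hΩU hθ hc hθ0,
    eventually_det_ne_zero hd hwp hθ hc b] with t ⟨T, hT, hTd, hfix, hTU, hfd⟩ hdet
  rw [← hfd] at hdet
  rw [← hT]
  have hdet' := Ne.isUnit hdet
  set A := stiffness b (fderiv ℝ T) with hA
  have hinj : ∀ x y, A.mulVec x = A.mulVec y → x = y := fun x y h =>
    Matrix.mulVec_injective_iff_isUnit.2 ((Matrix.isUnit_iff_isUnit_det A).2 hdet') h
  have hsol : ∀ r, A.mulVec (A⁻¹.mulVec r) = r := fun r => by
    rw [Matrix.mulVec_mulVec, Matrix.mul_nonsing_inv _ hdet', Matrix.one_mulVec]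
  set x := A⁻¹.mulVec (load b g T) with hx
  set y := A⁻¹.mulVec ((fixedGram b).mulVec x - fixedVec b g.gD) with hy
  have hu := represents_realize T (comb b x)
  have hp := represents_realize T (comb b y)
  refine ⟨d.realize T (comb b x), d.realize T (comb b y),
    (isPrimal_iff hd hTd hfix hgN hf.continuousOn hTU
      (memVhMapped_realize T (comb_mem b x)) hu).2 (hsol _),
    (isDual_iff hd hTd hfix hgD hu (memVhMapped_realize T (comb_mem b y)) hp).2 (hsol _),
    fun u' p' hu' hp' => ?_⟩
  obtain ⟨x', hx'⟩ := exists_comb_represents hd b hu'.1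
  obtain ⟨y', hy'⟩ := exists_comb_represents hd b hp'.1
  have hxx : x' = x := hinj _ _ (((isPrimal_iff hd hTd hfix hgN hf.continuousOn hTU hu'.1
    hx').1 hu').trans (hsol _).symm)
  have hyy : y' = y := by
    have h := (isDual_iff hd hTd hfix hgD hx' hp'.1 hy').1 hp'
    rw [hxx] at h
    exact hinj _ _ (h.trans (hsol _).symm)
  subst hxx hyy
  exact ⟨hx'.ae_eq hd hTd hu, hy'.ae_eq hd hTd hp⟩

lemma hasDerivAt_lagrangian (hd : d.IsAdmissible) (hwp : d.IsWellPosed) (hU : IsOpen U)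
    (hΩU : closure d.Ω ⊆ U) (hf : ContDiffOn ℝ 1 g.f U)
    (hgD : MemLp g.gD 2 (μH[1].restrict d.Γf)) (hgN : MemHNegHalf d.Γf g.gN)
    (hθ : ContDiff ℝ 1 θ) (hc : HasCompactSupport θ) (hθ0 : ∀ x ∈ d.Γf, θ x = 0)
    {u p : ℝ → Plane → ℝ} (hup : ∀ᶠ t in 𝓝 (0 : ℝ), d.IsPrimal g (perturb θ t) (u t) ∧
      d.IsDual g (perturb θ t) (u t) (p t)) :
    ∃ α β : d.Coeff, Represents id (u 0) α ∧ Represents id (p 0) β ∧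
      HasDerivAt (fun t => d.lagrangian g (perturb θ t) (u t) (p t))
        (d.formLDeriv g θ β - d.formADeriv θ α β) 0 := by
  have b := Module.finBasis ℝ d.coeffSpace
  have hgood := (eventually_deformation hd hU hΩU hθ hc hθ0).and hup
  -- Solutions are given only for small `t`; elsewhere the coordinates are set to `0`, which does
  -- not affect the derivative at `0`.
  have hex : ∀ t, ∃ x : Fin (Module.finrank ℝ d.coeffSpace) → ℝ,
      d.MemVhMapped (perturb θ t) (u t) → Represents (perturb θ t) (u t) (comb b x) := fun t => by
    by_cases h : d.MemVhMapped (perturb θ t) (u t)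
    · obtain ⟨x, hx⟩ := exists_comb_represents hd b h
      exact ⟨x, fun _ => hx⟩
    · exact ⟨0, fun h' => absurd h' h⟩
  choose X hX using hex
  obtain ⟨⟨T, hT, hTd, hfix, -, hfd⟩, hu0, hp0⟩ := hgood.self_of_nhds
  obtain ⟨y, hy⟩ := exists_comb_represents hd b hp0.1
  have hx := hX 0 hu0.1
  have hdual : (stiffness b fun x => 1 + (0 : ℝ) • fderiv ℝ θ x).mulVec y =
      (fixedGram b).mulVec (X 0) - fixedVec b g.gD := by
    rw [← hfd]
    rw [← hT] at hx hy hp0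
    exact (isDual_iff hd hTd hfix hgD hx hp0.1 hy).1 hp0
  have hmain := hasDerivAt_quadratic_of_linear_system
    (A := fun t => stiffness b fun x => 1 + t • fderiv ℝ θ x)
    (A' := Matrix.of fun i j => d.formADeriv θ (b i) (b j))
    (L := fun t => load b g (perturb θ t)) (L' := fun i => d.formLDeriv g θ (b i))
    (hasDerivAt_stiffness hd hθ hc) (fun i => hasDerivAt_load hd hU hΩU hf hθ hc (b i))
    (by rw [one_add_zero_smul_fderiv]; exact det_stiffness_ne_zero hd hwp) (stiffness_transpose _)
    fixedGram_transpose (1 / 2 * d.h⁻¹ * ∫ z in d.Γf, g.gD z ^ 2 ∂μH[1]) (fixedVec b g.gD)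
    (U := X) (P := y) ?_ hdual
  · rw [perturb_zero] at hx hy
    refine ⟨comb b (X 0), comb b y, hx, hy, ?_⟩
    rw [formLDeriv_comb hd hU hΩU hf hθ hc hθ0, formADeriv_comb hd hθ hc hθ0]
    refine hmain.congr_of_eventuallyEq ?_
    filter_upwards [hgood] with t ⟨⟨S, hS, hSd, hfix, _, _⟩, hut, hpt⟩
    have hr := hX t hut.1
    rw [← hS] at hr hut hpt ⊢
    -- For `t ≠ 0` only the membership of `p t` in the discrete space is needed; the dual equation
    -- enters at `t = 0` alone.
    exact lagrangian_eq hd hSd hfix hgD hr (hut.2 _ hpt.1)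
  · filter_upwards [hgood] with t ⟨⟨S, hS, hSd, hfix, hSU, hfdS⟩, hut, _⟩
    have hr := hX t hut.1
    rw [← hfdS]
    rw [← hS] at hr hut ⊢
    exact (isPrimal_iff hd hSd hfix hgN hf.continuousOn hSU hut.1 hr).1 hut

end Discretization

/-! ### Reduction to compactly supported vector fields. -/

/-- A vector field agrees near a bounded set with a compactly supported one. -/
lemma exists_hasCompactSupport_eventuallyEq {θ : Plane → Plane} (hθ : ContDiff ℝ 1 θ)
    {D : Set Plane} (hD : Bornology.IsBounded D) :
    ∃ ψ : Plane → Plane, ContDiff ℝ 1 ψ ∧ HasCompactSupport ψ ∧ ∀ x ∈ D, ψ =ᶠ[𝓝 x] θ := by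
  obtain ⟨R, hR, hDR⟩ := hD.subset_ball_lt 0 0
  let χ : ContDiffBump (0 : Plane) := ⟨R, R + 1, hR, by linarith⟩
  refine ⟨fun x => χ x • θ x, χ.contDiff.smul hθ, χ.hasCompactSupport.smul_right,
    fun x hx => ?_⟩
  filter_upwards [Metric.isOpen_ball.mem_nhds (hDR hx)] with y hy
  rw [χ.one_of_mem_closedBall (Metric.ball_subset_closedBall hy), one_smul]

lemma div_congr {θ ψ : Plane → Plane} {x : Plane} (h : ψ =ᶠ[𝓝 x] θ) : div ψ x = div θ x := by
  rw [div, div, h.fderiv_eq]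

lemma S_congr {θ ψ : Plane → Plane} {x : Plane} (h : ψ =ᶠ[𝓝 x] θ) : S ψ x = S θ x := by
  rw [S, S, h.fderiv_eq]

lemma tangentialDiv_congr {θ ψ : Plane → Plane} {x : Plane} (h : ψ =ᶠ[𝓝 x] θ) (n : Plane) :
    tangentialDiv ψ n x = tangentialDiv θ n x := by
  rw [tangentialDiv, tangentialDiv, div_congr h, h.fderiv_eq]

namespace Discretization

variable {d : Discretization}

lemma cell_subset_hat (hd : d.IsAdmissible) {K : Finset Plane} (hK : K ∈ d.triangles) :
    cell K ⊆ closure d.Ωhat := by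
  rw [← hd.space_mesh]
  exact interior_subset.trans (d.mesh.convexHull_subset_space hK.1)

lemma face_subset_hat (hd : d.IsAdmissible) {F : Finset Plane} (hF : F ∈ d.mesh.faces) :
    convexHull ℝ (F : Set Plane) ⊆ closure d.Ωhat := by
  rw [← hd.space_mesh]
  exact d.mesh.convexHull_subset_space hF

/-! ### The problem depends on the values of the deformation in the background domain only -/

section Congr

variable {T T' : Plane → Plane}

lemma image_eq_of_eqOn (hd : d.IsAdmissible) (h : EqOn T T' (closure d.Ωhat)) :
    T '' d.Ω = T' '' d.Ω :=
  (h.mono (hd.subset_hat.trans subset_closure)).image_eq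

lemma normalJump_congr (hd : d.IsAdmissible) (h : EqOn T T' (closure d.Ωhat)) (F : Finset Plane) :
    d.normalJump T F = d.normalJump T' F := by
  funext G x
  refine finsum_mem_congr rfl fun K hK => ?_
  rw [(h.mono (cell_subset_hat hd hK.1)).image_eq]

lemma a_congr (hd : d.IsAdmissible) (h : EqOn T T' (closure d.Ωhat)) : d.a T = d.a T' := by
  have hg : d.ghost T = d.ghost T' := by
    funext w v
    refine finsum_mem_congr rfl fun F hF => ?_
    rw [(h.mono (face_subset_hat hd hF.1)).image_eq, normalJump_congr hd h]
  funext w v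
  rw [a, a, Γfree, Γfree, image_eq_of_eqOn hd h, hg]

lemma memVhMapped_congr (hd : d.IsAdmissible) (h : EqOn T T' (closure d.Ωhat)) :
    d.MemVhMapped T = d.MemVhMapped T' := by
  have key : ∀ {T T' : Plane → Plane}, EqOn T T' (closure d.Ωhat) → ∀ v,
      d.MemVhMapped T v → d.MemVhMapped T' v := by
    intro T T' h v hv
    refine ⟨hv.1.congr ?_, fun K hK => ?_⟩
    · filter_upwards [ae_restrict_mem hd.isOpen.measurableSet] with x hx
      exact congrArg v (h (subset_closure (hd.subset_hat hx)))
    · obtain ⟨a, ha⟩ := hv.2 K hK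
      refine ⟨a, fun y hy => ?_⟩
      rw [← ha hy]
      exact congrArg v (h (cell_subset_hat hd hK.1 hy)).symm
  funext v
  exact propext ⟨key h v, key h.symm v⟩

lemma isPrimal_congr (hd : d.IsAdmissible) (h : EqOn T T' (closure d.Ωhat)) (g : Data) :
    d.IsPrimal g T = d.IsPrimal g T' := by
  funext u
  simp only [IsPrimal, memVhMapped_congr hd h, a_congr hd h, l, image_eq_of_eqOn hd h]

lemma isDual_congr (hd : d.IsAdmissible) (h : EqOn T T' (closure d.Ωhat)) (g : Data) :
    d.IsDual g T = d.IsDual g T' := by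
  funext u p
  simp only [IsDual, memVhMapped_congr hd h, a_congr hd h, image_eq_of_eqOn hd h]

lemma lagrangian_congr (hd : d.IsAdmissible) (h : EqOn T T' (closure d.Ωhat)) (g : Data) :
    d.lagrangian g T = d.lagrangian g T' := by
  funext u p
  simp only [lagrangian, a_congr hd h, l, image_eq_of_eqOn hd h]

variable [Fintype d.active] {θ ψ : Plane → Plane}

/-- The derivative formula contains `Dθ`, so agreement near each point of the closed domain is
required, not only at the point. -/
lemma formLDeriv_congr (hd : d.IsAdmissible) (h : ∀ x ∈ closure d.Ωhat, ψ =ᶠ[𝓝 x] θ) (g : Data)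
    (α : d.Coeff) : d.formLDeriv g ψ α = d.formLDeriv g θ α := by
  refine setIntegral_congr_fun hd.isOpen.measurableSet fun x hx => ?_
  have hx' := h x (subset_closure (hd.subset_hat hx))
  simp only [div_congr hx', hx'.eq_of_nhds]

lemma formADeriv_congr (hd : d.IsAdmissible) (h : ∀ x ∈ closure d.Ωhat, ψ =ᶠ[𝓝 x] θ)
    (α β : d.Coeff) : d.formADeriv ψ α β = d.formADeriv θ α β := by
  have hΩ : ∀ x ∈ d.Ω, ψ =ᶠ[𝓝 x] θ := fun x hx => h x (subset_closure (hd.subset_hat hx))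
  have hΓ : ∀ x ∈ frontier d.Ω \ d.Γf, ψ =ᶠ[𝓝 x] θ := fun x hx =>
    h x (closure_mono hd.subset_hat (frontier_subset_closure hx.1))
  have e1 : ∫ x in d.Ω, (div ψ x * ⟪(d.bulkJet α x).1, (d.bulkJet β x).1⟫ -
      ⟪S ψ x (d.bulkJet α x).1, (d.bulkJet β x).1⟫) =
      ∫ x in d.Ω, (div θ x * ⟪(d.bulkJet α x).1, (d.bulkJet β x).1⟫ -
        ⟪S θ x (d.bulkJet α x).1, (d.bulkJet β x).1⟫) :=
    setIntegral_congr_fun hd.isOpen.measurableSet fun x hx => by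
      simp only [div_congr (hΩ x hx), S_congr (hΩ x hx)]
  have e2 : ∀ α β : d.Coeff, ∫ x in frontier d.Ω \ d.Γf,
      fluxDeriv ψ (outerNormal d.Ω x) x (d.boundaryJet α x) (d.boundaryJet β x) ∂μH[1] =
      ∫ x in frontier d.Ω \ d.Γf,
        fluxDeriv θ (outerNormal d.Ω x) x (d.boundaryJet α x) (d.boundaryJet β x) ∂μH[1] :=
    fun α β => setIntegral_congr_fun d.measurableSet_free fun x hx => by
      simp only [fluxDeriv, div_congr (hΓ x hx), S_congr (hΓ x hx)]
  have e3 : ∫ x in frontier d.Ω \ d.Γf, tangentialDiv ψ (outerNormal d.Ω x) x *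
      (d.boundaryJet α x).2 * (d.boundaryJet β x).2 ∂μH[1] =
      ∫ x in frontier d.Ω \ d.Γf, tangentialDiv θ (outerNormal d.Ω x) x *
        (d.boundaryJet α x).2 * (d.boundaryJet β x).2 ∂μH[1] :=
    setIntegral_congr_fun d.measurableSet_free fun x hx => by
      simp only [tangentialDiv_congr (hΓ x hx)]
  rw [formADeriv, formADeriv, e1, e2, e2, e3]
  congr 1
  refine finsum_mem_congr rfl fun F hF => ?_
  congr 1
  refine setIntegral_congr_fun (isClosed_convexHull_finset F).measurableSet fun x hx => ?_
  have hx' := h x (face_subset_hat hd hF.1 hx)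
  simp only [ghostDeriv, div_congr hx', S_congr hx', tangentialDiv_congr hx']

end Congr

end Discretization

end CutFEM

end

theorem lemma4p7 (d : Discretization) (hd : d.IsAdmissible) (hwp : d.IsWellPosed)
    (g : Data)
    (hf : ∃ U : Set Plane, IsOpen U ∧ closure d.Ω ⊆ U ∧ ContDiffOn ℝ 1 g.f U)
    (hgD : MemLp g.gD 2 (μH[1].restrict d.Γf))
    (hgN : MemHNegHalf d.Γf g.gN)
    (θ : Plane → Plane) (hθ : ContDiff ℝ 1 θ) (hθ0 : ∀ x ∈ d.Γf, θ x = 0) :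
    -- the discrete solutions exist on the perturbed domains and are unique there
    (∀ᶠ t in 𝓝 (0 : ℝ), ∃ u p : Plane → ℝ,
      d.IsPrimal g (perturb θ t) u ∧ d.IsDual g (perturb θ t) u p ∧
      ∀ u' p' : Plane → ℝ,
        d.IsPrimal g (perturb θ t) u' → d.IsDual g (perturb θ t) u' p' →
          u' =ᵐ[volume.restrict (perturb θ t '' d.Ω)] u ∧
          p' =ᵐ[volume.restrict (perturb θ t '' d.Ω)] p) ∧
    -- the shape derivative of the discrete Lagrangian along the discrete solutions
    ∀ u p : ℝ → Plane → ℝ,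
      (∀ᶠ t in 𝓝 (0 : ℝ), d.IsPrimal g (perturb θ t) (u t) ∧
        d.IsDual g (perturb θ t) (u t) (p t)) →
      HasDerivAt (fun t => d.lagrangian g (perturb θ t) (u t) (p t))
        ((∫ x in d.Ω, div θ x * (g.f x * p 0 x - ⟪∇ (u 0) x, ∇ (p 0) x⟫))
          + (∫ x in d.Ω, ⟪∇ (u 0) x, S θ x (∇ (p 0) x)⟫)
          + (∫ x in d.Ω, ⟪∇ g.f x, θ x⟫ * p 0 x)
          + d.nitscheTerm θ (u 0) (p 0)
          + d.nitscheTerm θ (p 0) (u 0)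
          - (∫ x in d.Γfree id, d.β * d.h⁻¹ * tangentialDiv θ (outerNormal d.Ω x) x *
              (trace d.Ω (u 0) x * trace d.Ω (p 0) x) ∂μH[1])
          - ∑ᶠ F ∈ d.interiorFaces, d.γ * d.h * d.faceTerm θ F (u 0) (p 0)) 0 := by
  have : Fintype d.active := hd.finite_active.fintype
  obtain ⟨U, hU, hΩU, hf⟩ := hf
  -- The cutoff makes the field globally Lipschitz. Discrete problem and Lagrangian see the
  -- deformation only on the closure of `Ωhat`, where the two fields give the same `T_t`.
  obtain ⟨ψ, hψ, hc, hψθ⟩ := exists_hasCompactSupport_eventuallyEq hθ hd.isBounded_hat.closure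
  have hψ0 : ∀ x ∈ d.Γf, ψ x = 0 := fun x hx =>
    (hψθ x (frontier_subset_closure hx)).eq_of_nhds.trans (hθ0 x hx)
  have hT : ∀ t, EqOn (perturb ψ t) (perturb θ t) (closure d.Ωhat) := fun t x hx => by
    rw [perturb, perturb, (hψθ x hx).eq_of_nhds]
  constructor
  · filter_upwards [Discretization.eventually_exists_unique hd hwp hU hΩU hf hgD hgN hψ hc hψ0]
      with t ht
    rwa [Discretization.isPrimal_congr hd (hT t), Discretization.isDual_congr hd (hT t),
      Discretization.image_eq_of_eqOn hd (hT t)] at ht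
  · intro u p hup
    have hup' : ∀ᶠ t in 𝓝 (0 : ℝ), d.IsPrimal g (perturb ψ t) (u t) ∧
        d.IsDual g (perturb ψ t) (u t) (p t) := hup.mono fun t ht => by
      rwa [Discretization.isPrimal_congr hd (hT t), Discretization.isDual_congr hd (hT t)]
    obtain ⟨α, β, hα, hβ, h⟩ :=
      Discretization.hasDerivAt_lagrangian hd hwp hU hΩU hf hgD hgN hψ hc hψ0 hup'
    simp only [Discretization.lagrangian_congr hd (hT _)] at h
    -- In coefficients the derivative returns from `ψ` to `θ`, and only then is it rewritten in
    -- terms of `u 0` and `p 0`.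
    rwa [Discretization.formLDeriv_congr hd hψθ, Discretization.formADeriv_congr hd hψθ,
      ← Discretization.shapeDeriv_eq hd hθ hU hΩU hf hα hβ] at h
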